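/- Let $N\ge 1$, let $\Omega\subset\mathbb R^N$ be a bounded domain (nonempty, open, connected), let $1<p<2$ and $\lambda>0$. Put $X=W_0^{1,p}(\Omega)\cap L^2(\Omega)$ with norm $\|w\|_X=\|w\|_{W^{1,p}(\Omega)}+\|w\|_{L^2(\Omega)}$, where $W^{1,p}_0(\Omega)$ is the closure of $C_c^\infty(\Omega)$ in $W^{1,p}(\Omega)$. For $h\in C(\overline\Omega)$ consider the elliptic problem $$-\Delta_p w=\lambda|w|^{p-2}w-w+h(x)\ \text{ in }\Omega,\qquad w=0\ \text{ on }\partial\Omega, \tag{1}$$ and its energy on $X$, $$E_\lambda(w)=\frac1p\int_\Omega|\nabla w|^p\,dx-\frac\lambda p\int_\Omega|w|^p\,dx+\frac12\int_\Omega|w|^2\,dx-\int_\Omega h\,w\,dx .$$ For $T>0$, $f\in L^\infty(\Omega\times(0,T))$ and $g_0\in X$ consider the parabolic problem $$\partial_tu-\Delta_pu=\lambda|u|^{p-2}u+f\ \text{ in }\Omega\times(0,T),\qquad u(\cdot,0)=g_0\ \text{ in }\Omega,\qquad u=0\ \text{ on }\partial\Omega\times(0,T). \tag{2}$$ A weak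 solution of (2) is a function $u\in C([0,T]\to L^2(\Omega))\cap L^p((0,T)\to W_0^{1,p}(\Omega))$ with $u(\cdot,0)=g_0$ and $$\int_\Omega u\varphi\,dx\Big|_{t=0}^{t=\tau}+\int_0^\tau\!\!\int_\Omega\left(-u\,\partial_t\varphi+|\nabla u|^{p-2}\langle\nabla u,\nabla\varphi\rangle\right)dx\,dt=\lambda\int_0^\tau\!\!\int_\Omega|u|^{p-2}u\varphi\,dx\,dt+\int_0^\tau\!\!\int_\Omega f\varphi\,dx\,dt$$ for all $\tau\in(0,T]$ and all $\varphi\in W^{1,2}((0,\tau)\to L^2(\Omega))\cap L^p((0,\tau)\to W_0^{1,p}(\Omega))$. Let $v(t)=((2-p)t)^{1/(2-p)}$ for $t\ge 0$; it is continuous on $[0,\infty)$, positive for $t>0$, and solves $v'=|v|^{p-2}v$ for $t>0$, $v(0)=0$. Then there exist $h\in C(\overline\Omega)$, taking both positive and negative values in $\Omega$, and $w_0,w_1\in X$ such that: 1. $w_0\not\equiv0$ is a $C^2$ function with compact support in $\Omega$; the vector field $|\nabla w_0|^{p-2}\nabla w_0$ is differentiable in $\Omega$ and $w_0$ satisfies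 (1) at every point of $\Omega$; $w_0$ is a weak solution of (1) and a critical point of $E_\lambda$ (the Fréchet derivative on $X$ vanishes at $w_0$), but it is not a local minimizer of $E_\lambda$ in $X$ (in particular, not a global one); 2. $w_1\not\equiv 0$ is a weak solution of (1), a critical point of $E_\lambda$, and a global minimizer of $E_\lambda$ on $X$; 3. $w_0\ne w_1$, i.e. they differ on a subset of $\Omega$ of positive measure; 4. for every $T>0$, the functions $u_0(x,t)=w_0(x)v(t)$ and $u_1(x,t)=w_1(x)v(t)$ are both weak solutions of (2) with the same source $f(x,t)=h(x)|v(t)|^{p-2}v(t)$ and zero initial data $g_0=0$, and they do not coincide a.e. in $\Omega\times(0,T)$. Consequently the weak comparison principle fails for (2) on $\Omega\times(0,T)$: it is not true that any two weak solutions $u,\tilde u$ of (2) whose sources satisfy $f\le\tilde f$ a.e. and whose initial data satisfy $g_0\le\tilde g_0$ a.e. must satisfy $u\le\tilde u$ a.e. in $\Omega\times(0,T)$. -/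

import Mathlib

open MeasureTheory Set Filter Topology

noncomputable section

namespace PLap

/-- Euclidean space `ℝ^N`. -/
abbrev Eu (N : ℕ) : Type := EuclideanSpace ℝ (Fin N)

/-- Lebesgue measure on `Ω`. -/
abbrev leb {N : ℕ} (Ω : Set (Eu N)) : Measure (Eu N) := volume.restrict Ω

/-- Lebesgue measure on the cylinder `Ω × (0, T)`; points are written `(t, x)`. -/
abbrev cyl {N : ℕ} (T : ℝ) (Ω : Set (Eu N)) : Measure (ℝ × Eu N) :=
  (volume.restrict (Ioo (0 : ℝ) T)).prod (leb Ω)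

/-! ### Sobolev spaces -/

/-- `φ ∈ C_c^∞(Ω)`. -/
def IsTestFn {N : ℕ} (Ω : Set (Eu N)) (φ : Eu N → ℝ) : Prop :=
  ContDiff ℝ ((⊤ : ℕ∞) : WithTop ℕ∞) φ ∧ HasCompactSupport φ ∧ tsupport φ ⊆ Ω

/-- `G` is the weak (distributional) gradient of `w` in the open set `Ω`. -/
def HasWeakGrad {N : ℕ} (Ω : Set (Eu N)) (w : Eu N → ℝ) (G : Eu N → Eu N) : Prop :=
  LocallyIntegrableOn w Ω ∧ LocallyIntegrableOn G Ω ∧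
    ∀ φ : Eu N → ℝ, IsTestFn Ω φ →
      ∫ x in Ω, w x • gradient φ x = - ∫ x in Ω, φ x • G x

/-- `w ∈ W₀^{1,p}(Ω)` with weak gradient `G`: the function `w` lies in `W^{1,p}(Ω)` and is the
limit in `W^{1,p}(Ω)` of a sequence in `C_c^∞(Ω)`. -/
def IsW0 {N : ℕ} (p : ℝ) (Ω : Set (Eu N)) (w : Eu N → ℝ) (G : Eu N → Eu N) : Prop :=
  HasWeakGrad Ω w G ∧
  MemLp w (ENNReal.ofReal p) (leb Ω) ∧ MemLp G (ENNReal.ofReal p) (leb Ω) ∧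
  ∃ φ : ℕ → Eu N → ℝ, (∀ n, IsTestFn Ω (φ n)) ∧
    Tendsto (fun n => eLpNorm (fun x => φ n x - w x) (ENNReal.ofReal p) (leb Ω)) atTop (𝓝 0) ∧
    Tendsto (fun n => eLpNorm (fun x => gradient (φ n) x - G x) (ENNReal.ofReal p) (leb Ω))
      atTop (𝓝 0)

/-- The space `X = W₀^{1,p}(Ω) ∩ L²(Ω)`. -/
def MemX {N : ℕ} (p : ℝ) (Ω : Set (Eu N)) (w : Eu N → ℝ) : Prop :=
  (∃ G, IsW0 p Ω w G) ∧ MemLp w 2 (leb Ω)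

open Classical in
/-- The weak gradient of `w` in `Ω` (unique a.e. in `Ω` when it exists, and `0` otherwise). -/
def weakGrad {N : ℕ} (Ω : Set (Eu N)) (w : Eu N → ℝ) : Eu N → Eu N :=
  if h : ∃ G, HasWeakGrad Ω w G then h.choose else 0

/-- The norm of `X`: the sum of the norms of `W^{1,p}(Ω)` and of `L²(Ω)`. -/
def xNorm {N : ℕ} (p : ℝ) (Ω : Set (Eu N)) (w : Eu N → ℝ) : ℝ :=
  (eLpNorm w (ENNReal.ofReal p) (leb Ω)).toReal +
  (eLpNorm (weakGrad Ω w) (ENNReal.ofReal p) (leb Ω)).toReal +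
  (eLpNorm w 2 (leb Ω)).toReal

/-! ### The elliptic problem `-Δ_p w = λ |w|^{p-2} w - w + h` in `Ω`, `w = 0` on `∂Ω` -/

/-- The vector field `|∇w|^{p-2} ∇w`. -/
def pFlux {N : ℕ} (p : ℝ) (w : Eu N → ℝ) (x : Eu N) : Eu N :=
  ‖gradient w x‖ ^ (p - 2) • gradient w x

/-- The pointwise `p`-Laplacian `div (|∇w|^{p-2} ∇w)`. -/
def pLaplacian {N : ℕ} (p : ℝ) (w : Eu N → ℝ) (x : Eu N) : ℝ :=
  ∑ i : Fin N, (fderiv ℝ (pFlux p w) x (EuclideanSpace.single i 1)) i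

/-- The energy functional of the elliptic problem. -/
def energy {N : ℕ} (p lam : ℝ) (Ω : Set (Eu N)) (h w : Eu N → ℝ) : ℝ :=
  1 / p * (∫ x in Ω, ‖weakGrad Ω w x‖ ^ p) - lam / p * (∫ x in Ω, |w x| ^ p)
    + 1 / 2 * (∫ x in Ω, |w x| ^ 2) - ∫ x in Ω, h x * w x

/-- `w ∈ X` is a weak solution of the elliptic problem. -/
def IsEllipticSol {N : ℕ} (p lam : ℝ) (Ω : Set (Eu N)) (h w : Eu N → ℝ) : Prop :=
  MemX p Ω w ∧ ∀ φ : Eu N → ℝ, MemX p Ω φ →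
    ∫ x in Ω, ‖weakGrad Ω w x‖ ^ (p - 2) * inner ℝ (weakGrad Ω w x) (weakGrad Ω φ x)
      = lam * (∫ x in Ω, |w x| ^ (p - 2) * w x * φ x) - (∫ x in Ω, w x * φ x)
        + ∫ x in Ω, h x * φ x

/-- `w ∈ X` is a critical point of the energy: its Fréchet derivative on `X` at `w` is zero. -/
def IsCriticalPt {N : ℕ} (p lam : ℝ) (Ω : Set (Eu N)) (h w : Eu N → ℝ) : Prop :=
  MemX p Ω w ∧ ∀ ε > 0, ∃ δ > 0, ∀ φ : Eu N → ℝ, MemX p Ω φ → xNorm p Ω φ < δ →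
    |energy p lam Ω h (fun x => w x + φ x) - energy p lam Ω h w| ≤ ε * xNorm p Ω φ

/-- `w ∈ X` is a local minimizer of the energy on `X`. -/
def IsLocalMinimizer {N : ℕ} (p lam : ℝ) (Ω : Set (Eu N)) (h w : Eu N → ℝ) : Prop :=
  MemX p Ω w ∧ ∃ δ > 0, ∀ φ : Eu N → ℝ, MemX p Ω φ → xNorm p Ω φ < δ →
    energy p lam Ω h w ≤ energy p lam Ω h (fun x => w x + φ x)

/-- `w ∈ X` is a global minimizer of the energy on `X`. -/
def IsGlobalMinimizer {N : ℕ} (p lam : ℝ) (Ω : Set (Eu N)) (h w : Eu N → ℝ) : Prop :=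
  MemX p Ω w ∧ ∀ φ : Eu N → ℝ, MemX p Ω φ → energy p lam Ω h w ≤ energy p lam Ω h φ

/-! ### The parabolic problem `∂_t u - Δ_p u = λ |u|^{p-2} u + f` in `Ω × (0, T)`, with
`u(·, 0) = u₀` in `Ω` and `u = 0` on `∂Ω × (0, T)` -/

/-- `u ∈ C([0, T] → L²(Ω))`. -/
def IsContL2 {N : ℕ} (T : ℝ) (Ω : Set (Eu N)) (u : ℝ → Eu N → ℝ) : Prop :=
  (∀ t ∈ Icc 0 T, MemLp (u t) 2 (leb Ω)) ∧
  ∀ t ∈ Icc 0 T,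
    Tendsto (fun s => eLpNorm (fun x => u s x - u t x) 2 (leb Ω)) (𝓝[Icc 0 T] t) (𝓝 0)

/-- `u ∈ L^p((0, T) → W₀^{1,p}(Ω))` with spatial gradient `G`. -/
def IsLpW0 {N : ℕ} (p T : ℝ) (Ω : Set (Eu N)) (u : ℝ → Eu N → ℝ) (G : ℝ → Eu N → Eu N) : Prop :=
  MemLp (fun z : ℝ × Eu N => u z.1 z.2) (ENNReal.ofReal p) (cyl T Ω) ∧
  MemLp (fun z : ℝ × Eu N => G z.1 z.2) (ENNReal.ofReal p) (cyl T Ω) ∧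
  ∀ᵐ t ∂(volume.restrict (Ioo (0 : ℝ) T)), IsW0 p Ω (u t) (G t)

/-- `φ ∈ W^{1,2}((0, T) → L²(Ω))` with time derivative `ψ`. The function `φ` is the continuous
representative: `φ(t) = φ(0) + ∫₀ᵗ ψ(s) ds` in `L²(Ω)` for all `t ∈ [0, T]`. -/
def IsW12L2 {N : ℕ} (T : ℝ) (Ω : Set (Eu N)) (φ ψ : ℝ → Eu N → ℝ) : Prop :=
  MemLp (fun z : ℝ × Eu N => φ z.1 z.2) 2 (cyl T Ω) ∧
  MemLp (fun z : ℝ × Eu N => ψ z.1 z.2) 2 (cyl T Ω) ∧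
  ∀ t ∈ Icc 0 T, MemLp (φ t) 2 (leb Ω) ∧
    ∀ᵐ x ∂(leb Ω), φ t x = φ 0 x + ∫ s in (0 : ℝ)..t, ψ s x

/-- `u` is a weak solution of the parabolic problem with source `f ∈ L^∞(Ω × (0, T))`, initial
value `u₀ ∈ W₀^{1,p}(Ω) ∩ L²(Ω)` and zero lateral boundary values. -/
def IsParabolicSol {N : ℕ} (p lam T : ℝ) (Ω : Set (Eu N)) (f : ℝ → Eu N → ℝ)
    (u₀ : Eu N → ℝ) (u : ℝ → Eu N → ℝ) : Prop :=
  MemLp (fun z : ℝ × Eu N => f z.1 z.2) ⊤ (cyl T Ω) ∧ MemX p Ω u₀ ∧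
  IsContL2 T Ω u ∧ u 0 =ᵐ[leb Ω] u₀ ∧
  ∃ G : ℝ → Eu N → Eu N, IsLpW0 p T Ω u G ∧
    ∀ τ ∈ Ioc 0 T, ∀ (φ ψ : ℝ → Eu N → ℝ) (Φ : ℝ → Eu N → Eu N),
      IsW12L2 τ Ω φ ψ → IsLpW0 p τ Ω φ Φ →
      (∫ x in Ω, u τ x * φ τ x) - (∫ x in Ω, u 0 x * φ 0 x)
        + ∫ z, (-(u z.1 z.2 * ψ z.1 z.2)
            + ‖G z.1 z.2‖ ^ (p - 2) * inner ℝ (G z.1 z.2) (Φ z.1 z.2)) ∂(cyl τ Ω)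
      = lam * (∫ z, |u z.1 z.2| ^ (p - 2) * u z.1 z.2 * φ z.1 z.2 ∂(cyl τ Ω))
        + ∫ z, f z.1 z.2 * φ z.1 z.2 ∂(cyl τ Ω)

/-- The weak comparison principle for the parabolic problem: ordered sources and ordered initial
values give ordered weak solutions. -/
def WeakComparisonPrinciple {N : ℕ} (p lam T : ℝ) (Ω : Set (Eu N)) : Prop :=
  ∀ (f g : ℝ → Eu N → ℝ) (u₀ v₀ : Eu N → ℝ) (u v : ℝ → Eu N → ℝ),
    IsParabolicSol p lam T Ω f u₀ u → IsParabolicSol p lam T Ω g v₀ v →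
    (∀ᵐ z ∂(cyl T Ω), f z.1 z.2 ≤ g z.1 z.2) → (∀ᵐ x ∂(leb Ω), u₀ x ≤ v₀ x) →
    ∀ᵐ z ∂(cyl T Ω), u z.1 z.2 ≤ v z.1 z.2

/-- The function `v(t) = ((2 - p) t)^{1/(2-p)}`. -/
def profile (p t : ℝ) : ℝ := ((2 - p) * t) ^ (1 / (2 - p))

end PLap

end

/-!
# Nonuniqueness and failure of the weak comparison principle for `∂_t u - Δ_p u = λ |u|^{p-2} u + f`

Since `v' = |v|^{p-2} v` for the profile `v`, and both nonlinear terms are homogeneous of degree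
`p - 1`, the product `w(x) v(t)` solves the parabolic problem with source `h(x) |v|^{p-2} v` as soon
as `w` solves the elliptic problem with source `h` (`IsEllipticSol.isParabolicSol`). As `v(0) = 0`,
two different solutions of one elliptic problem give two parabolic solutions with the same data, and
then no comparison principle can hold.

The two elliptic solutions are told apart by their energy.

* The solution `w₀` is prescribed and `h` is read off from the equation. It is a smooth radial
  function supported in an annulus inside a ball in `Ω`; its radial slopes are bumps built from
  `exp (-1 / s)`, all of whose positive powers are smooth, so that the flux `|∇w₀|^{p-2} ∇w₀` is
  smooth although `p < 2` (`exists_classical_candidate`). On two plateaus of heights `± c` the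
  source is `± (c - λ c^{p-1})`, which has the sign of `± 1` for large `c`.
* `w₀` is not a local minimizer (`not_isLocalMinimizer`). Perturb it by `t φ`, where `φ = 1` on a
  ball on which `w₀ = 0` and `∇φ` lives where `∇w₀` is bounded away from zero. The gradient and
  quadratic terms then cost `O(t^2)`, while the term `-λ/p |w|^p` gains at least a multiple of
  `t^p`, and `p < 2`.
* The energy has a global minimizer `w₁` (`exists_isGlobalMinimizer`). It is bounded below because
  the quadratic term dominates `|w|^p`. A minimizing sequence is precompact in `L¹`
  (`exists_subseq_cauchy_eLpNorm_one`: averages over small balls are uniformly `L¹`-close to the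
  functions and converge along a subsequence by weak compactness in `L²`), hence in `L^p` by
  interpolation with the `L²` bound. The remaining part of the energy is uniformly convex
  (`exists_norm_sub_rpow_le`), which upgrades this to convergence in `X`.

So `w₀ ≠ w₁`, and neither is zero because the zero function does not solve the equation with
`h ≠ 0`. That weak solutions are critical points, and that minimizers are weak solutions, follows
from one expansion of the energy (`energy_add`, `abs_energy_sub_le`).
-/

namespace PLap

/-! ### The pointwise geometry of `‖·‖ ^ p` -/

section Pointwise

variable {E : Type*} [NormedAddCommGroup E] [InnerProductSpace ℝ E]

/-- The first-order Taylor remainder at `a`, with increment `b`, of `‖·‖ ^ p / p`. -/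
noncomputable def taylorRem {E : Type*} [NormedAddCommGroup E] [InnerProductSpace ℝ E]
    (p : ℝ) (a b : E) : ℝ :=
  ‖a + b‖ ^ p / p - ‖a‖ ^ p / p - ‖a‖ ^ (p - 2) * inner ℝ a b

/-- The defect in the midpoint convexity of `‖·‖ ^ p`. -/
noncomputable def midDefect {E : Type*} [NormedAddCommGroup E] [InnerProductSpace ℝ E]
    (p : ℝ) (a b : E) : ℝ :=
  ‖a‖ ^ p + ‖b‖ ^ p - 2 * ‖(1 / 2 : ℝ) • (a + b)‖ ^ p

lemma rpow_sub_one_mul_le {p x y : ℝ} (hp : 1 < p) (hx : 0 ≤ x) (hy : 0 ≤ y) :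
    x ^ (p - 1) * y ≤ x ^ p + y ^ p := by
  have key : ∀ z : ℝ, 0 ≤ z → z ^ (p - 1) * z = z ^ p := fun z hz => by
    rcases hz.eq_or_lt with rfl | hz
    · rw [Real.zero_rpow (by linarith : p ≠ 0), mul_zero]
    · rw [← Real.rpow_add_one hz.ne']; ring_nf
  rcases le_total x y with h | h
  · have h1 : x ^ (p - 1) * y ≤ y ^ (p - 1) * y :=
      mul_le_mul_of_nonneg_right (Real.rpow_le_rpow hx h (by linarith)) hy
    rw [key y hy] at h1
    linarith [Real.rpow_nonneg hx p]
  · have h1 : x ^ (p - 1) * y ≤ x ^ (p - 1) * x :=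
      mul_le_mul_of_nonneg_left h (Real.rpow_nonneg hx _)
    rw [key x hx] at h1
    linarith [Real.rpow_nonneg hy p]

lemma abs_norm_rpow_mul_inner_le (p : ℝ) (a b : E) :
    |‖a‖ ^ (p - 2) * inner ℝ a b| ≤ ‖a‖ ^ (p - 1) * ‖b‖ := by
  rcases eq_or_ne a 0 with rfl | ha
  · simp only [inner_zero_left, mul_zero, abs_zero]; positivity
  · have ha' : 0 < ‖a‖ := norm_pos_iff.2 ha
    have : ‖a‖ ^ (p - 1) = ‖a‖ ^ (p - 2) * ‖a‖ := by
      rw [← Real.rpow_add_one ha'.ne']; ring_nf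
    rw [abs_mul, abs_of_nonneg (Real.rpow_nonneg (norm_nonneg _) _), this, mul_assoc]
    exact mul_le_mul_of_nonneg_left (abs_real_inner_le_norm a b)
      (Real.rpow_nonneg (norm_nonneg _) _)

lemma abs_norm_rpow_mul_inner_le_add {p : ℝ} (hp : 1 < p) (a b : E) :
    |‖a‖ ^ (p - 2) * inner ℝ a b| ≤ ‖a‖ ^ p + ‖b‖ ^ p :=
  (abs_norm_rpow_mul_inner_le p a b).trans
    (rpow_sub_one_mul_le hp (norm_nonneg _) (norm_nonneg _))

/-- Convexity of `‖·‖ ^ p`, by Bernoulli's inequality for the ratio `‖a + b‖ / ‖a‖`. -/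
lemma taylorRem_nonneg {p : ℝ} (hp : 1 < p) (a b : E) : 0 ≤ taylorRem p a b := by
  unfold taylorRem
  rcases eq_or_ne a 0 with rfl | ha
  · simp only [zero_add, norm_zero, inner_zero_left, mul_zero, sub_zero]
    rw [Real.zero_rpow (by linarith : p ≠ 0), zero_div]
    have := Real.rpow_nonneg (norm_nonneg b) p
    have : 0 ≤ ‖b‖ ^ p / p := by positivity
    linarith
  · have ha' : 0 < ‖a‖ := norm_pos_iff.2 ha
    set x := ‖a + b‖ with hx
    have h1 : ‖a‖ * x ≥ ‖a‖ ^ 2 + inner ℝ a b := by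
      have := real_inner_le_norm a (a + b)
      rw [inner_add_right, real_inner_self_eq_norm_sq] at this
      linarith
    have h2 := one_add_mul_self_le_rpow_one_add (s := x / ‖a‖ - 1)
      (by have : 0 ≤ x / ‖a‖ := by positivity
          linarith) hp.le
    rw [add_sub_cancel, Real.div_rpow (norm_nonneg _) (norm_nonneg _),
      le_div_iff₀ (Real.rpow_pos_of_pos ha' p)] at h2
    have e1 : ‖a‖ ^ p = ‖a‖ ^ (p - 2) * ‖a‖ ^ 2 := by
      rw [← Real.rpow_natCast, ← Real.rpow_add ha']; norm_num
    have h3 : (x / ‖a‖ - 1) * ‖a‖ ^ p ≥ ‖a‖ ^ (p - 2) * inner ℝ a b := by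
      have : (x / ‖a‖ - 1) * ‖a‖ ^ p = ‖a‖ ^ (p - 2) * (‖a‖ * x - ‖a‖ ^ 2) := by
        rw [e1]; field_simp
      rw [this]
      exact mul_le_mul_of_nonneg_left (by linarith) (Real.rpow_nonneg (norm_nonneg _) _)
    have h4 : ‖a‖ ^ p + p * (‖a‖ ^ (p - 2) * inner ℝ a b) ≤ x ^ p := by nlinarith
    have h5 : x ^ p / p - ‖a‖ ^ p / p - ‖a‖ ^ (p - 2) * inner ℝ a b
        = (x ^ p - (‖a‖ ^ p + p * (‖a‖ ^ (p - 2) * inner ℝ a b))) / p := by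
      field_simp; ring
    rw [h5]
    exact div_nonneg (by linarith) (by linarith)

/-- Away from `a = 0` the remainder is quadratic: `‖·‖ ^ p` is the concave power `p / 2` of
the quadratic form `‖·‖ ^ 2`. -/
lemma taylorRem_le_sq {p : ℝ} (hp : 1 < p) (hp2 : p < 2) {a : E} (ha : a ≠ 0) (b : E) :
    taylorRem p a b ≤ 1 / 2 * (‖a‖ ^ (p - 2) * ‖b‖ ^ 2) := by
  unfold taylorRem
  have ha' : 0 < ‖a‖ := norm_pos_iff.2 ha
  have hsq : ‖a + b‖ ^ 2 = ‖a‖ ^ 2 * (1 + (2 * inner ℝ a b + ‖b‖ ^ 2) / ‖a‖ ^ 2) := by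
    rw [norm_add_sq_real]; field_simp; ring
  set s := (2 * inner ℝ a b + ‖b‖ ^ 2) / ‖a‖ ^ 2 with hs
  have hs1 : -1 ≤ s := by
    have : 0 ≤ ‖a‖ ^ 2 * (1 + s) := by rw [← hsq]; positivity
    have := nonneg_of_mul_nonneg_right this (by positivity)
    linarith
  have h2 := rpow_one_add_le_one_add_mul_self hs1 (by linarith : 0 ≤ p / 2)
    (by linarith : p / 2 ≤ 1)
  have e2 : ∀ y : ℝ, 0 ≤ y → y ^ p = (y ^ 2) ^ (p / 2) := fun y hy => by
    rw [← Real.rpow_natCast, ← Real.rpow_mul hy]; congr 1; push_cast; ring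
  have e1 : ‖a‖ ^ p = ‖a‖ ^ (p - 2) * ‖a‖ ^ 2 := by
    rw [← Real.rpow_natCast, ← Real.rpow_add ha']; norm_num
  have h3 : ‖a + b‖ ^ p ≤ ‖a‖ ^ p * (1 + p / 2 * s) := by
    rw [e2 _ (norm_nonneg (a + b)), hsq, Real.mul_rpow (by positivity) (by linarith),
      ← e2 _ (norm_nonneg a)]
    exact mul_le_mul_of_nonneg_left h2 (by positivity)
  have h4 : ‖a‖ ^ p * (1 + p / 2 * s)
      = ‖a‖ ^ p + p / 2 * (‖a‖ ^ (p - 2) * (2 * inner ℝ a b + ‖b‖ ^ 2)) := by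
    rw [hs, e1]; field_simp
  have h5 : ‖a + b‖ ^ p / p ≤
      ‖a‖ ^ p / p + 1 / 2 * (‖a‖ ^ (p - 2) * (2 * inner ℝ a b + ‖b‖ ^ 2)) := by
    rw [h4] at h3
    rw [div_le_iff₀ (by linarith)]
    have : (‖a‖ ^ p / p + 1 / 2 * (‖a‖ ^ (p - 2) * (2 * inner ℝ a b + ‖b‖ ^ 2))) * p
      = ‖a‖ ^ p + p / 2 * (‖a‖ ^ (p - 2) * (2 * inner ℝ a b + ‖b‖ ^ 2)) := by
      field_simp
    linarith
  linarith

/-- The remainder is of order `‖b‖ ^ p` uniformly in `a`: directly if `‖a‖ ≤ ‖b‖`, and from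
the quadratic bound otherwise, since `p - 2 < 0`. -/
lemma taylorRem_le {p : ℝ} (hp : 1 < p) (hp2 : p < 2) (a b : E) :
    taylorRem p a b ≤ 5 * ‖b‖ ^ p := by
  have hb0 := Real.rpow_nonneg (norm_nonneg b) p
  rcases le_or_gt ‖a‖ ‖b‖ with h | h
  · unfold taylorRem
    have h1 : ‖a + b‖ ^ p ≤ 4 * ‖b‖ ^ p := by
      have : ‖a + b‖ ≤ 2 * ‖b‖ := (norm_add_le a b).trans (by linarith)
      calc ‖a + b‖ ^ p ≤ (2 * ‖b‖) ^ p := Real.rpow_le_rpow (norm_nonneg _) this (by linarith)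
        _ = 2 ^ p * ‖b‖ ^ p := Real.mul_rpow (by norm_num) (norm_nonneg _)
        _ ≤ 4 * ‖b‖ ^ p := by
          refine mul_le_mul_of_nonneg_right ?_ hb0
          calc (2 : ℝ) ^ p ≤ 2 ^ (2 : ℝ) :=
                Real.rpow_le_rpow_of_exponent_le (by norm_num) hp2.le
            _ = 4 := by norm_num
    have h1' : ‖a + b‖ ^ p / p ≤ 4 * ‖b‖ ^ p :=
      (div_le_self (by positivity) hp.le).trans h1
    have h2 : ‖a‖ ^ (p - 1) * ‖b‖ ≤ ‖b‖ ^ p := by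
      rcases (norm_nonneg b).eq_or_lt with hb | hb
      · rw [← hb]; simp [Real.zero_rpow (by linarith : p ≠ 0)]
      · calc ‖a‖ ^ (p - 1) * ‖b‖ ≤ ‖b‖ ^ (p - 1) * ‖b‖ := mul_le_mul_of_nonneg_right
              (Real.rpow_le_rpow (norm_nonneg _) h (by linarith)) hb.le
          _ = ‖b‖ ^ p := by rw [← Real.rpow_add_one hb.ne']; ring_nf
    have h3 := abs_le.1 (abs_norm_rpow_mul_inner_le p a b)
    have h4 : 0 ≤ ‖a‖ ^ p / p := by positivity
    linarith [h3.1]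
  · have ha : a ≠ 0 := norm_pos_iff.1 ((norm_nonneg b).trans_lt h)
    refine (taylorRem_le_sq hp hp2 ha b).trans ?_
    rcases (norm_nonneg b).eq_or_lt with hb | hb
    · rw [← hb]; simp [Real.zero_rpow (by linarith : p ≠ 0)]
    · have h1 : ‖a‖ ^ (p - 2) * ‖b‖ ^ 2 ≤ ‖b‖ ^ (p - 2) * ‖b‖ ^ 2 :=
        mul_le_mul_of_nonneg_right
          (Real.rpow_le_rpow_of_nonpos hb h.le (by linarith)) (by positivity)
      have h2 : ‖b‖ ^ (p - 2) * ‖b‖ ^ 2 = ‖b‖ ^ p := by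
        rw [← Real.rpow_natCast ‖b‖ 2, ← Real.rpow_add hb]; norm_num
      linarith

/-- The midpoint defect is `p` times the sum of the Taylor remainders at the midpoint. -/
lemma midDefect_nonneg {p : ℝ} (hp : 1 < p) (a b : E) : 0 ≤ midDefect p a b := by
  have h1 := taylorRem_nonneg hp ((1 / 2 : ℝ) • (a + b)) ((1 / 2 : ℝ) • (a - b))
  have h2 := taylorRem_nonneg hp ((1 / 2 : ℝ) • (a + b)) (-((1 / 2 : ℝ) • (a - b)))
  have e1 : (1 / 2 : ℝ) • (a + b) + (1 / 2 : ℝ) • (a - b) = a := by module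
  have e2 : (1 / 2 : ℝ) • (a + b) + -((1 / 2 : ℝ) • (a - b)) = b := by module
  unfold taylorRem at h1 h2
  rw [e1] at h1
  rw [e2, inner_neg_right] at h2
  have : 0 ≤ midDefect p a b / p := by
    have e : midDefect p a b / p = ‖a‖ ^ p / p + ‖b‖ ^ p / p
        - 2 * (‖(1 / 2 : ℝ) • (a + b)‖ ^ p / p) := by
      unfold midDefect; ring
    rw [e]; linarith
  have hp0 : 0 < p := by linarith
  calc 0 ≤ midDefect p a b / p * p := by positivity
    _ = _ := by field_simp

lemma midDefect_le {p : ℝ} (hp : 1 < p) (hp2 : p < 2) (a b : E) :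
    midDefect p a b ≤ 20 * ‖a - b‖ ^ p := by
  have h1 := taylorRem_le hp hp2 ((1 / 2 : ℝ) • (a + b)) ((1 / 2 : ℝ) • (a - b))
  have h2 := taylorRem_le hp hp2 ((1 / 2 : ℝ) • (a + b)) (-((1 / 2 : ℝ) • (a - b)))
  have e1 : (1 / 2 : ℝ) • (a + b) + (1 / 2 : ℝ) • (a - b) = a := by module
  have e2 : (1 / 2 : ℝ) • (a + b) + -((1 / 2 : ℝ) • (a - b)) = b := by module
  have e3 : ‖(1 / 2 : ℝ) • (a - b)‖ ^ p ≤ ‖a - b‖ ^ p := by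
    refine Real.rpow_le_rpow (norm_nonneg _) ?_ (by linarith)
    rw [norm_smul]; norm_num; linarith [norm_nonneg (a - b)]
  unfold taylorRem at h1 h2
  rw [e1] at h1
  rw [e2, inner_neg_right, norm_neg] at h2
  have h0 := Real.rpow_nonneg (norm_nonneg (a - b)) p
  have h3 : midDefect p a b / p ≤ 10 * ‖a - b‖ ^ p := by
    have e : midDefect p a b / p = ‖a‖ ^ p / p + ‖b‖ ^ p / p
        - 2 * (‖(1 / 2 : ℝ) • (a + b)‖ ^ p / p) := by
      unfold midDefect; ring
    rw [e]; linarith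
  rw [div_le_iff₀ (by linarith)] at h3
  nlinarith

lemma midDefect_pos {p : ℝ} (hp : 1 < p) {a b : E} (hab : a ≠ b) : 0 < midDefect p a b := by
  unfold midDefect
  rcases eq_or_ne ‖a‖ ‖b‖ with h | h
  · have h1 : ‖(1 / 2 : ℝ) • (a + b)‖ < ‖a‖ := by
      have := norm_combo_lt_of_ne (r := ‖a‖) le_rfl h.ge hab
        (by norm_num : (0 : ℝ) < 1 / 2) (by norm_num : (0 : ℝ) < 1 / 2) (by norm_num)
      rwa [smul_add]
    have := Real.rpow_lt_rpow (norm_nonneg _) h1 (by linarith : 0 < p)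
    rw [← h]; linarith
  · have h1 : ‖(1 / 2 : ℝ) • (a + b)‖ ≤ 1 / 2 * ‖a‖ + 1 / 2 * ‖b‖ := by
      rw [norm_smul]; norm_num; linarith [norm_add_le a b]
    have h2 := (strictConvexOn_rpow hp).2 (norm_nonneg a) (norm_nonneg b) h
      (by norm_num : (0 : ℝ) < 1 / 2) (by norm_num : (0 : ℝ) < 1 / 2) (by norm_num)
    simp only [smul_eq_mul] at h2
    have := Real.rpow_le_rpow (norm_nonneg _) h1 (by linarith : 0 ≤ p)
    linarith

lemma midDefect_smul {p t : ℝ} (ht : 0 ≤ t) (a b : E) :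
    midDefect p (t • a) (t • b) = t ^ p * midDefect p a b := by
  unfold midDefect
  rw [← smul_add, smul_comm, norm_smul t, norm_smul t, norm_smul t, Real.norm_of_nonneg ht,
    Real.mul_rpow ht (norm_nonneg _), Real.mul_rpow ht (norm_nonneg _),
    Real.mul_rpow ht (norm_nonneg _)]
  ring

/-- A form of uniform convexity of `‖·‖ ^ p`: strict convexity and compactness of the unit sphere
of `E × E`, extended to all pairs by homogeneity. -/
lemma exists_norm_sub_rpow_le [ProperSpace E] {p : ℝ} (hp : 1 < p) {δ : ℝ} (hδ : 0 < δ) :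
    ∃ C > 0, ∀ a b : E, ‖a - b‖ ^ p ≤ δ * (‖a‖ ^ p + ‖b‖ ^ p) + C * midDefect p a b := by
  have hp0 : 0 < p := by linarith
  have hc : ∀ f : E × E → E, Continuous f → Continuous fun z => ‖f z‖ ^ p := fun f hf =>
    hf.norm.rpow_const fun _ => Or.inr hp0.le
  set K : Set (E × E) := {z | ‖z.1‖ ^ p + ‖z.2‖ ^ p = 1 ∧ δ ≤ ‖z.1 - z.2‖ ^ p} with hK
  have hle : ∀ x : ℝ, 0 ≤ x → x ^ p ≤ 1 → x ≤ 1 := fun x hx h => by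
    by_contra! hx1
    exact absurd h (not_le.2 (Real.one_lt_rpow hx1 hp0))
  have hKc : IsCompact K := by
    refine (isCompact_closedBall (0 : E × E) 1).of_isClosed_subset ?_ ?_
    · exact (isClosed_eq ((hc _ continuous_fst).add (hc _ continuous_snd))
        continuous_const).inter
        (isClosed_le continuous_const (hc _ (continuous_fst.sub continuous_snd)))
    · rintro ⟨a, b⟩ ⟨h, -⟩
      have ha := Real.rpow_nonneg (norm_nonneg a) p
      have hb := Real.rpow_nonneg (norm_nonneg b) p
      simp only at h
      rw [mem_closedBall_zero_iff, Prod.norm_def]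
      exact max_le (hle _ (norm_nonneg _) (by linarith)) (hle _ (norm_nonneg _) (by linarith))
  have hVc : Continuous fun z : E × E => midDefect p z.1 z.2 :=
    ((hc _ continuous_fst).add (hc _ continuous_snd)).sub
      (continuous_const.mul (hc _ ((continuous_fst.add continuous_snd).const_smul _)))
  obtain ⟨m, hm, hmK⟩ : ∃ m > 0, ∀ z ∈ K, m ≤ midDefect p z.1 z.2 := by
    rcases K.eq_empty_or_nonempty with h | h
    · exact ⟨1, one_pos, by simp [h]⟩
    · obtain ⟨z, hz, hz'⟩ := hKc.exists_isMinOn h hVc.continuousOn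
      refine ⟨_, midDefect_pos hp (a := z.1) (b := z.2) ?_, fun y hy => hz' hy⟩
      rintro h
      have := hz.2
      rw [h, sub_self, norm_zero, Real.zero_rpow hp0.ne'] at this
      linarith
  refine ⟨2 ^ p / m, by positivity, fun a b => ?_⟩
  set r := ‖a‖ ^ p + ‖b‖ ^ p with hr
  have ha := Real.rpow_nonneg (norm_nonneg a) p
  have hb := Real.rpow_nonneg (norm_nonneg b) p
  rcases (add_nonneg ha hb).eq_or_lt with h0 | hr0
  · have ha0 : a = 0 := by
      by_contra h
      have := Real.rpow_pos_of_pos (norm_pos_iff.2 h) p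
      linarith
    have hb0 : b = 0 := by
      by_contra h
      have := Real.rpow_pos_of_pos (norm_pos_iff.2 h) p
      linarith
    have := midDefect_nonneg hp a b
    rw [ha0, hb0] at *
    rw [sub_self, norm_zero, Real.zero_rpow hp0.ne']
    positivity
  · rw [← hr] at hr0
    -- normalise so that `‖a‖ ^ p + ‖b‖ ^ p = 1`
    set t := r ^ (-(1 / p)) with ht
    have ht0 : 0 < t := Real.rpow_pos_of_pos hr0 _
    have htp : t ^ p = r⁻¹ := by
      rw [ht, ← Real.rpow_mul hr0.le, neg_mul, one_div, inv_mul_cancel₀ hp0.ne',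
        Real.rpow_neg_one]
    have hns : ∀ x : E, ‖t • x‖ ^ p = r⁻¹ * ‖x‖ ^ p := fun x => by
      rw [norm_smul, Real.norm_of_nonneg ht0.le, Real.mul_rpow ht0.le (norm_nonneg _), htp]
    have hV0 := midDefect_nonneg hp a b
    rcases le_or_gt (‖a - b‖ ^ p) (δ * r) with h | h
    · have : 0 ≤ 2 ^ p / m * midDefect p a b := by positivity
      linarith
    · have hz : (t • a, t • b) ∈ K := by
        refine ⟨?_, ?_⟩
        · simp only [hns]; rw [← mul_add, ← hr, inv_mul_cancel₀ hr0.ne']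
        · simp only [← smul_sub, hns]
          rw [inv_mul_eq_div, le_div_iff₀ hr0]; exact h.le
      have h1 := hmK _ hz
      simp only [midDefect_smul ht0.le, htp] at h1
      rw [inv_mul_eq_div, le_div_iff₀ hr0] at h1
      have h2 : r ≤ midDefect p a b / m := by rw [le_div_iff₀ hm]; linarith
      have h3 : ‖a - b‖ ^ p ≤ 2 ^ p * r := by
        have hmax : ‖a - b‖ ≤ 2 * max ‖a‖ ‖b‖ :=
          (norm_sub_le a b).trans (by linarith [le_max_left ‖a‖ ‖b‖, le_max_right ‖a‖ ‖b‖])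
        calc ‖a - b‖ ^ p ≤ (2 * max ‖a‖ ‖b‖) ^ p :=
              Real.rpow_le_rpow (norm_nonneg _) hmax hp0.le
          _ = 2 ^ p * (max ‖a‖ ‖b‖) ^ p :=
              Real.mul_rpow (by norm_num) (le_max_of_le_left (norm_nonneg _))
          _ ≤ 2 ^ p * r := by
              refine mul_le_mul_of_nonneg_left ?_ (by positivity)
              rcases max_choice ‖a‖ ‖b‖ with h | h <;> rw [h] <;> linarith
      have h4 : 2 ^ p * r ≤ 2 ^ p * (midDefect p a b / m) :=
        mul_le_mul_of_nonneg_left h2 (by positivity)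
      have h5 : 0 ≤ δ * r := by positivity
      calc ‖a - b‖ ^ p ≤ 2 ^ p * (midDefect p a b / m) := h3.trans h4
        _ = 2 ^ p / m * midDefect p a b := by ring
        _ ≤ _ := by linarith

/-- Interpolation between the powers `1` and `2`. -/
lemma exists_rpow_le_sq_add {p δ : ℝ} (hp : 1 < p) (hp2 : p < 2) (hδ : 0 < δ) :
    ∃ C > 0, ∀ x : ℝ, 0 ≤ x → x ^ p ≤ δ * x ^ 2 + C * x := by
  set K := δ ^ (-(1 / (2 - p))) with hK
  have hK0 : 0 < K := Real.rpow_pos_of_pos hδ _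
  have hKp : K ^ (p - 2) = δ := by
    rw [hK, ← Real.rpow_mul hδ.le]
    have : -(1 / (2 - p)) * (p - 2) = 1 := by
      have : 2 - p ≠ 0 := by linarith
      field_simp; ring
    rw [this, Real.rpow_one]
  refine ⟨K ^ (p - 1), by positivity, fun x hx => ?_⟩
  rcases hx.eq_or_lt with rfl | hx
  · simp [Real.zero_rpow (by linarith : p ≠ 0)]
  rcases le_or_gt x K with h | h
  · have h1 : x ^ p = x ^ (p - 1) * x := by rw [← Real.rpow_add_one hx.ne']; ring_nf
    have h2 : x ^ (p - 1) ≤ K ^ (p - 1) := Real.rpow_le_rpow hx.le h (by linarith)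
    have h3 : 0 ≤ δ * x ^ 2 := by positivity
    rw [h1]
    linarith [mul_le_mul_of_nonneg_right h2 hx.le]
  · have h1 : x ^ p = x ^ (p - 2) * x ^ 2 := by
      rw [← Real.rpow_natCast, ← Real.rpow_add hx]; norm_num
    have h2 : x ^ (p - 2) ≤ δ := by
      rw [← hKp]; exact Real.rpow_le_rpow_of_nonpos hK0 h.le (by linarith)
    have h3 : 0 ≤ K ^ (p - 1) * x := by positivity
    rw [h1]
    linarith [mul_le_mul_of_nonneg_right h2 (by positivity : 0 ≤ x ^ 2)]

end Pointwise

/-! ### Calculus in `W₀^{1,p}(Ω)` -/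

section Sobolev

variable {N : ℕ} {Ω : Set (Eu N)} {p : ℝ}

lemma IsTestFn.continuous_gradient {φ : Eu N → ℝ} (h : IsTestFn Ω φ) :
    Continuous (gradient φ) :=
  (InnerProductSpace.toDual ℝ (Eu N)).symm.continuous.comp (h.1.continuous_fderiv (by simp))

lemma gradient_eq_zero_of_notMem_tsupport {φ : Eu N → ℝ} {x : Eu N} (hx : x ∉ tsupport φ) :
    gradient φ x = 0 := by
  have : fderiv ℝ φ x = 0 := by
    by_contra h
    exact hx (support_fderiv_subset ℝ h)
  simp [gradient, this]

lemma IsTestFn.hasCompactSupport_gradient {φ : Eu N → ℝ} (h : IsTestFn Ω φ) :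
    HasCompactSupport (gradient φ) :=
  HasCompactSupport.intro h.2.1 fun _ hx => gradient_eq_zero_of_notMem_tsupport hx

lemma IsTestFn.eq_zero {φ : Eu N → ℝ} (h : IsTestFn Ω φ) {x : Eu N} (hx : x ∉ Ω) : φ x = 0 :=
  image_eq_zero_of_notMem_tsupport fun h' => hx (h.2.2 h')

lemma IsTestFn.gradient_eq_zero {φ : Eu N → ℝ} (h : IsTestFn Ω φ) {x : Eu N} (hx : x ∉ Ω) :
    gradient φ x = 0 :=
  gradient_eq_zero_of_notMem_tsupport fun h' => hx (h.2.2 h')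

lemma IsTestFn.memLp {φ : Eu N → ℝ} (h : IsTestFn Ω φ) (q : ENNReal) : MemLp φ q (leb Ω) :=
  (h.1.continuous.memLp_of_hasCompactSupport h.2.1).restrict _

lemma IsTestFn.memLp_gradient {φ : Eu N → ℝ} (h : IsTestFn Ω φ) (q : ENNReal) :
    MemLp (gradient φ) q (leb Ω) :=
  (h.continuous_gradient.memLp_of_hasCompactSupport h.hasCompactSupport_gradient).restrict _

lemma gradient_add_apply {f g : Eu N → ℝ} {x : Eu N} (hf : DifferentiableAt ℝ f x)
    (hg : DifferentiableAt ℝ g x) :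
    gradient (fun y => f y + g y) x = gradient f x + gradient g x := by
  simp only [gradient]; rw [fderiv_fun_add hf hg, map_add]

lemma gradient_const_mul_apply {f : Eu N → ℝ} {x : Eu N} (hf : DifferentiableAt ℝ f x) (c : ℝ) :
    gradient (fun y => c * f y) x = c • gradient f x := by
  simp only [gradient]; rw [fderiv_const_mul hf, map_smul]

lemma IsTestFn.differentiable {φ : Eu N → ℝ} (h : IsTestFn Ω φ) : Differentiable ℝ φ :=
  h.1.differentiable (by simp)

lemma IsTestFn.add {φ ψ : Eu N → ℝ} (h : IsTestFn Ω φ) (h' : IsTestFn Ω ψ) :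
    IsTestFn Ω (fun x => φ x + ψ x) :=
  ⟨h.1.add h'.1, h.2.1.add h'.2.1,
    (tsupport_add φ ψ).trans (union_subset h.2.2 h'.2.2)⟩

lemma IsTestFn.const_mul {φ : Eu N → ℝ} (h : IsTestFn Ω φ) (c : ℝ) :
    IsTestFn Ω (fun x => c * φ x) :=
  ⟨contDiff_const.mul h.1, h.2.1.mul_left, (tsupport_mul_subset_right).trans h.2.2⟩

/-- The product of a locally integrable function on `Ω` with a continuous function of compact
support in `Ω` is integrable. -/
lemma integrable_smul_of_tsupport_subset {E F : Type*} [NormedAddCommGroup E] [NormedSpace ℝ E]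
    [NormedAddCommGroup F] [NormedSpace ℝ F] {G : Eu N → E} (hG : LocallyIntegrableOn G Ω)
    {g : Eu N → F} (hg : Continuous g) (hgc : HasCompactSupport g) (hgs : tsupport g ⊆ Ω)
    (B : F →L[ℝ] E →L[ℝ] Eu N) :
    Integrable (fun x => B (g x) (G x)) := by
  have h1 : IntegrableOn G (tsupport g) := hG.integrableOn_compact_subset hgs hgc
  have h2 : IntegrableOn (fun x => B (g x) (G x)) (tsupport g) := by
    obtain ⟨C, hC⟩ := hg.bounded_above_of_compact_support hgc
    have := B.aestronglyMeasurable_comp₂ hg.aestronglyMeasurable.restrict h1.1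
    refine (h1.norm.const_mul (‖B‖ * C)).mono' this (ae_of_all _ fun x => ?_)
    refine (B.le_opNorm₂ _ _).trans ?_
    gcongr
    exact hC x
  rwa [integrableOn_iff_integrable_of_support_subset] at h2
  intro x hx
  by_contra h
  exact hx (by simp [image_eq_zero_of_notMem_tsupport h])

lemma integrable_testFn_smul {G : Eu N → Eu N} (hG : LocallyIntegrableOn G Ω)
    {φ : Eu N → ℝ} (h : IsTestFn Ω φ) : Integrable (fun x => φ x • G x) :=
  integrable_smul_of_tsupport_subset hG h.1.continuous h.2.1 h.2.2
    (ContinuousLinearMap.lsmul ℝ ℝ)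

lemma integrable_smul_gradient {w : Eu N → ℝ} (hw : LocallyIntegrableOn w Ω)
    {φ : Eu N → ℝ} (h : IsTestFn Ω φ) : Integrable (fun x => w x • gradient φ x) := by
  have hs : tsupport (gradient φ) ⊆ Ω :=
    (closure_minimal (fun x hx => by
      by_contra h'
      exact hx (gradient_eq_zero_of_notMem_tsupport h')) (isClosed_tsupport φ)).trans h.2.2
  exact integrable_smul_of_tsupport_subset hw h.continuous_gradient h.hasCompactSupport_gradient hs
    (ContinuousLinearMap.lsmul ℝ ℝ).flip

/-- Functions which are equal a.e. in `Ω` have the same weak gradient; in particular weak gradients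
are unique. -/
lemma HasWeakGrad.ae_eq (hΩ : IsOpen Ω) {w w' : Eu N → ℝ} {G G' : Eu N → Eu N}
    (h : HasWeakGrad Ω w G) (h' : HasWeakGrad Ω w' G') (hw : w =ᵐ[leb Ω] w') :
    G =ᵐ[leb Ω] G' := by
  have key := hΩ.ae_eq_zero_of_integral_contDiff_smul_eq_zero (h.2.1.sub h'.2.1)
    (fun φ h1 h2 h3 => ?_)
  · rw [EventuallyEq, ae_restrict_iff' hΩ.measurableSet]
    filter_upwards [key] with x hx hxΩ
    exact sub_eq_zero.1 (hx hxΩ)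
  · have hφ : IsTestFn Ω φ := ⟨h1, h2, h3⟩
    rw [← setIntegral_eq_integral_of_forall_compl_eq_zero (s := Ω)
      (fun x hx => by simp [hφ.eq_zero hx])]
    simp only [Pi.sub_apply, smul_sub]
    rw [integral_sub (integrable_testFn_smul h.2.1 hφ).integrableOn
      (integrable_testFn_smul h'.2.1 hφ).integrableOn, sub_eq_zero, ← neg_inj,
      ← h.2.2 φ hφ, ← h'.2.2 φ hφ]
    exact integral_congr_ae (by filter_upwards [hw] with x hx; rw [hx])

lemma HasWeakGrad.weakGrad {w : Eu N → ℝ} {G : Eu N → Eu N}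
    (h : HasWeakGrad Ω w G) : HasWeakGrad Ω w (weakGrad Ω w) := by
  have h' : ∃ G, HasWeakGrad Ω w G := ⟨G, h⟩
  unfold PLap.weakGrad
  rw [dif_pos h']
  exact h'.choose_spec

lemma HasWeakGrad.weakGrad_ae_eq (hΩ : IsOpen Ω) {w : Eu N → ℝ} {G : Eu N → Eu N}
    (h : HasWeakGrad Ω w G) : PLap.weakGrad Ω w =ᵐ[leb Ω] G :=
  h.weakGrad.ae_eq hΩ h EventuallyEq.rfl

lemma HasWeakGrad.add {w w' : Eu N → ℝ} {G G' : Eu N → Eu N}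
    (h : HasWeakGrad Ω w G) (h' : HasWeakGrad Ω w' G') :
    HasWeakGrad Ω (fun x => w x + w' x) (fun x => G x + G' x) := by
  refine ⟨h.1.add h'.1, h.2.1.add h'.2.1, fun φ hφ => ?_⟩
  simp only [add_smul, smul_add]
  rw [integral_add (integrable_smul_gradient h.1 hφ).integrableOn
    (integrable_smul_gradient h'.1 hφ).integrableOn,
    integral_add (integrable_testFn_smul h.2.1 hφ).integrableOn
      (integrable_testFn_smul h'.2.1 hφ).integrableOn, h.2.2 φ hφ, h'.2.2 φ hφ, neg_add]

lemma HasWeakGrad.const_mul {w : Eu N → ℝ} {G : Eu N → Eu N}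
    (h : HasWeakGrad Ω w G) (c : ℝ) :
    HasWeakGrad Ω (fun x => c * w x) (fun x => c • G x) := by
  refine ⟨h.1.smul c, h.2.1.smul c, fun φ hφ => ?_⟩
  simp only [mul_smul, smul_comm _ c]
  rw [integral_smul, integral_smul, h.2.2 φ hφ, smul_neg]

/-- For test functions the weak gradient is the classical one, by integration by parts. -/
lemma HasWeakGrad.of_testFn {w : Eu N → ℝ} (hw : IsTestFn Ω w) :
    HasWeakGrad Ω w (gradient w) := by
  refine ⟨hw.1.continuous.locallyIntegrable.locallyIntegrableOn _,
    hw.continuous_gradient.locallyIntegrable.locallyIntegrableOn _, fun φ hφ => ?_⟩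
  rw [setIntegral_eq_integral_of_forall_compl_eq_zero
      (fun x hx => by simp [hw.eq_zero hx]),
    setIntegral_eq_integral_of_forall_compl_eq_zero
      (fun x hx => by simp [hφ.eq_zero hx])]
  have c1 : Continuous w := hw.1.continuous
  have c2 : Continuous φ := hφ.1.continuous
  have i1 : Integrable fun x => w x • gradient φ x :=
    (c1.smul hφ.continuous_gradient).integrable_of_hasCompactSupport hw.2.1.smul_right
  have i2 : Integrable fun x => φ x • gradient w x :=
    (c2.smul hw.continuous_gradient).integrable_of_hasCompactSupport hφ.2.1.smul_right
  refine ext_inner_left ℝ fun v => ?_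
  rw [inner_neg_right, ← integral_inner i1, ← integral_inner i2]
  simp only [inner_smul_right, inner_gradient_right, conj_trivial]
  have f1 : Continuous fun x => fderiv ℝ w x v :=
    (hw.1.continuous_fderiv (by simp)).clm_apply continuous_const
  have f2 : Continuous fun x => fderiv ℝ φ x v :=
    (hφ.1.continuous_fderiv (by simp)).clm_apply continuous_const
  rw [integral_mul_fderiv_eq_neg_fderiv_mul_of_integrable]
  · congr 1; exact integral_congr_ae (ae_of_all _ fun x => mul_comm _ _)
  · exact (f1.mul c2).integrable_of_hasCompactSupport hφ.2.1.mul_left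
  · exact (c1.mul f2).integrable_of_hasCompactSupport hw.2.1.mul_right
  · exact (c1.mul c2).integrable_of_hasCompactSupport hw.2.1.mul_right
  · exact fun x _ => hw.differentiable x
  · exact fun x _ => hφ.differentiable x

lemma IsW0.of_testFn {w : Eu N → ℝ} (hw : IsTestFn Ω w) : IsW0 p Ω w (gradient w) :=
  ⟨HasWeakGrad.of_testFn hw, hw.memLp _, hw.memLp_gradient _, fun _ => w, fun _ => hw,
    by simp, by simp⟩

lemma MemX.of_testFn {w : Eu N → ℝ} (hw : IsTestFn Ω w) : MemX p Ω w :=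
  ⟨⟨_, IsW0.of_testFn hw⟩, hw.memLp _⟩

lemma weakGrad_testFn (hΩ : IsOpen Ω) {w : Eu N → ℝ} (hw : IsTestFn Ω w) :
    weakGrad Ω w =ᵐ[leb Ω] gradient w :=
  (HasWeakGrad.of_testFn hw).weakGrad_ae_eq hΩ

lemma one_le_ofReal (hp : 1 < p) : (1 : ENNReal) ≤ ENNReal.ofReal p := by
  simpa using ENNReal.ofReal_le_ofReal hp.le

lemma IsW0.congr_grad {w : Eu N → ℝ} {G G' : Eu N → Eu N} (h : IsW0 p Ω w G)
    (h' : HasWeakGrad Ω w G') (hG : G =ᵐ[leb Ω] G') : IsW0 p Ω w G' := by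
  obtain ⟨-, h2, h3, φ, h4, h5, h6⟩ := h
  refine ⟨h', h2, h3.ae_eq hG, φ, h4, h5, h6.congr fun n => eLpNorm_congr_ae ?_⟩
  filter_upwards [hG] with x hx
  rw [hx]

lemma MemX.isW0 (hΩ : IsOpen Ω) {w : Eu N → ℝ} (h : MemX p Ω w) :
    IsW0 p Ω w (weakGrad Ω w) := by
  obtain ⟨⟨G, hG⟩, -⟩ := h
  exact hG.congr_grad hG.1.weakGrad (hG.1.weakGrad_ae_eq hΩ).symm

lemma MemX.hasWeakGrad (hΩ : IsOpen Ω) {w : Eu N → ℝ} (h : MemX p Ω w) :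
    HasWeakGrad Ω w (weakGrad Ω w) :=
  (h.isW0 hΩ).1

lemma MemX.memLp {w : Eu N → ℝ} (h : MemX p Ω w) : MemLp w (ENNReal.ofReal p) (leb Ω) := by
  obtain ⟨⟨G, hG⟩, -⟩ := h
  exact hG.2.1

lemma MemX.memLp_weakGrad (hΩ : IsOpen Ω) {w : Eu N → ℝ} (h : MemX p Ω w) :
    MemLp (weakGrad Ω w) (ENNReal.ofReal p) (leb Ω) :=
  (h.isW0 hΩ).2.2.1

lemma IsW0.add (hp : 1 < p) {w w' : Eu N → ℝ} {G G' : Eu N → Eu N} (h : IsW0 p Ω w G)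
    (h' : IsW0 p Ω w' G') : IsW0 p Ω (fun x => w x + w' x) (fun x => G x + G' x) := by
  obtain ⟨h1, h2, h3, φ, h4, h5, h6⟩ := h
  obtain ⟨h1', h2', h3', φ', h4', h5', h6'⟩ := h'
  refine ⟨h1.add h1', h2.add h2', h3.add h3', fun n x => φ n x + φ' n x,
    fun n => (h4 n).add (h4' n), ?_, ?_⟩
  · refine tendsto_of_tendsto_of_tendsto_of_le_of_le tendsto_const_nhds
      (by simpa using h5.add h5') (fun _ => zero_le) fun n => ?_
    refine le_trans (le_of_eq ?_) (eLpNorm_add_le (((h4 n).memLp _).sub h2).1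
      (((h4' n).memLp _).sub h2').1 (one_le_ofReal hp))
    congr 1; ext x; simp only [Pi.add_apply]; ring
  · refine tendsto_of_tendsto_of_tendsto_of_le_of_le tendsto_const_nhds
      (by simpa using h6.add h6') (fun _ => zero_le) fun n => ?_
    refine le_trans (le_of_eq ?_) (eLpNorm_add_le (((h4 n).memLp_gradient _).sub h3).1
      (((h4' n).memLp_gradient _).sub h3').1 (one_le_ofReal hp))
    congr 1; ext1 x
    simp only [Pi.add_apply]
    rw [gradient_add_apply ((h4 n).differentiable x) ((h4' n).differentiable x)]
    abel

lemma IsW0.const_mul {w : Eu N → ℝ} {G : Eu N → Eu N} (h : IsW0 p Ω w G) (c : ℝ) :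
    IsW0 p Ω (fun x => c * w x) (fun x => c • G x) := by
  obtain ⟨h1, h2, h3, φ, h4, h5, h6⟩ := h
  refine ⟨h1.const_mul c, h2.const_mul c, h3.const_smul c, fun n x => c * φ n x,
    fun n => (h4 n).const_mul c, ?_, ?_⟩
  · have := ENNReal.Tendsto.const_mul (a := ‖c‖ₑ) h5 (Or.inr (by simp))
    rw [mul_zero] at this
    refine this.congr fun n => ?_
    rw [← eLpNorm_const_smul]
    congr 1; ext x; simp only [Pi.smul_apply, smul_eq_mul]; ring
  · have := ENNReal.Tendsto.const_mul (a := ‖c‖ₑ) h6 (Or.inr (by simp))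
    rw [mul_zero] at this
    refine this.congr fun n => ?_
    rw [← eLpNorm_const_smul]
    congr 1; ext1 x
    simp only [Pi.smul_apply]
    rw [gradient_const_mul_apply ((h4 n).differentiable x), smul_sub]

lemma MemX.add (hp : 1 < p) {w w' : Eu N → ℝ} (h : MemX p Ω w) (h' : MemX p Ω w') :
    MemX p Ω (fun x => w x + w' x) := by
  obtain ⟨⟨G, hG⟩, h2⟩ := h
  obtain ⟨⟨G', hG'⟩, h2'⟩ := h'
  exact ⟨⟨_, hG.add hp hG'⟩, h2.add h2'⟩

lemma MemX.const_mul {w : Eu N → ℝ} (h : MemX p Ω w) (c : ℝ) :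
    MemX p Ω (fun x => c * w x) := by
  obtain ⟨⟨G, hG⟩, h2⟩ := h
  exact ⟨⟨_, hG.const_mul c⟩, h2.const_mul c⟩

lemma memX_zero : MemX p Ω (fun _ => 0) :=
  MemX.of_testFn ⟨contDiff_const, HasCompactSupport.zero, by simp [tsupport]⟩

lemma weakGrad_add (hΩ : IsOpen Ω) {w w' : Eu N → ℝ} (h : MemX p Ω w) (h' : MemX p Ω w') :
    weakGrad Ω (fun x => w x + w' x) =ᵐ[leb Ω] fun x => weakGrad Ω w x + weakGrad Ω w' x :=
  ((h.hasWeakGrad hΩ).add (h'.hasWeakGrad hΩ)).weakGrad_ae_eq hΩ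

lemma weakGrad_const_mul (hΩ : IsOpen Ω) {w : Eu N → ℝ} (h : MemX p Ω w) (c : ℝ) :
    weakGrad Ω (fun x => c * w x) =ᵐ[leb Ω] fun x => c • weakGrad Ω w x :=
  ((h.hasWeakGrad hΩ).const_mul c).weakGrad_ae_eq hΩ

lemma integrable_of_memLp [IsFiniteMeasure (leb Ω)] (hp : 1 < p) {E : Type*}
    [NormedAddCommGroup E] {f : Eu N → E} (hf : MemLp f (ENNReal.ofReal p) (leb Ω)) :
    Integrable f (leb Ω) :=
  hf.integrable (one_le_ofReal hp)

lemma tendsto_eLpNorm_of_le [IsFiniteMeasure (leb Ω)] {E : Type*} [NormedAddCommGroup E]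
    {q r : ENNReal} (hqr : q ≤ r) (hq : q ≠ 0) {F : ℕ → Eu N → E}
    (hF : ∀ n, AEStronglyMeasurable (F n) (leb Ω))
    (h : Tendsto (fun n => eLpNorm (F n) r (leb Ω)) atTop (𝓝 0)) :
    Tendsto (fun n => eLpNorm (F n) q (leb Ω)) atTop (𝓝 0) := by
  set c := leb Ω Set.univ ^ (1 / q.toReal - 1 / r.toReal) with hc
  have hexp : 0 ≤ 1 / q.toReal - 1 / r.toReal := by
    rcases eq_or_ne r ⊤ with rfl | hr
    · simp
    · have hq' : q ≠ ⊤ := ne_top_of_le_ne_top hr hqr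
      have := ENNReal.toReal_pos hq hq'
      rw [sub_nonneg]
      exact one_div_le_one_div_of_le this (ENNReal.toReal_mono hr hqr)
  have hctop : c ≠ ⊤ := ENNReal.rpow_ne_top_of_nonneg hexp (measure_ne_top _ _)
  have := ENNReal.Tendsto.mul_const (b := c) h (Or.inr hctop)
  rw [zero_mul] at this
  exact tendsto_of_tendsto_of_tendsto_of_le_of_le tendsto_const_nhds this (fun _ => zero_le)
    fun n => eLpNorm_le_eLpNorm_mul_rpow_measure_univ hqr (hF n)

/-- Integrals converge under `L^q` convergence, `q ≥ 1`, of a controlling sequence. -/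
lemma tendsto_integral_of_eLpNorm [IsFiniteMeasure (leb Ω)] {E F : Type*} [NormedAddCommGroup E]
    [NormedAddCommGroup F] [NormedSpace ℝ F] {q : ENNReal} (hq : 1 ≤ q) {f : ℕ → Eu N → E}
    {H : ℕ → Eu N → F} {H' : Eu N → F} (hf : ∀ n, AEStronglyMeasurable (f n) (leb Ω))
    (h : Tendsto (fun n => eLpNorm (f n) q (leb Ω)) atTop (𝓝 0))
    (hH : ∀ n, Integrable (H n) (leb Ω)) (hH' : AEStronglyMeasurable H' (leb Ω)) (C : ℝ)
    (hle : ∀ n x, ‖H n x - H' x‖ ≤ C * ‖f n x‖) :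
    Tendsto (fun n => ∫ x in Ω, H n x) atTop (𝓝 (∫ x in Ω, H' x)) := by
  refine tendsto_integral_of_L1' _ hH' (Eventually.of_forall hH) ?_
  have h1 := tendsto_eLpNorm_of_le hq one_ne_zero hf h
  have := ENNReal.Tendsto.const_mul (a := ENNReal.ofReal C) h1 (Or.inr (by simp))
  rw [mul_zero] at this
  exact tendsto_of_tendsto_of_tendsto_of_le_of_le tendsto_const_nhds this (fun _ => zero_le)
    fun n => eLpNorm_le_mul_eLpNorm_of_ae_le_mul (ae_of_all _ (hle n)) 1

/-- `W₀^{1,p}(Ω)` is closed under convergence of functions and gradients in `L^p`. -/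
lemma IsW0.of_tendsto [IsFiniteMeasure (leb Ω)] (hp : 1 < p)
    {w : ℕ → Eu N → ℝ} {G : ℕ → Eu N → Eu N} {w' : Eu N → ℝ} {G' : Eu N → Eu N}
    (h : ∀ n, IsW0 p Ω (w n) (G n)) (hw' : MemLp w' (ENNReal.ofReal p) (leb Ω))
    (hG' : MemLp G' (ENNReal.ofReal p) (leb Ω))
    (hw : Tendsto (fun n => eLpNorm (fun x => w n x - w' x) (ENNReal.ofReal p) (leb Ω))
      atTop (𝓝 0))
    (hG : Tendsto (fun n => eLpNorm (fun x => G n x - G' x) (ENNReal.ofReal p) (leb Ω))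
      atTop (𝓝 0)) : IsW0 p Ω w' G' := by
  have li : ∀ {E : Type} [NormedAddCommGroup E] {f : Eu N → E},
      MemLp f (ENNReal.ofReal p) (leb Ω) → LocallyIntegrableOn f Ω := fun hf =>
    IntegrableOn.locallyIntegrableOn (integrable_of_memLp hp hf)
  refine ⟨⟨li hw', li hG', fun φ hφ => ?_⟩, hw', hG', ?_⟩
  · obtain ⟨C, hC⟩ := hφ.continuous_gradient.bounded_above_of_compact_support
      hφ.hasCompactSupport_gradient
    obtain ⟨D, hD⟩ := hφ.1.continuous.bounded_above_of_compact_support hφ.2.1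
    have t1 : Tendsto (fun n => ∫ x in Ω, w n x • gradient φ x) atTop
        (𝓝 (∫ x in Ω, w' x • gradient φ x)) := by
      refine tendsto_integral_of_eLpNorm (one_le_ofReal hp) (fun n => ((h n).2.1.sub hw').1) hw
        (fun n => (integrable_smul_gradient (h n).1.1 hφ).integrableOn)
        (integrable_smul_gradient (li hw') hφ).integrableOn.1 C fun n x => ?_
      rw [← sub_smul, norm_smul, mul_comm]
      exact mul_le_mul_of_nonneg_right (hC x) (norm_nonneg _)
    have t2 : Tendsto (fun n => ∫ x in Ω, φ x • G n x) atTop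
        (𝓝 (∫ x in Ω, φ x • G' x)) := by
      refine tendsto_integral_of_eLpNorm (one_le_ofReal hp) (fun n => ((h n).2.2.1.sub hG').1) hG
        (fun n => (integrable_testFn_smul (h n).1.2.1 hφ).integrableOn)
        (integrable_testFn_smul (li hG') hφ).integrableOn.1 D fun n x => ?_
      rw [← smul_sub, norm_smul]
      exact mul_le_mul_of_nonneg_right (hD x) (norm_nonneg _)
    exact tendsto_nhds_unique t1 (t2.neg.congr fun n => ((h n).1.2.2 φ hφ).symm)
  · have ch : ∀ n, ∃ φ, IsTestFn Ω φ ∧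
        eLpNorm (fun x => φ x - w n x) (ENNReal.ofReal p) (leb Ω) ≤ (n : ENNReal)⁻¹ ∧
        eLpNorm (fun x => gradient φ x - G n x) (ENNReal.ofReal p) (leb Ω) ≤ (n : ENNReal)⁻¹ := by
      intro n
      obtain ⟨-, -, -, φ, h1, h2, h3⟩ := h n
      have hn : (0 : ENNReal) < (n : ENNReal)⁻¹ := by simp
      obtain ⟨k, hk⟩ := ((h2.eventually (ge_mem_nhds hn)).and
        (h3.eventually (ge_mem_nhds hn))).exists
      exact ⟨φ k, h1 k, hk.1, hk.2⟩
    choose φ h1 h2 h3 using ch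
    have hn : Tendsto (fun n : ℕ => (n : ENNReal)⁻¹) atTop (𝓝 0) :=
      ENNReal.tendsto_inv_nat_nhds_zero
    refine ⟨φ, h1, ?_, ?_⟩
    · refine tendsto_of_tendsto_of_tendsto_of_le_of_le tendsto_const_nhds
        (by simpa using hn.add hw) (fun _ => zero_le) fun n => ?_
      refine le_trans (le_of_eq ?_) ((eLpNorm_add_le (((h1 n).memLp _).sub (h n).2.1).1
        ((h n).2.1.sub hw').1 (one_le_ofReal hp)).trans (add_le_add_left (h2 n) _))
      congr 1; ext x; simp
    · refine tendsto_of_tendsto_of_tendsto_of_le_of_le tendsto_const_nhds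
        (by simpa using hn.add hG) (fun _ => zero_le) fun n => ?_
      refine le_trans (le_of_eq ?_) ((eLpNorm_add_le (((h1 n).memLp_gradient _).sub (h n).2.2.1).1
        ((h n).2.2.1.sub hG').1 (one_le_ofReal hp)).trans (add_le_add_left (h3 n) _))
      congr 1; ext1 x; simp

end Sobolev

/-! ### The energy: expansion, critical points, Euler-Lagrange equation -/

section LpCalculus

variable {α E : Type*} [MeasurableSpace α] {μ : Measure α} [NormedAddCommGroup E]
  [InnerProductSpace ℝ E] {p : ℝ}

lemma integrable_norm_rpow {E : Type*} [NormedAddCommGroup E] (hp : 1 < p) {f : α → E}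
    (hf : MemLp f (ENNReal.ofReal p) μ) :
    Integrable (fun x => ‖f x‖ ^ p) μ := by
  have := hf.integrable_norm_rpow (by simp; linarith) (by simp)
  rwa [ENNReal.toReal_ofReal (by linarith)] at this

lemma integral_norm_rpow {E : Type*} [NormedAddCommGroup E] (hp : 1 < p) {f : α → E}
    (hf : MemLp f (ENNReal.ofReal p) μ) :
    ∫ x, ‖f x‖ ^ p ∂μ = (eLpNorm f (ENNReal.ofReal p) μ).toReal ^ p := by
  have hp0 : 0 < p := by linarith
  have h0 : 0 ≤ ∫ x, ‖f x‖ ^ p ∂μ := integral_nonneg fun x => by positivity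
  rw [hf.eLpNorm_eq_integral_rpow_norm (by simp; linarith) (by simp),
    ENNReal.toReal_ofReal hp0.le, ENNReal.toReal_ofReal (by positivity), ← Real.rpow_mul h0,
    inv_mul_cancel₀ hp0.ne', Real.rpow_one]

lemma integral_sq (μ : Measure α) {f : α → ℝ} (hf : MemLp f 2 μ) :
    ∫ x, |f x| ^ 2 ∂μ = (eLpNorm f 2 μ).toReal ^ 2 := by
  have h := integral_norm_rpow (μ := μ) (p := 2) (f := f) (by norm_num) (by simpa using hf)
  simpa using h

lemma integrable_sq {f : α → ℝ} (hf : MemLp f 2 μ) : Integrable (fun x => |f x| ^ 2) μ := by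
  simpa using hf.integrable_sq

lemma aestronglyMeasurable_flux (p : ℝ) {f g : α → E} (hf : AEStronglyMeasurable f μ)
    (hg : AEStronglyMeasurable g μ) :
    AEStronglyMeasurable (fun x => ‖f x‖ ^ (p - 2) * inner ℝ (f x) (g x)) μ :=
  (hf.norm.aemeasurable.pow_const _).aestronglyMeasurable.mul (hf.inner hg)

lemma integrable_flux (hp : 1 < p) {f g : α → E} (hf : MemLp f (ENNReal.ofReal p) μ)
    (hg : MemLp g (ENNReal.ofReal p) μ) :
    Integrable (fun x => ‖f x‖ ^ (p - 2) * inner ℝ (f x) (g x)) μ :=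
  ((integrable_norm_rpow hp hf).add (integrable_norm_rpow hp hg)).mono'
    (aestronglyMeasurable_flux p hf.1 hg.1)
    (ae_of_all _ fun _ => abs_norm_rpow_mul_inner_le_add hp _ _)

lemma integrable_taylorRem (hp : 1 < p) {f g : α → E} (hf : MemLp f (ENNReal.ofReal p) μ)
    (hg : MemLp g (ENNReal.ofReal p) μ) :
    Integrable (fun x => taylorRem p (f x) (g x)) μ :=
  (((integrable_norm_rpow hp (hf.add hg)).div_const p).sub
    ((integrable_norm_rpow hp hf).div_const p)).sub (integrable_flux hp hf hg)

lemma integral_norm_add_rpow (hp : 1 < p) {f g : α → E} (hf : MemLp f (ENNReal.ofReal p) μ)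
    (hg : MemLp g (ENNReal.ofReal p) μ) :
    1 / p * ∫ x, ‖f x + g x‖ ^ p ∂μ = 1 / p * (∫ x, ‖f x‖ ^ p ∂μ)
      + (∫ x, ‖f x‖ ^ (p - 2) * inner ℝ (f x) (g x) ∂μ) + ∫ x, taylorRem p (f x) (g x) ∂μ := by
  have i1 := (integrable_norm_rpow hp (hf.add hg)).div_const p
  have i2 := (integrable_norm_rpow hp hf).div_const p
  have i3 := integrable_flux hp hf hg
  simp only [Pi.add_apply] at i1
  have i12 : Integrable (fun x => ‖f x + g x‖ ^ p / p - ‖f x‖ ^ p / p) μ := i1.sub i2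
  unfold taylorRem
  rw [integral_sub i12 i3, integral_sub i1 i2, integral_div, integral_div]
  ring

lemma integral_taylorRem_nonneg (hp : 1 < p) (f g : α → E) :
    0 ≤ ∫ x, taylorRem p (f x) (g x) ∂μ :=
  integral_nonneg fun _ => taylorRem_nonneg hp _ _

lemma integral_taylorRem_le (hp : 1 < p) (hp2 : p < 2) {f g : α → E}
    (hf : MemLp f (ENNReal.ofReal p) μ) (hg : MemLp g (ENNReal.ofReal p) μ) :
    ∫ x, taylorRem p (f x) (g x) ∂μ ≤ 5 * ∫ x, ‖g x‖ ^ p ∂μ := by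
  rw [← integral_const_mul]
  exact integral_mono (integrable_taylorRem hp hf hg) ((integrable_norm_rpow hp hg).const_mul _)
    fun x => taylorRem_le hp hp2 _ _

end LpCalculus

/-- The scalar nonlinearity `|w| ^ (p - 2) * w` is the flux of the one-dimensional inner product
space `ℝ`, so that zero-order and gradient terms obey the same estimates. -/
lemma abs_rpow_mul_mul_eq (p a b : ℝ) :
    |a| ^ (p - 2) * a * b = ‖a‖ ^ (p - 2) * inner ℝ a b := by
  rw [Real.norm_eq_abs, mul_assoc]
  congr 1
  simp [mul_comm]

section Energy

variable {N : ℕ} {Ω : Set (Eu N)} {p lam : ℝ}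

/-- The Gâteaux derivative of the energy at `w` in the direction `φ`, that is, the residual of the
weak form of the elliptic problem. -/
noncomputable def energyDeriv {N : ℕ} (p lam : ℝ) (Ω : Set (Eu N)) (h w φ : Eu N → ℝ) : ℝ :=
  (∫ x in Ω, ‖weakGrad Ω w x‖ ^ (p - 2) * inner ℝ (weakGrad Ω w x) (weakGrad Ω φ x))
    - lam * (∫ x in Ω, |w x| ^ (p - 2) * w x * φ x) + (∫ x in Ω, w x * φ x) - ∫ x in Ω, h x * φ x

lemma isEllipticSol_iff {h w : Eu N → ℝ} : IsEllipticSol p lam Ω h w ↔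
    MemX p Ω w ∧ ∀ φ, MemX p Ω φ → energyDeriv p lam Ω h w φ = 0 := by
  unfold IsEllipticSol energyDeriv
  refine and_congr_right fun _ => forall₂_congr fun φ _ => ?_
  constructor <;> intro h <;> linarith

/-- The exact expansion of the energy. The zero-order term has the wrong sign: its remainder
*lowers* the energy. -/
lemma energy_add (hp : 1 < p) (hΩ : IsOpen Ω) {h w φ : Eu N → ℝ} (hh : MemLp h 2 (leb Ω))
    (hw : MemX p Ω w) (hφ : MemX p Ω φ) :
    energy p lam Ω h (fun x => w x + φ x) = energy p lam Ω h w + energyDeriv p lam Ω h w φ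
      + (∫ x in Ω, taylorRem p (weakGrad Ω w x) (weakGrad Ω φ x))
      - lam * (∫ x in Ω, taylorRem p (w x) (φ x)) + 1 / 2 * ∫ x in Ω, |φ x| ^ 2 := by
  have e1 := integral_norm_add_rpow hp (hw.memLp_weakGrad hΩ) (hφ.memLp_weakGrad hΩ)
  have e2 := integral_norm_add_rpow hp hw.memLp hφ.memLp
  have e3 : ∫ x in Ω, ‖weakGrad Ω (fun x => w x + φ x) x‖ ^ p
      = ∫ x in Ω, ‖weakGrad Ω w x + weakGrad Ω φ x‖ ^ p :=
    integral_congr_ae (by filter_upwards [weakGrad_add hΩ hw hφ] with x hx; rw [hx])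
  have e4 : ∫ x in Ω, |w x + φ x| ^ 2
      = (∫ x in Ω, |w x| ^ 2) + 2 * (∫ x in Ω, w x * φ x) + ∫ x in Ω, |φ x| ^ 2 := by
    have i1 := integrable_sq hw.2
    have i2 := integrable_sq hφ.2
    have i3 : Integrable (fun x => w x * φ x) (leb Ω) := hw.2.integrable_mul hφ.2
    have i4 : Integrable (fun x => |w x| ^ 2 + 2 * (w x * φ x)) (leb Ω) :=
      i1.add (i3.const_mul 2)
    rw [← integral_const_mul, ← integral_add i1 (i3.const_mul 2), ← integral_add i4 i2]
    refine integral_congr_ae (ae_of_all _ fun x => ?_)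
    simp only [sq_abs]; ring
  have e5 : ∫ x in Ω, h x * (w x + φ x) = (∫ x in Ω, h x * w x) + ∫ x in Ω, h x * φ x := by
    simp only [mul_add]
    exact integral_add (hh.integrable_mul hw.2) (hh.integrable_mul hφ.2)
  unfold energy energyDeriv
  simp only [abs_rpow_mul_mul_eq]
  simp only [Real.norm_eq_abs] at e2 ⊢
  rw [e3, e4, e5, e1]
  have e2' : lam * _ = lam * _ := congrArg (fun y => lam * y) e2
  have : lam / p * (∫ x in Ω, |w x + φ x| ^ p) = lam * (1 / p * ∫ x in Ω, |w x + φ x| ^ p) := by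
    ring
  rw [this, e2']
  ring

lemma xNorm_nonneg (w : Eu N → ℝ) : 0 ≤ xNorm p Ω w := by
  unfold xNorm; positivity

/-- The first-order expansion of the energy, with a remainder which is controlled by powers of the
norm of `X` with exponents greater than `1`. -/
lemma abs_energy_sub_le (hp : 1 < p) (hp2 : p < 2) (hlam : 0 < lam) (hΩ : IsOpen Ω)
    {h w φ : Eu N → ℝ} (hh : MemLp h 2 (leb Ω))
    (hw : MemX p Ω w) (hφ : MemX p Ω φ) (hle : xNorm p Ω φ ≤ 1) :
    |energy p lam Ω h (fun x => w x + φ x) - energy p lam Ω h w - energyDeriv p lam Ω h w φ|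
      ≤ (6 + 5 * lam) * xNorm p Ω φ ^ p := by
  rw [energy_add hp hΩ hh hw hφ]
  set R := xNorm p Ω φ with hR
  set A := (eLpNorm φ (ENNReal.ofReal p) (leb Ω)).toReal with hA
  set B := (eLpNorm (weakGrad Ω φ) (ENNReal.ofReal p) (leb Ω)).toReal with hB
  set C := (eLpNorm φ 2 (leb Ω)).toReal with hC
  have hsum : R = A + B + C := rfl
  have hA0 : 0 ≤ A := ENNReal.toReal_nonneg
  have hB0 : 0 ≤ B := ENNReal.toReal_nonneg
  have hC0 : 0 ≤ C := ENNReal.toReal_nonneg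
  have hR0 : 0 ≤ R := by linarith
  have r1 := integral_taylorRem_le hp hp2 (hw.memLp_weakGrad hΩ) (hφ.memLp_weakGrad hΩ)
  have r2 := integral_taylorRem_le hp hp2 hw.memLp hφ.memLp
  rw [integral_norm_rpow hp (hφ.memLp_weakGrad hΩ), ← hB] at r1
  rw [integral_norm_rpow hp hφ.memLp, ← hA] at r2
  have r1' := integral_taylorRem_nonneg (μ := leb Ω) hp (weakGrad Ω w) (weakGrad Ω φ)
  have r2' := integral_taylorRem_nonneg (μ := leb Ω) hp w φ
  rw [integral_sq _ hφ.2, ← hC]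
  have b1 : B ^ p ≤ R ^ p := Real.rpow_le_rpow hB0 (by linarith) (by linarith)
  have b2 : A ^ p ≤ R ^ p := Real.rpow_le_rpow hA0 (by linarith) (by linarith)
  have b3 : C ^ 2 ≤ R ^ p := by
    calc C ^ 2 ≤ R ^ 2 := by gcongr; linarith
      _ = R ^ (2 : ℝ) := by norm_num
      _ ≤ R ^ p := Real.rpow_le_rpow_of_exponent_ge_of_imp hR0 hle hp2.le (by intro _ h; linarith)
  have b4 : 0 ≤ C ^ 2 := by positivity
  have b5 := mul_le_mul_of_nonneg_left (r2.trans (mul_le_mul_of_nonneg_left b2 (by norm_num)))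
    hlam.le
  have b6 := mul_nonneg hlam.le r2'
  have b7 : 0 ≤ R ^ p := by positivity
  rw [abs_le]
  constructor <;> nlinarith

/-- Weak solutions are critical points in the sense of Fréchet. -/
lemma IsEllipticSol.isCriticalPt (hp : 1 < p) (hp2 : p < 2) (hlam : 0 < lam) (hΩ : IsOpen Ω)
    {h w : Eu N → ℝ} (hh : MemLp h 2 (leb Ω)) (hw : IsEllipticSol p lam Ω h w) :
    IsCriticalPt p lam Ω h w := by
  rw [isEllipticSol_iff] at hw
  refine ⟨hw.1, fun ε hε => ?_⟩
  have hK : 0 < 6 + 5 * lam := by linarith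
  refine ⟨min 1 ((ε / (6 + 5 * lam)) ^ (1 / (p - 1))), by positivity, fun φ hφ hlt => ?_⟩
  have h1 := abs_energy_sub_le hp hp2 hlam hΩ hh hw.1 hφ (hlt.le.trans (min_le_left _ _))
  rw [hw.2 φ hφ, sub_zero] at h1
  refine h1.trans ?_
  have hR0 := xNorm_nonneg (p := p) (Ω := Ω) φ
  set R := xNorm p Ω φ
  rcases hR0.eq_or_lt with h0 | h0
  · rw [← h0, Real.zero_rpow (by linarith : p ≠ 0)]; simp
  · have h2 : R ^ (p - 1) ≤ ε / (6 + 5 * lam) := by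
      calc R ^ (p - 1) ≤ ((ε / (6 + 5 * lam)) ^ (1 / (p - 1))) ^ (p - 1) :=
            Real.rpow_le_rpow hR0 (hlt.le.trans (min_le_right _ _)) (by linarith)
        _ = ε / (6 + 5 * lam) := by
            rw [← Real.rpow_mul (by positivity), one_div_mul_cancel (by linarith), Real.rpow_one]
    rw [le_div_iff₀ hK] at h2
    have h3 : R ^ p = R ^ (p - 1) * R := by
      rw [← Real.rpow_add_one h0.ne']; ring_nf
    rw [h3]
    nlinarith

lemma xNorm_const_mul (hΩ : IsOpen Ω) {φ : Eu N → ℝ} (hφ : MemX p Ω φ) (c : ℝ) :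
    xNorm p Ω (fun x => c * φ x) = |c| * xNorm p Ω φ := by
  unfold xNorm
  rw [eLpNorm_congr_ae (weakGrad_const_mul hΩ hφ c)]
  have e1 : (fun x => c * φ x) = c • φ := rfl
  have e2 : (fun x => c • weakGrad Ω φ x) = c • weakGrad Ω φ := rfl
  rw [e1, e2]
  simp only [eLpNorm_const_smul, ENNReal.toReal_mul, toReal_enorm, Real.norm_eq_abs]
  ring

lemma energyDeriv_const_mul (hΩ : IsOpen Ω) {h w φ : Eu N → ℝ} (hφ : MemX p Ω φ) (c : ℝ) :
    energyDeriv p lam Ω h w (fun x => c * φ x) = c * energyDeriv p lam Ω h w φ := by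
  unfold energyDeriv
  have e1 : ∫ x in Ω, ‖weakGrad Ω w x‖ ^ (p - 2)
        * inner ℝ (weakGrad Ω w x) (weakGrad Ω (fun x => c * φ x) x)
      = c * ∫ x in Ω, ‖weakGrad Ω w x‖ ^ (p - 2) * inner ℝ (weakGrad Ω w x) (weakGrad Ω φ x) := by
    rw [← integral_const_mul]
    refine integral_congr_ae ?_
    filter_upwards [weakGrad_const_mul hΩ hφ c] with x hx
    rw [hx, inner_smul_right]; ring
  have e2 : ∀ f : Eu N → ℝ, ∫ x in Ω, f x * (c * φ x) = c * ∫ x in Ω, f x * φ x := fun f => by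
    rw [← integral_const_mul]
    exact integral_congr_ae (ae_of_all _ fun x => by simp only; ring)
  rw [e1]
  simp only [e2]
  ring

/-- Minimizers solve the Euler-Lagrange equation. -/
lemma IsGlobalMinimizer.isEllipticSol (hp : 1 < p) (hp2 : p < 2) (hlam : 0 < lam)
    (hΩ : IsOpen Ω) {h w : Eu N → ℝ} (hh : MemLp h 2 (leb Ω))
    (hw : IsGlobalMinimizer p lam Ω h w) : IsEllipticSol p lam Ω h w := by
  rw [isEllipticSol_iff]
  refine ⟨hw.1, ?_⟩
  have key : ∀ φ, MemX p Ω φ → 0 ≤ energyDeriv p lam Ω h w φ := by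
    intro φ hφ
    set R := xNorm p Ω φ
    have hR0 : 0 ≤ R := xNorm_nonneg φ
    set K := (6 + 5 * lam) * R ^ p with hKdef
    have hK : 0 ≤ K := by positivity
    -- divide the expansion in the direction `t * φ` by `t` and let `t → 0`
    have hev : ∀ᶠ t in 𝓝[>] (0 : ℝ), 0 ≤ energyDeriv p lam Ω h w φ + K * t ^ (p - 1) := by
      have : Ioo (0 : ℝ) (1 / (R + 1)) ∈ 𝓝[>] (0 : ℝ) :=
        Ioo_mem_nhdsGT (by positivity)
      filter_upwards [this] with t ht
      have ht0 : 0 < t := ht.1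
      have hx := xNorm_const_mul hΩ hφ t
      rw [abs_of_pos ht0] at hx
      have hle : xNorm p Ω (fun x => t * φ x) ≤ 1 := by
        rw [hx]
        have := ht.2.le
        rw [le_div_iff₀ (by positivity)] at this
        nlinarith
      have h1 := abs_energy_sub_le hp hp2 hlam hΩ hh hw.1 (hφ.const_mul t) hle
      rw [energyDeriv_const_mul hΩ hφ, hx, Real.mul_rpow ht0.le hR0] at h1
      have h2 := hw.2 _ (hw.1.add hp (hφ.const_mul t))
      have h3 := (abs_le.1 h1).2
      have h4 : t ^ p = t * t ^ (p - 1) := by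
        rw [mul_comm, ← Real.rpow_add_one ht0.ne']; ring_nf
      have h5 : 0 ≤ t * (energyDeriv p lam Ω h w φ + K * t ^ (p - 1)) := by
        rw [h4] at h3
        rw [hKdef]
        nlinarith
      exact nonneg_of_mul_nonneg_right h5 ht0
    have hlim : Tendsto (fun t : ℝ => energyDeriv p lam Ω h w φ + K * t ^ (p - 1)) (𝓝[>] 0)
        (𝓝 (energyDeriv p lam Ω h w φ + K * 0 ^ (p - 1))) :=
      (((Real.continuous_rpow_const
        (by linarith)).const_mul K).const_add _).continuousAt.tendsto.mono_left nhdsWithin_le_nhds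
    rw [Real.zero_rpow (by linarith), mul_zero, add_zero] at hlim
    exact ge_of_tendsto hlim hev
  intro φ hφ
  have h1 := key φ hφ
  have h2 := key _ (hφ.const_mul (-1))
  rw [energyDeriv_const_mul hΩ hφ] at h2
  linarith

end Energy

/-! ### Compactness in `L¹(Ω)` -/

section Compactness

variable {N : ℕ} {Ω : Set (Eu N)} {p : ℝ}

/-- The integral of `w` over `Ω ∩ B(x, r)`. -/
noncomputable def ballIntegral {N : ℕ} (Ω : Set (Eu N)) (r : ℝ) (w : Eu N → ℝ) (x : Eu N) : ℝ :=
  ∫ y in Metric.ball x r, w y ∂(leb Ω)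

/-- Translation by `z` moves a test function in `L¹` by at most `‖z‖` times the `L¹` norm of its
gradient: the fundamental theorem of calculus along segments. -/
lemma lintegral_translate_sub_le {φ : Eu N → ℝ} (hφ : IsTestFn Ω φ) (z : Eu N) :
    ∫⁻ x, ‖φ (x + z) - φ x‖ₑ ≤ ‖z‖ₑ * ∫⁻ x, ‖gradient φ x‖ₑ := by
  have hgc := hφ.continuous_gradient
  have h1 : ∀ x, ‖φ (x + z) - φ x‖ₑ
      ≤ ∫⁻ t in Ioc (0 : ℝ) 1, ‖z‖ₑ * ‖gradient φ (x + t • z)‖ₑ := by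
    intro x
    have hd : ∀ t ∈ uIcc (0 : ℝ) 1, HasDerivAt (fun t : ℝ => φ (x + t • z))
        (fderiv ℝ φ (x + t • z) z) t := fun t _ => by
      have h2 : HasDerivAt (fun t : ℝ => x + t • z) z t := by
        simpa using ((hasDerivAt_id t).smul_const z).const_add x
      exact (hφ.differentiable _).hasFDerivAt.comp_hasDerivAt t h2
    have hc : Continuous fun t : ℝ => fderiv ℝ φ (x + t • z) z :=
      ((hφ.1.continuous_fderiv (by simp)).comp (by fun_prop)).clm_apply continuous_const
    have h3 := intervalIntegral.integral_eq_sub_of_hasDerivAt hd (hc.intervalIntegrable 0 1)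
    simp only [one_smul, zero_smul, add_zero] at h3
    rw [← h3, intervalIntegral.integral_of_le zero_le_one]
    refine (enorm_integral_le_lintegral_enorm _).trans (lintegral_mono fun t => ?_)
    rw [← inner_gradient_left, mul_comm ‖z‖ₑ]
    rw [← ofReal_norm, ← ofReal_norm, ← ofReal_norm, ← ENNReal.ofReal_mul (norm_nonneg _)]
    exact ENNReal.ofReal_le_ofReal (norm_inner_le_norm _ _)
  have hm : Measurable fun q : Eu N × ℝ => ‖z‖ₑ * ‖gradient φ (q.1 + q.2 • z)‖ₑ :=
    ((hgc.comp (by fun_prop :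
      Continuous fun q : Eu N × ℝ => q.1 + q.2 • z)).enorm.measurable).const_mul _
  calc ∫⁻ x, ‖φ (x + z) - φ x‖ₑ
      ≤ ∫⁻ x, ∫⁻ t in Ioc (0 : ℝ) 1, ‖z‖ₑ * ‖gradient φ (x + t • z)‖ₑ := lintegral_mono h1
    _ = ∫⁻ t in Ioc (0 : ℝ) 1, ∫⁻ x, ‖z‖ₑ * ‖gradient φ (x + t • z)‖ₑ :=
        lintegral_lintegral_swap hm.aemeasurable
    _ = ∫⁻ t in Ioc (0 : ℝ) 1, ‖z‖ₑ * ∫⁻ x, ‖gradient φ x‖ₑ := by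
        refine lintegral_congr fun t => ?_
        rw [lintegral_const_mul' _ _ (by simp),
          lintegral_add_right_eq_self (fun x => ‖gradient φ x‖ₑ)]
    _ = _ := by simp

lemma ballIntegral_testFn {φ : Eu N → ℝ} (hφ : IsTestFn Ω φ) (r : ℝ) (x : Eu N) :
    ballIntegral Ω r φ x = ∫ z in Metric.ball (0 : Eu N) r, φ (x + z) := by
  unfold ballIntegral
  rw [Measure.restrict_restrict measurableSet_ball,
    ← setIntegral_eq_of_subset_of_forall_sdiff_eq_zero measurableSet_ball inter_subset_left
      (fun y hy => hφ.eq_zero fun h => hy.2 ⟨hy.1, h⟩),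
    ← (measurePreserving_add_left volume x).setIntegral_preimage_emb
      (measurableEmbedding_addLeft x)]
  simp

lemma lintegral_ballIntegral_sub_testFn_le {φ : Eu N → ℝ} (hφ : IsTestFn Ω φ) (r : ℝ) :
    ∫⁻ x in Ω, ‖ballIntegral Ω r φ x - (volume (Metric.ball (0 : Eu N) r)).toReal * φ x‖ₑ
      ≤ volume (Metric.ball (0 : Eu N) r) * (ENNReal.ofReal r * ∫⁻ x in Ω, ‖gradient φ x‖ₑ) := by
  have hc : Continuous φ := hφ.1.continuous
  have hm : Measurable fun q : Eu N × Eu N => ‖φ (q.1 + q.2) - φ q.1‖ₑ := by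
    have : Continuous fun q : Eu N × Eu N => φ (q.1 + q.2) - φ q.1 := by fun_prop
    exact this.enorm.measurable
  have e1 : ∫⁻ x in Ω, ‖gradient φ x‖ₑ = ∫⁻ x, ‖gradient φ x‖ₑ := by
    rw [← eLpNorm_one_eq_lintegral_enorm, ← eLpNorm_one_eq_lintegral_enorm]
    refine eLpNorm_restrict_eq_of_support_subset fun x hx => ?_
    by_contra h
    exact hx (hφ.gradient_eq_zero h)
  rw [e1]
  calc _ ≤ ∫⁻ x, ‖ballIntegral Ω r φ x
        - (volume (Metric.ball (0 : Eu N) r)).toReal * φ x‖ₑ := setLIntegral_le_lintegral _ _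
    _ ≤ ∫⁻ x, ∫⁻ z in Metric.ball (0 : Eu N) r, ‖φ (x + z) - φ x‖ₑ := by
        refine lintegral_mono fun x => ?_
        have hi : IntegrableOn (fun z => φ (x + z)) (Metric.ball (0 : Eu N) r) :=
          ((hc.comp (by fun_prop)).continuousOn.integrableOn_compact
            (isCompact_closedBall (0 : Eu N) r)).mono_set Metric.ball_subset_closedBall
        have hi2 : IntegrableOn (fun _ => φ x) (Metric.ball (0 : Eu N) r) :=
          integrableOn_const (measure_ball_lt_top.ne)
        have : ballIntegral Ω r φ x - (volume (Metric.ball (0 : Eu N) r)).toReal * φ x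
            = ∫ z in Metric.ball (0 : Eu N) r, (φ (x + z) - φ x) := by
          rw [ballIntegral_testFn hφ, integral_sub hi hi2, setIntegral_const, smul_eq_mul]; rfl
        rw [this]
        exact enorm_integral_le_lintegral_enorm _
    _ = ∫⁻ z in Metric.ball (0 : Eu N) r, ∫⁻ x, ‖φ (x + z) - φ x‖ₑ :=
        lintegral_lintegral_swap hm.aemeasurable
    _ ≤ ∫⁻ _ in Metric.ball (0 : Eu N) r, ENNReal.ofReal r * ∫⁻ x, ‖gradient φ x‖ₑ := by
        refine setLIntegral_mono measurable_const fun z hz => ?_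
        refine (lintegral_translate_sub_le hφ z).trans ?_
        gcongr
        rw [← ofReal_norm]
        exact ENNReal.ofReal_le_ofReal (mem_ball_zero_iff.1 hz).le
    _ = _ := by rw [setLIntegral_const, mul_comm]

lemma enorm_ballIntegral_le (r : ℝ) (w : Eu N → ℝ) (x : Eu N) :
    ‖ballIntegral Ω r w x‖ₑ ≤ ∫⁻ y in Ω, ‖w y‖ₑ :=
  (enorm_integral_le_lintegral_enorm _).trans (setLIntegral_le_lintegral _ _)

lemma ballIntegral_sub {w w' : Eu N → ℝ} (hw : Integrable w (leb Ω))
    (hw' : Integrable w' (leb Ω)) (r : ℝ) (x : Eu N) :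
    ballIntegral Ω r (fun y => w y - w' y) x = ballIntegral Ω r w x - ballIntegral Ω r w' x :=
  integral_sub hw.integrableOn hw'.integrableOn

/-- Averaging over balls of radius `r` moves a function of `W₀^{1,p}(Ω)` in `L¹` by at most `r`
times the `L¹` norm of its gradient. -/
lemma IsW0.lintegral_ballIntegral_sub_le [IsFiniteMeasure (leb Ω)] (hp : 1 < p)
    {w : Eu N → ℝ} {G : Eu N → Eu N} (h : IsW0 p Ω w G) (r : ℝ) :
    ∫⁻ x in Ω, ‖ballIntegral Ω r w x - (volume (Metric.ball (0 : Eu N) r)).toReal * w x‖ₑ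
      ≤ volume (Metric.ball (0 : Eu N) r) * (ENNReal.ofReal r * ∫⁻ x in Ω, ‖G x‖ₑ) := by
  obtain ⟨-, hw, hG, φ, hφ, t1, t2⟩ := h
  have hVtop : volume (Metric.ball (0 : Eu N) r) ≠ ⊤ := measure_ball_lt_top.ne
  set V := volume (Metric.ball (0 : Eu N) r) with hV
  have hw1 := integrable_of_memLp hp hw
  have hG1 := integrable_of_memLp hp hG
  have hφ1 : ∀ n, Integrable (φ n) (leb Ω) := fun n => memLp_one_iff_integrable.1 ((hφ n).memLp 1)
  have t1' := tendsto_eLpNorm_of_le (one_le_ofReal hp) one_ne_zero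
    (fun n => ((hφ1 n).sub hw1).1) t1
  have t2' := tendsto_eLpNorm_of_le (one_le_ofReal hp) one_ne_zero
    (fun n => (((hφ n).memLp_gradient 1).sub (memLp_one_iff_integrable.2 hG1)).1) t2
  simp only [eLpNorm_one_eq_lintegral_enorm, Pi.sub_apply] at t1' t2'
  have key : ∀ n, ∫⁻ x in Ω, ‖ballIntegral Ω r w x - V.toReal * w x‖ₑ
      ≤ V * (ENNReal.ofReal r * ((∫⁻ x in Ω, ‖gradient (φ n) x - G x‖ₑ) + ∫⁻ x in Ω, ‖G x‖ₑ))
        + ((∫⁻ x in Ω, ‖φ n x - w x‖ₑ) * leb Ω univ + V * ∫⁻ x in Ω, ‖φ n x - w x‖ₑ) := by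
    intro n
    set c := ∫⁻ x in Ω, ‖φ n x - w x‖ₑ with hc
    have hm : AEMeasurable (fun x => c + V * ‖φ n x - w x‖ₑ) (leb Ω) :=
      ((((hφ1 n).sub hw1).1.enorm).const_mul V).const_add c
    calc ∫⁻ x in Ω, ‖ballIntegral Ω r w x - V.toReal * w x‖ₑ
        ≤ ∫⁻ x in Ω, (‖ballIntegral Ω r (φ n) x - V.toReal * φ n x‖ₑ
          + (c + V * ‖φ n x - w x‖ₑ)) := by
          refine lintegral_mono fun x => ?_
          have e : ballIntegral Ω r w x - V.toReal * w x
              = (ballIntegral Ω r (φ n) x - V.toReal * φ n x)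
                + (-ballIntegral Ω r (fun y => φ n y - w y) x
                + V.toReal * (φ n x - w x)) := by
            rw [ballIntegral_sub (hφ1 n) hw1]; ring
          simp only
          rw [e]
          refine (enorm_add_le _ _).trans (add_le_add_right ((enorm_add_le _ _).trans ?_) _)
          rw [enorm_neg, enorm_mul]
          refine add_le_add (enorm_ballIntegral_le r _ x) (mul_le_mul_left (le_of_eq ?_) _)
          rw [Real.enorm_of_nonneg ENNReal.toReal_nonneg, ENNReal.ofReal_toReal hVtop]
      _ = (∫⁻ x in Ω, ‖ballIntegral Ω r (φ n) x - V.toReal * φ n x‖ₑ)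
          + (c * leb Ω univ + V * c) := by
          rw [lintegral_add_right' _ hm, lintegral_add_left measurable_const,
            lintegral_const, lintegral_const_mul' _ _ hVtop]
      _ ≤ _ := by
          refine add_le_add_left ((lintegral_ballIntegral_sub_testFn_le (hφ n) r).trans ?_) _
          gcongr
          rw [← lintegral_add_right' _ hG1.1.enorm]
          refine lintegral_mono fun x => ?_
          have e : gradient (φ n) x = (gradient (φ n) x - G x) + G x := by abel
          conv_lhs => rw [e]
          exact enorm_add_le _ _
  have hlim : Tendsto (fun n => V * (ENNReal.ofReal r *
      ((∫⁻ x in Ω, ‖gradient (φ n) x - G x‖ₑ) + ∫⁻ x in Ω, ‖G x‖ₑ))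
        + ((∫⁻ x in Ω, ‖φ n x - w x‖ₑ) * leb Ω univ + V * ∫⁻ x in Ω, ‖φ n x - w x‖ₑ)) atTop
      (𝓝 (V * (ENNReal.ofReal r * (0 + ∫⁻ x in Ω, ‖G x‖ₑ)) + (0 * leb Ω univ + V * 0))) := by
    refine Tendsto.add (ENNReal.Tendsto.const_mul (ENNReal.Tendsto.const_mul
      (t2'.add_const _) (Or.inr ENNReal.ofReal_ne_top)) (Or.inr hVtop)) (Tendsto.add
      (ENNReal.Tendsto.mul_const t1' (Or.inr (measure_ne_top _ _)))
      (ENNReal.Tendsto.const_mul t1' (Or.inr hVtop)))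
  have := ge_of_tendsto' hlim key
  simpa using this

lemma aestronglyMeasurable_ballIntegral [IsFiniteMeasure (leb Ω)] {w : Eu N → ℝ}
    (hw : AEStronglyMeasurable w (leb Ω)) (r : ℝ) :
    AEStronglyMeasurable (ballIntegral Ω r w) (leb Ω) := by
  have hS : MeasurableSet {q : Eu N × Eu N | q.2 ∈ Metric.ball q.1 r} :=
    (isOpen_lt (by fun_prop : Continuous fun q : Eu N × Eu N => dist q.2 q.1)
      continuous_const).measurableSet
  have h1 : AEStronglyMeasurable (indicator {q : Eu N × Eu N | q.2 ∈ Metric.ball q.1 r}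
      fun q => w q.2) ((leb Ω).prod (leb Ω)) := (hw.comp_snd).indicator hS
  refine h1.integral_prod_right'.congr (ae_of_all _ fun x => ?_)
  unfold ballIntegral
  rw [← integral_indicator measurableSet_ball]
  rfl

/-- A bounded sequence in `L²(Ω)` has a subsequence whose integrals over all balls converge. -/
lemma exists_subseq_tendsto_ballIntegral [IsFiniteMeasure (leb Ω)] {w : ℕ → Eu N → ℝ} {M : ℝ}
    (hw : ∀ n, MemLp (w n) 2 (leb Ω)) (hM : ∀ n, (eLpNorm (w n) 2 (leb Ω)).toReal ≤ M) :
    ∃ ns : ℕ → ℕ, StrictMono ns ∧ ∀ r x, ∃ l : ℝ,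
      Tendsto (fun n => ballIntegral Ω r (w (ns n)) x) atTop (𝓝 l) := by
  have : Fact ((1 : ENNReal) ≤ 2) := ⟨by norm_num⟩
  have : Fact ((2 : ENNReal) ≠ ⊤) := ⟨by norm_num⟩
  set f : ℕ → Lp ℝ 2 (leb Ω) := fun n => (hw n).toLp with hf
  set d : ℕ → WeakDual ℝ (Lp ℝ 2 (leb Ω)) := fun n =>
    StrongDual.toWeakDual (InnerProductSpace.toDual ℝ _ (f n)) with hd
  obtain ⟨a, -, ns, hns, hlim⟩ := WeakDual.isSeqCompact_closedBall ℝ (Lp ℝ 2 (leb Ω)) 0 M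
    (x := d) (fun n => by
      simp only [mem_preimage, mem_closedBall_zero_iff]
      refine le_trans (le_of_eq ?_) (hM n)
      refine ((InnerProductSpace.toDual ℝ _).norm_map (f n)).trans ?_
      exact Lp.norm_toLp _ (hw n))
  refine ⟨ns, hns, fun r x => ⟨a (indicatorConstLp 2 measurableSet_ball
    (measure_ne_top (leb Ω) (Metric.ball x r)) 1), ?_⟩⟩
  have := ((WeakDual.eval_continuous (𝕜 := ℝ) (indicatorConstLp 2 measurableSet_ball
    (measure_ne_top (leb Ω) (Metric.ball x r)) (1 : ℝ))).tendsto a).comp hlim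
  refine this.congr fun n => ?_
  change inner ℝ (f (ns n)) (indicatorConstLp 2 measurableSet_ball
    (measure_ne_top (leb Ω) (Metric.ball x r)) (1 : ℝ)) = _
  rw [real_inner_comm, L2.inner_indicatorConstLp_one]
  exact integral_congr_ae (ae_restrict_of_ae (hw (ns n)).coeFn_toLp)

/-- The compactness part of the Rellich theorem for sequences which are also bounded in
`L²(Ω)`. -/
lemma exists_subseq_cauchy_eLpNorm_one [IsFiniteMeasure (leb Ω)] (hp : 1 < p)
    {w : ℕ → Eu N → ℝ} {G : ℕ → Eu N → Eu N} {M K : ℝ} (h : ∀ n, IsW0 p Ω (w n) (G n))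
    (hw : ∀ n, MemLp (w n) 2 (leb Ω)) (hM : ∀ n, (eLpNorm (w n) 2 (leb Ω)).toReal ≤ M)
    (hK : ∀ n, ∫⁻ x in Ω, ‖G n x‖ₑ ≤ ENNReal.ofReal K) :
    ∃ ns : ℕ → ℕ, StrictMono ns ∧ ∀ ε : ENNReal, 0 < ε → ∃ n₀, ∀ n ≥ n₀, ∀ m ≥ n₀,
      ∫⁻ x in Ω, ‖w (ns n) x - w (ns m) x‖ₑ ≤ ε := by
  obtain ⟨ns, hns, hlim⟩ := exists_subseq_tendsto_ballIntegral hw hM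
  refine ⟨ns, hns, fun ε hε => ?_⟩
  obtain ⟨B, hBtop, hB⟩ : ∃ B : ENNReal, B ≠ ⊤ ∧ ∀ n, ∫⁻ x in Ω, ‖w n x‖ₑ ≤ B := by
    refine ⟨ENNReal.ofReal M * leb Ω univ ^ (1 / (1 : ENNReal).toReal - 1 / (2 : ENNReal).toReal),
      ENNReal.mul_ne_top ENNReal.ofReal_ne_top
        (ENNReal.rpow_ne_top_of_nonneg (by norm_num) (measure_ne_top _ _)), fun n => ?_⟩
    rw [← eLpNorm_one_eq_lintegral_enorm]
    refine (eLpNorm_le_eLpNorm_mul_rpow_measure_univ (q := 2) (by norm_num) (hw n).1).trans ?_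
    gcongr
    rw [← ENNReal.ofReal_toReal (hw n).2.ne]
    exact ENNReal.ofReal_le_ofReal (hM n)
  -- choose the radius so that replacing `w` by its averages costs at most `ε / 4`
  obtain ⟨r, hr, hrK⟩ : ∃ r > 0, ENNReal.ofReal r * ENNReal.ofReal K ≤ ε / 4 := by
    have : Tendsto (fun r : ℝ => ENNReal.ofReal r * ENNReal.ofReal K) (𝓝[>] 0) (𝓝 0) := by
      have h0 : Tendsto (fun r : ℝ => ENNReal.ofReal r) (𝓝[>] 0) (𝓝 0) := by
        have := (ENNReal.continuous_ofReal.tendsto 0).mono_left (nhdsWithin_le_nhds (s := Ioi 0))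
        simpa using this
      simpa using ENNReal.Tendsto.mul_const h0 (Or.inr (ENNReal.ofReal_ne_top (r := K)))
    have h4 : 0 < ε / 4 := ENNReal.div_pos hε.ne' (by norm_num)
    obtain ⟨r, h1, h2⟩ := ((this.eventually (ge_mem_nhds h4)).and self_mem_nhdsWithin).exists
    exact ⟨r, h2, h1⟩
  set V := volume (Metric.ball (0 : Eu N) r) with hV
  have hVtop : V ≠ ⊤ := measure_ball_lt_top.ne
  have hV0 : V ≠ 0 := (Metric.measure_ball_pos volume _ hr).ne'
  choose l hl using fun x => hlim r x
  have hwi : ∀ n, Integrable (w n) (leb Ω) := fun n => integrable_of_memLp hp (h n).2.1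
  have hmeas : ∀ n, AEStronglyMeasurable (ballIntegral Ω r (w n)) (leb Ω) := fun n =>
    aestronglyMeasurable_ballIntegral (hwi n).1 r
  have hdom : Tendsto (fun n => ∫⁻ x in Ω, ‖ballIntegral Ω r (w (ns n)) x - l x‖ₑ) atTop
      (𝓝 0) := by
    have := tendsto_lintegral_norm_of_dominated_convergence (μ := leb Ω)
      (F := fun n => ballIntegral Ω r (w (ns n))) (f := l) (bound := fun _ => B.toReal)
      (fun n => hmeas _) ((integrable_const B.toReal).2)
      (fun n => ae_of_all _ fun x => ?_) (ae_of_all _ fun x => hl x)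
    · simpa only [ofReal_norm] using this
    · have h1 := (enorm_ballIntegral_le (Ω := Ω) r (w (ns n)) x).trans (hB _)
      rw [← toReal_enorm]
      exact ENNReal.toReal_mono hBtop h1
  have hpos : 0 < V * (ε / 4) :=
    pos_iff_ne_zero.2 (mul_ne_zero hV0 (ENNReal.div_pos hε.ne' (by norm_num)).ne')
  obtain ⟨n₀, hn₀⟩ := eventually_atTop.1 (hdom.eventually (ge_mem_nhds hpos))
  have hD : ∀ n, ∫⁻ x in Ω, ‖ballIntegral Ω r (w n) x - V.toReal * w n x‖ₑ ≤ V * (ε / 4) :=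
    fun n => ((h n).lintegral_ballIntegral_sub_le hp r).trans (by
      gcongr
      exact (mul_le_mul_right (hK n) _).trans hrK)
  have hlm : AEStronglyMeasurable l (leb Ω) :=
    aestronglyMeasurable_of_tendsto_ae atTop (fun n => hmeas (ns n)) (ae_of_all _ hl)
  refine ⟨n₀, fun n hn m hm => ?_⟩
  have hfin : V * ∫⁻ x in Ω, ‖w (ns n) x - w (ns m) x‖ₑ ≤ V * ε := by
    have m1 : ∀ k, AEMeasurable (fun x => ‖ballIntegral Ω r (w k) x - V.toReal * w k x‖ₑ)
        (leb Ω) := fun k => ((hmeas k).sub ((hwi k).1.const_mul _)).enorm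
    have m2 : ∀ k, AEMeasurable (fun x => ‖ballIntegral Ω r (w k) x - l x‖ₑ) (leb Ω) := fun k =>
      ((hmeas k).sub hlm).enorm
    calc V * ∫⁻ x in Ω, ‖w (ns n) x - w (ns m) x‖ₑ
        = ∫⁻ x in Ω, ‖V.toReal * (w (ns n) x - w (ns m) x)‖ₑ := by
          rw [← lintegral_const_mul' _ _ hVtop]
          refine lintegral_congr fun x => ?_
          rw [enorm_mul, Real.enorm_of_nonneg ENNReal.toReal_nonneg, ENNReal.ofReal_toReal hVtop]
      _ ≤ ∫⁻ x in Ω, ((‖ballIntegral Ω r (w (ns n)) x - V.toReal * w (ns n) x‖ₑ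
            + ‖ballIntegral Ω r (w (ns m)) x - V.toReal * w (ns m) x‖ₑ)
          + (‖ballIntegral Ω r (w (ns n)) x - l x‖ₑ
            + ‖ballIntegral Ω r (w (ns m)) x - l x‖ₑ)) := by
          refine lintegral_mono fun x => ?_
          have e : V.toReal * (w (ns n) x - w (ns m) x)
            = (-(ballIntegral Ω r (w (ns n)) x - V.toReal * w (ns n) x)
              + (ballIntegral Ω r (w (ns m)) x - V.toReal * w (ns m) x))
              + ((ballIntegral Ω r (w (ns n)) x - l x)
              + -(ballIntegral Ω r (w (ns m)) x - l x)) := by ring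
          rw [e]
          refine (enorm_add_le _ _).trans (add_le_add ((enorm_add_le _ _).trans ?_)
            ((enorm_add_le _ _).trans ?_)) <;> simp only [enorm_neg, le_refl]
      _ ≤ (V * (ε / 4) + V * (ε / 4)) + (V * (ε / 4) + V * (ε / 4)) := by
          have m3 : AEMeasurable (fun x => ‖ballIntegral Ω r (w (ns n)) x - V.toReal * w (ns n) x‖ₑ
              + ‖ballIntegral Ω r (w (ns m)) x - V.toReal * w (ns m) x‖ₑ) (leb Ω) :=
            (m1 _).add (m1 _)
          rw [lintegral_add_left' m3, lintegral_add_left' (m1 _), lintegral_add_left' (m2 _)]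
          exact add_le_add (add_le_add (hD _) (hD _)) (add_le_add (hn₀ n hn) (hn₀ m hm))
      _ = V * ε := by
          rw [← mul_add, ← mul_add]
          congr 1
          rw [← two_mul, ← two_mul, ← mul_assoc]
          norm_num
          exact ENNReal.mul_div_cancel (by norm_num) (by norm_num)
  exact (ENNReal.mul_le_mul_iff_right hV0 hVtop).1 hfin

end Compactness

/-! ### Existence of a global minimizer -/

section LpLimits

variable {α E : Type*} [MeasurableSpace α] {μ : Measure α} [NormedAddCommGroup E] {p : ℝ}

lemma exists_limit_of_integral_cauchy [CompleteSpace E] (hp : 1 < p) {F : ℕ → α → E}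
    (hF : ∀ n, MemLp (F n) (ENNReal.ofReal p) μ)
    (hc : ∀ η > 0, ∃ n₀, ∀ n ≥ n₀, ∀ m ≥ n₀, ∫ x, ‖F n x - F m x‖ ^ p ∂μ ≤ η) :
    ∃ f, MemLp f (ENNReal.ofReal p) μ ∧
      Tendsto (fun n => eLpNorm (fun x => F n x - f x) (ENNReal.ofReal p) μ) atTop (𝓝 0) := by
  have : Fact (1 ≤ ENNReal.ofReal p) := ⟨one_le_ofReal hp⟩
  have hcs : CauchySeq fun n => (hF n).toLp := by
    rw [Metric.cauchySeq_iff]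
    intro ε hε
    obtain ⟨n₀, hn₀⟩ := hc ((ε / 2) ^ p) (by positivity)
    refine ⟨n₀, fun m hm n hn => ?_⟩
    have h1 := hn₀ m hm n hn
    have h2 := integral_norm_rpow hp ((hF m).sub (hF n))
    simp only [Pi.sub_apply] at h2
    rw [h2] at h1
    have h3 := (Real.rpow_le_rpow_iff ENNReal.toReal_nonneg (by positivity) (by linarith)).1 h1
    rw [dist_eq_norm, ← MemLp.toLp_sub, Lp.norm_toLp]
    linarith
  obtain ⟨f, hf⟩ := cauchySeq_tendsto_of_complete hcs
  exact ⟨f, Lp.memLp f, (Lp.tendsto_Lp_iff_tendsto_eLpNorm'' F hF f (Lp.memLp f)).1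
    (by simpa using hf)⟩

lemma tendsto_integral_norm_rpow (hp : 1 < p) {F : ℕ → α → E} {f : α → E}
    (hF : ∀ n, MemLp (F n) (ENNReal.ofReal p) μ) (hf : MemLp f (ENNReal.ofReal p) μ)
    (h : Tendsto (fun n => eLpNorm (fun x => F n x - f x) (ENNReal.ofReal p) μ) atTop (𝓝 0)) :
    Tendsto (fun n => ∫ x, ‖F n x‖ ^ p ∂μ) atTop (𝓝 (∫ x, ‖f x‖ ^ p ∂μ)) := by
  have : Fact (1 ≤ ENNReal.ofReal p) := ⟨one_le_ofReal hp⟩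
  have h1 := ((Lp.tendsto_Lp_iff_tendsto_eLpNorm'' F hF f hf).2 h).norm
  simp only [Lp.norm_toLp] at h1
  rw [integral_norm_rpow hp hf]
  refine (h1.rpow_const (Or.inr (by linarith))).congr fun n => ?_
  rw [integral_norm_rpow hp (hF n)]

lemma tendsto_integral_mul_of_eLpNorm {F : ℕ → α → ℝ} {f h : α → ℝ} (hh : MemLp h 2 μ)
    (hF : ∀ n, MemLp (F n) 2 μ) (hf : MemLp f 2 μ)
    (ht : Tendsto (fun n => eLpNorm (fun x => F n x - f x) 2 μ) atTop (𝓝 0)) :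
    Tendsto (fun n => ∫ x, h x * F n x ∂μ) atTop (𝓝 (∫ x, h x * f x ∂μ)) := by
  have key : ∀ {g : α → ℝ} (hg : MemLp g 2 μ),
      inner ℝ (hh.toLp) (hg.toLp) = ∫ x, h x * g x ∂μ := fun hg => by
    rw [L2.inner_def]
    refine integral_congr_ae ?_
    filter_upwards [hh.coeFn_toLp, hg.coeFn_toLp] with x h1 h2
    rw [h1, h2]; simp [mul_comm]
  have h1 := (Lp.tendsto_Lp_iff_tendsto_eLpNorm'' F hF f hf).2 ht
  have h2 := (tendsto_const_nhds (x := hh.toLp)).inner (𝕜 := ℝ) h1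
  rw [key hf] at h2
  exact h2.congr fun n => key (hF n)

end LpLimits

section Existence

variable {N : ℕ} {Ω : Set (Eu N)} {p lam : ℝ}

/-- Since `p < 2`, the quadratic term absorbs both the term `-λ/p |w| ^ p` and the source. -/
lemma exists_energy_coercive [IsFiniteMeasure (leb Ω)] (hp : 1 < p) (hp2 : p < 2)
    (hlam : 0 < lam) {h : Eu N → ℝ} (hh : MemLp h 2 (leb Ω)) :
    ∃ K, ∀ w, MemX p Ω w → 1 / p * (∫ x in Ω, ‖weakGrad Ω w x‖ ^ p)
      + 1 / 4 * (∫ x in Ω, |w x| ^ 2) ≤ energy p lam Ω h w + K := by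
  obtain ⟨C, hC0, hC⟩ := exists_rpow_le_sq_add (p := p) (δ := p / lam * (1 / 8)) hp hp2
    (by positivity)
  set D := lam / p * C with hD
  refine ⟨∫ x in Ω, (4 * D ^ 2 + 4 * |h x| ^ 2), fun w hw => ?_⟩
  have i1 : Integrable (fun x => |w x| ^ p) (leb Ω) := integrable_norm_rpow hp hw.memLp
  have i2 := integrable_sq hw.2
  have i3 : Integrable (fun x => h x * w x) (leb Ω) := hh.integrable_mul hw.2
  have i4 : Integrable (fun x => 4 * D ^ 2 + 4 * |h x| ^ 2) (leb Ω) :=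
    (integrable_const _).add ((integrable_sq hh).const_mul 4)
  have key : lam / p * (∫ x in Ω, |w x| ^ p) + (∫ x in Ω, h x * w x)
      ≤ 1 / 4 * (∫ x in Ω, |w x| ^ 2) + ∫ x in Ω, (4 * D ^ 2 + 4 * |h x| ^ 2) := by
    rw [← integral_const_mul, ← integral_const_mul, ← integral_add (i1.const_mul _) i3,
      ← integral_add (i2.const_mul _) i4]
    refine integral_mono ((i1.const_mul _).add i3) ((i2.const_mul _).add i4) fun x => ?_
    simp only
    have h1 := mul_le_mul_of_nonneg_left (hC |w x| (abs_nonneg _))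
      (by positivity : 0 ≤ lam / p)
    have h2 : lam / p * (p / lam * (1 / 8) * |w x| ^ 2 + C * |w x|)
        = 1 / 8 * |w x| ^ 2 + D * |w x| := by
      rw [hD]; field_simp
    have h3 : h x * w x ≤ |h x| * |w x| := (le_abs_self _).trans (abs_mul _ _).le
    nlinarith [sq_nonneg (|w x| - 4 * (D + |h x|)), sq_nonneg (D - |h x|)]
  unfold energy
  linarith

/-- The parallelogram identity for the energy: the midpoint lowers the average energy by the defects
of the gradient term and of the quadratic term, up to the defect of the nonconvex term. -/
lemma energy_midpoint (hp : 1 < p) (hΩ : IsOpen Ω) {h u v : Eu N → ℝ}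
    (hh : MemLp h 2 (leb Ω)) (hu : MemX p Ω u) (hv : MemX p Ω v) :
    energy p lam Ω h u + energy p lam Ω h v
        - 2 * energy p lam Ω h (fun x => 1 / 2 * (u x + v x))
      = 1 / p * (∫ x in Ω, midDefect p (weakGrad Ω u x) (weakGrad Ω v x))
        - lam / p * (∫ x in Ω, midDefect p (u x) (v x)) + 1 / 4 * ∫ x in Ω, |u x - v x| ^ 2 := by
  have split : ∀ {E : Type} [NormedAddCommGroup E] [InnerProductSpace ℝ E] {f g : Eu N → E},
      MemLp f (ENNReal.ofReal p) (leb Ω) → MemLp g (ENNReal.ofReal p) (leb Ω) →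
      ∫ x in Ω, midDefect p (f x) (g x) = (∫ x in Ω, ‖f x‖ ^ p) + (∫ x in Ω, ‖g x‖ ^ p)
        - 2 * ∫ x in Ω, ‖(1 / 2 : ℝ) • (f x + g x)‖ ^ p := by
    intro E _ _ f g hf hg
    have i1 := integrable_norm_rpow hp hf
    have i2 := integrable_norm_rpow hp hg
    have i3 : Integrable (fun x => ‖(1 / 2 : ℝ) • (f x + g x)‖ ^ p) (leb Ω) :=
      integrable_norm_rpow hp ((hf.add hg).const_smul (1 / 2 : ℝ))
    have i4 : Integrable (fun x => ‖f x‖ ^ p + ‖g x‖ ^ p) (leb Ω) := i1.add i2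
    unfold midDefect
    rw [integral_sub i4 (i3.const_mul 2), integral_add i1 i2, integral_const_mul]
  have e1 := split (hu.memLp_weakGrad hΩ) (hv.memLp_weakGrad hΩ)
  have e2 := split hu.memLp hv.memLp
  have e3 : ∫ x in Ω, ‖weakGrad Ω (fun x => 1 / 2 * (u x + v x)) x‖ ^ p
      = ∫ x in Ω, ‖(1 / 2 : ℝ) • (weakGrad Ω u x + weakGrad Ω v x)‖ ^ p := by
    refine integral_congr_ae ?_
    filter_upwards [weakGrad_const_mul hΩ (hu.add hp hv) (1 / 2), weakGrad_add hΩ hu hv]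
      with x h1 h2
    rw [h1, h2]
  have i1 := integrable_sq hu.2
  have i2 := integrable_sq hv.2
  have i3 : Integrable (fun x => |u x - v x| ^ 2) (leb Ω) := integrable_sq (hu.2.sub hv.2)
  have i4 : Integrable (fun x => |1 / 2 * (u x + v x)| ^ 2) (leb Ω) :=
    integrable_sq ((hu.2.add hv.2).const_mul (1 / 2))
  have e4 : (∫ x in Ω, |u x| ^ 2) + (∫ x in Ω, |v x| ^ 2)
      = 2 * (∫ x in Ω, |1 / 2 * (u x + v x)| ^ 2) + 1 / 2 * ∫ x in Ω, |u x - v x| ^ 2 := by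
    rw [← integral_const_mul, ← integral_const_mul, ← integral_add i1 i2,
      ← integral_add (i4.const_mul 2) (i3.const_mul _)]
    refine integral_congr_ae (ae_of_all _ fun x => ?_)
    simp only [sq_abs]; ring
  have e5 : ∫ x in Ω, h x * (1 / 2 * (u x + v x))
      = 1 / 2 * ((∫ x in Ω, h x * u x) + ∫ x in Ω, h x * v x) := by
    have j1 : Integrable (fun x => h x * u x) (leb Ω) := hh.integrable_mul hu.2
    have j2 : Integrable (fun x => h x * v x) (leb Ω) := hh.integrable_mul hv.2
    rw [← integral_add j1 j2, ← integral_const_mul]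
    refine integral_congr_ae (ae_of_all _ fun x => ?_)
    simp only; ring
  simp only [Real.norm_eq_abs, smul_eq_mul] at e2
  unfold energy
  rw [e1, e2, e3, e5]
  linear_combination (1 / 2) * e4

/-- Two functions of almost minimal energy which are close in `L^p` are close in `X`. -/
lemma midDefect_add_sq_le (hp : 1 < p) (hp2 : p < 2) (hlam : 0 < lam) (hΩ : IsOpen Ω)
    {h u v : Eu N → ℝ} (hh : MemLp h 2 (leb Ω)) (hu : MemX p Ω u) (hv : MemX p Ω v)
    {m ε : ℝ} (hm : ∀ w, MemX p Ω w → m ≤ energy p lam Ω h w)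
    (hue : energy p lam Ω h u ≤ m + ε) (hve : energy p lam Ω h v ≤ m + ε) :
    1 / p * (∫ x in Ω, midDefect p (weakGrad Ω u x) (weakGrad Ω v x))
      + 1 / 4 * (∫ x in Ω, |u x - v x| ^ 2)
      ≤ 2 * ε + lam / p * (20 * ∫ x in Ω, |u x - v x| ^ p) := by
  have h1 := energy_midpoint (lam := lam) hp hΩ hh hu hv
  have h2 := hm _ ((hu.add hp hv).const_mul (1 / 2))
  have i1 : Integrable (fun x => |u x - v x| ^ p) (leb Ω) :=
    integrable_norm_rpow hp (hu.memLp.sub hv.memLp)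
  have h3 : ∫ x in Ω, midDefect p (u x) (v x) ≤ 20 * ∫ x in Ω, |u x - v x| ^ p := by
    rw [← integral_const_mul]
    exact integral_mono_of_nonneg (ae_of_all _ fun x => midDefect_nonneg hp _ _)
      (i1.const_mul _) (ae_of_all _ fun x => midDefect_le hp hp2 _ _)
  have h4 := mul_le_mul_of_nonneg_left h3 (by positivity : 0 ≤ lam / p)
  linarith

lemma integrable_midDefect (hp : 1 < p) {f g : Eu N → Eu N}
    (hf : MemLp f (ENNReal.ofReal p) (leb Ω)) (hg : MemLp g (ENNReal.ofReal p) (leb Ω)) :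
    Integrable (fun x => midDefect p (f x) (g x)) (leb Ω) :=
  ((integrable_norm_rpow hp hf).add (integrable_norm_rpow hp hg)).sub
    ((integrable_norm_rpow hp ((hf.add hg).const_smul (1 / 2 : ℝ))).const_mul 2)

/-- The direct method: a minimizing sequence has a subsequence which is Cauchy in `L¹(Ω)`, hence in
`L^p(Ω)` by interpolation with the `L²` bound; the uniform convexity of the remaining part of the
energy then makes it Cauchy in `X`. -/
theorem exists_isGlobalMinimizer [IsFiniteMeasure (leb Ω)] (hp : 1 < p) (hp2 : p < 2)
    (hlam : 0 < lam) (hΩ : IsOpen Ω) {h : Eu N → ℝ} (hh : MemLp h 2 (leb Ω)) :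
    ∃ w, IsGlobalMinimizer p lam Ω h w := by
  have hp0 : 0 < p := by linarith
  obtain ⟨K, hK⟩ := exists_energy_coercive hp hp2 hlam hh
  have hsq0 : ∀ w : Eu N → ℝ, 0 ≤ ∫ x in Ω, |w x| ^ 2 := fun w =>
    integral_nonneg fun x => by positivity
  have hgr0 : ∀ G : Eu N → Eu N, 0 ≤ 1 / p * ∫ x in Ω, ‖G x‖ ^ p := fun G =>
    mul_nonneg (by positivity) (integral_nonneg fun x => by positivity)
  set S : Set ℝ := {e | ∃ w, MemX p Ω w ∧ energy p lam Ω h w = e} with hS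
  have hSne : S.Nonempty := ⟨_, _, memX_zero, rfl⟩
  have hSb : BddBelow S := ⟨-K, by
    rintro _ ⟨w, hw, rfl⟩
    have := hK w hw
    have h1 := hsq0 w
    have h2 := hgr0 (weakGrad Ω w)
    linarith⟩
  set m := sInf S with hm
  have hmle : ∀ w, MemX p Ω w → m ≤ energy p lam Ω h w := fun w hw => csInf_le hSb ⟨w, hw, rfl⟩
  have hseq : ∀ n : ℕ, ∃ w, MemX p Ω w ∧ energy p lam Ω h w ≤ m + 1 / ((n : ℝ) + 1) := by
    intro n
    obtain ⟨_, ⟨w, hw, rfl⟩, hlt⟩ := exists_lt_of_csInf_lt hSne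
      (lt_add_of_pos_right m (by positivity : 0 < 1 / ((n : ℝ) + 1)))
    exact ⟨w, hw, hlt.le⟩
  choose u hu hue using hseq
  set B := 4 * (m + 1 + K) with hB
  have hue1 : ∀ n, energy p lam Ω h (u n) ≤ m + 1 := fun n => by
    have : 1 / ((n : ℝ) + 1) ≤ 1 := by
      rw [div_le_one (by positivity)]; linarith [Nat.cast_nonneg (α := ℝ) n]
    linarith [hue n]
  have hb2 : ∀ n, ∫ x in Ω, |u n x| ^ 2 ≤ B := fun n => by
    have := hK _ (hu n)
    have h2 := hgr0 (weakGrad Ω (u n))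
    linarith [hue1 n]
  have hB0 : 0 ≤ B := (hsq0 _).trans (hb2 0)
  have hbp : ∀ n, ∫ x in Ω, ‖weakGrad Ω (u n) x‖ ^ p ≤ p * B := fun n => by
    have h1 := hK _ (hu n)
    have h2 := hsq0 (u n)
    have h3 : 1 / p * ∫ x in Ω, ‖weakGrad Ω (u n) x‖ ^ p ≤ B := by linarith [hue1 n]
    rw [one_div, inv_mul_le_iff₀ hp0] at h3
    exact h3
  have hM : ∀ n, (eLpNorm (u n) 2 (leb Ω)).toReal ≤ √B := fun n => by
    apply Real.le_sqrt_of_sq_le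
    rw [← integral_sq _ (hu n).2]
    exact hb2 n
  have hGK : ∀ n, ∫⁻ x in Ω, ‖weakGrad Ω (u n) x‖ₑ
      ≤ ENNReal.ofReal ((leb Ω).real univ + p * B) := fun n => by
    have hG := (hu n).memLp_weakGrad hΩ
    have i1 := integrable_of_memLp hp hG
    have i2 := integrable_norm_rpow hp hG
    rw [← ofReal_integral_norm_eq_lintegral_enorm i1]
    refine ENNReal.ofReal_le_ofReal ?_
    have : ∫ x in Ω, ‖weakGrad Ω (u n) x‖ ≤ ∫ x in Ω, (1 + ‖weakGrad Ω (u n) x‖ ^ p) := by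
      refine integral_mono i1.norm ((integrable_const 1).add i2) fun x => ?_
      have := Real.rpow_nonneg (norm_nonneg (weakGrad Ω (u n) x)) p
      rcases le_total ‖weakGrad Ω (u n) x‖ 1 with h | h
      · simp only; linarith
      · have := Real.self_le_rpow_of_one_le h hp.le
        simp only; linarith
    rw [integral_add (integrable_const 1) i2] at this
    simp only [integral_const, smul_eq_mul, mul_one] at this
    linarith [hbp n]
  obtain ⟨ns, hns, hcau⟩ := exists_subseq_cauchy_eLpNorm_one hp (fun n => (hu n).isW0 hΩ)
    (fun n => (hu n).2) hM hGK
  set v : ℕ → Eu N → ℝ := fun n => u (ns n) with hv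
  have hvX : ∀ n, MemX p Ω (v n) := fun n => hu (ns n)
  have hve : ∀ n, energy p lam Ω h (v n) ≤ m + 1 / ((n : ℝ) + 1) := fun n =>
    (hue (ns n)).trans (by
      have : (n : ℝ) ≤ ns n := by exact_mod_cast hns.le_apply
      gcongr)
  have cauP : ∀ η > 0, ∃ n₀, ∀ n ≥ n₀, ∀ k ≥ n₀, ∫ x in Ω, |v n x - v k x| ^ p ≤ η := by
    intro η hη
    obtain ⟨C, hC0, hC⟩ := exists_rpow_le_sq_add (p := p) (δ := η / 2 / (4 * B + 1)) hp hp2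
      (by positivity)
    obtain ⟨n₀, hn₀⟩ := hcau (ENNReal.ofReal (η / 2 / C)) (by simpa using by positivity)
    refine ⟨n₀, fun n hn k hk => ?_⟩
    have i0 : MemLp (fun x => v n x - v k x) 2 (leb Ω) := (hvX n).2.sub (hvX k).2
    have i1 : Integrable (fun x => |v n x - v k x|) (leb Ω) :=
      ((integrable_of_memLp hp (hvX n).memLp).sub (integrable_of_memLp hp (hvX k).memLp)).norm
    have i2 := integrable_sq i0
    have h1 : ∫ x in Ω, |v n x - v k x| ≤ η / 2 / C := by
      have := hn₀ n hn k hk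
      have e := ofReal_integral_norm_eq_lintegral_enorm
        ((integrable_of_memLp hp (hvX n).memLp).sub (integrable_of_memLp hp (hvX k).memLp))
      simp only [Pi.sub_apply, Real.norm_eq_abs] at e
      rw [← e, ENNReal.ofReal_le_ofReal_iff (by positivity)] at this
      exact this
    have h2 : ∫ x in Ω, |v n x - v k x| ^ 2 ≤ 4 * B := by
      have : ∫ x in Ω, |v n x - v k x| ^ 2 ≤ ∫ x in Ω, (2 * |v n x| ^ 2 + 2 * |v k x| ^ 2) := by
        refine integral_mono i2 (((integrable_sq (hvX n).2).const_mul 2).add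
          ((integrable_sq (hvX k).2).const_mul 2)) fun x => ?_
        simp only [sq_abs]
        nlinarith [sq_nonneg (v n x + v k x)]
      rw [integral_add ((integrable_sq (hvX n).2).const_mul 2)
        ((integrable_sq (hvX k).2).const_mul 2), integral_const_mul, integral_const_mul] at this
      have a1 : ∫ x in Ω, |v n x| ^ 2 ≤ B := hb2 (ns n)
      have a2 : ∫ x in Ω, |v k x| ^ 2 ≤ B := hb2 (ns k)
      linarith
    calc ∫ x in Ω, |v n x - v k x| ^ p
        ≤ ∫ x in Ω, (η / 2 / (4 * B + 1) * |v n x - v k x| ^ 2 + C * |v n x - v k x|) :=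
          integral_mono (integrable_norm_rpow hp ((hvX n).memLp.sub (hvX k).memLp))
            ((i2.const_mul _).add (i1.const_mul _)) fun x => hC _ (abs_nonneg _)
      _ = η / 2 / (4 * B + 1) * (∫ x in Ω, |v n x - v k x| ^ 2)
          + C * ∫ x in Ω, |v n x - v k x| := by
          rw [integral_add (i2.const_mul _) (i1.const_mul _), integral_const_mul,
            integral_const_mul]
      _ ≤ η / 2 / (4 * B + 1) * (4 * B + 1) + C * (η / 2 / C) := by
          gcongr
          linarith
      _ = η := by field_simp; ring
  have cauV : ∀ η > 0, ∃ n₀, ∀ n ≥ n₀, ∀ k ≥ n₀,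
      1 / p * (∫ x in Ω, midDefect p (weakGrad Ω (v n) x) (weakGrad Ω (v k) x))
        + 1 / 4 * (∫ x in Ω, |v n x - v k x| ^ 2) ≤ η := by
    intro η hη
    obtain ⟨n₁, hn₁⟩ := cauP (η / 2 / (lam / p * 20)) (by positivity)
    obtain ⟨n₂, hn₂⟩ := exists_nat_one_div_lt (by positivity : 0 < η / 4)
    refine ⟨max n₁ n₂, fun n hn k hk => ?_⟩
    have hsmall : ∀ j ≥ max n₁ n₂, energy p lam Ω h (v j) ≤ m + η / 4 := fun j hj => by
      have h1 : (n₂ : ℝ) ≤ j := by exact_mod_cast (le_max_right _ _).trans hj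
      have h2 : 1 / ((j : ℝ) + 1) ≤ 1 / ((n₂ : ℝ) + 1) := by gcongr
      linarith [hve j]
    have h1 := midDefect_add_sq_le hp hp2 hlam hΩ hh (hvX n) (hvX k) hmle (hsmall n hn)
      (hsmall k hk)
    have h2 := hn₁ n ((le_max_left _ _).trans hn) k ((le_max_left _ _).trans hk)
    rw [le_div_iff₀ (by positivity)] at h2
    nlinarith
  have hdef0 : ∀ f g : Eu N → Eu N, 0 ≤ 1 / p * ∫ x in Ω, midDefect p (f x) (g x) := fun f g =>
    mul_nonneg (by positivity) (integral_nonneg fun x => midDefect_nonneg hp _ _)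
  obtain ⟨w, hw2, hwt⟩ := exists_limit_of_integral_cauchy (μ := leb Ω) (p := 2) (F := v)
    (by norm_num) (fun n => by simpa using (hvX n).2) (by
      intro η hη
      obtain ⟨n₀, hn₀⟩ := cauV (η / 4) (by positivity)
      refine ⟨n₀, fun n hn k hk => ?_⟩
      have h1 := hn₀ n hn k hk
      have h2 := hdef0 (weakGrad Ω (v n)) (weakGrad Ω (v k))
      simp only [Real.norm_eq_abs, Real.rpow_ofNat]
      linarith)
  obtain ⟨G, hGp, hGt⟩ := exists_limit_of_integral_cauchy (μ := leb Ω)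
    (F := fun n => weakGrad Ω (v n)) hp (fun n => (hvX n).memLp_weakGrad hΩ) (by
      intro η hη
      obtain ⟨C, hC0, hC⟩ := exists_norm_sub_rpow_le (E := Eu N) hp
        (δ := η / 2 / (2 * (p * B) + 1)) (by positivity)
      obtain ⟨n₀, hn₀⟩ := cauV (η / 2 / (C * p)) (by positivity)
      refine ⟨n₀, fun n hn k hk => ?_⟩
      have h1 := hn₀ n hn k hk
      have h2 := hsq0 (fun x => v n x - v k x)
      have g1 := (hvX n).memLp_weakGrad hΩ
      have g2 := (hvX k).memLp_weakGrad hΩ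
      have i1 := integrable_norm_rpow hp g1
      have i2 := integrable_norm_rpow hp g2
      have i3 := integrable_midDefect hp g1 g2
      have i4 : Integrable (fun x => ‖weakGrad Ω (v n) x‖ ^ p + ‖weakGrad Ω (v k) x‖ ^ p)
        (leb Ω) := i1.add i2
      have h3 : C * ∫ x in Ω, midDefect p (weakGrad Ω (v n) x) (weakGrad Ω (v k) x) ≤ η / 2 := by
        have : 1 / p * ∫ x in Ω, midDefect p (weakGrad Ω (v n) x) (weakGrad Ω (v k) x)
          ≤ η / 2 / (C * p) := by linarith
        rw [le_div_iff₀ (by positivity)] at this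
        calc _ = (1 / p * ∫ x in Ω, midDefect p (weakGrad Ω (v n) x) (weakGrad Ω (v k) x))
              * (C * p) := by field_simp
          _ ≤ _ := this
      have a1 : ∫ x in Ω, ‖weakGrad Ω (v n) x‖ ^ p ≤ p * B := hbp (ns n)
      have a2 : ∫ x in Ω, ‖weakGrad Ω (v k) x‖ ^ p ≤ p * B := hbp (ns k)
      calc ∫ x in Ω, ‖weakGrad Ω (v n) x - weakGrad Ω (v k) x‖ ^ p
          ≤ ∫ x in Ω, (η / 2 / (2 * (p * B) + 1)
              * (‖weakGrad Ω (v n) x‖ ^ p + ‖weakGrad Ω (v k) x‖ ^ p)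
              + C * midDefect p (weakGrad Ω (v n) x) (weakGrad Ω (v k) x)) :=
            integral_mono (integrable_norm_rpow hp (g1.sub g2))
              ((i4.const_mul _).add (i3.const_mul _)) fun x => hC _ _
        _ = η / 2 / (2 * (p * B) + 1) * ((∫ x in Ω, ‖weakGrad Ω (v n) x‖ ^ p)
              + ∫ x in Ω, ‖weakGrad Ω (v k) x‖ ^ p)
              + C * ∫ x in Ω, midDefect p (weakGrad Ω (v n) x) (weakGrad Ω (v k) x) := by
            rw [integral_add (i4.const_mul _) (i3.const_mul _), integral_const_mul,
              integral_const_mul, integral_add i1 i2]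
        _ ≤ η / 2 / (2 * (p * B) + 1) * (2 * (p * B) + 1) + η / 2 :=
            add_le_add (mul_le_mul_of_nonneg_left (by linarith) (by positivity)) h3
        _ = η := by field_simp; ring)
  have e2 : ENNReal.ofReal 2 = 2 := by simp
  rw [e2] at hw2 hwt
  have hle : ENNReal.ofReal p ≤ 2 := by rw [← e2]; exact ENNReal.ofReal_le_ofReal hp2.le
  have hwp : MemLp w (ENNReal.ofReal p) (leb Ω) := hw2.mono_exponent hle
  have hwtp := tendsto_eLpNorm_of_le hle (by simpa using hp0)
    (fun n => ((hvX n).2.sub hw2).1) hwt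
  have hW0 : IsW0 p Ω w G := IsW0.of_tendsto hp (fun n => (hvX n).isW0 hΩ) hwp hGp hwtp hGt
  have hwX : MemX p Ω w := ⟨⟨G, hW0⟩, hw2⟩
  have hGae := hW0.1.weakGrad_ae_eq hΩ
  have hlimE : Tendsto (fun n => energy p lam Ω h (v n)) atTop (𝓝 (energy p lam Ω h w)) := by
    have t1 := tendsto_integral_norm_rpow hp (fun n => (hvX n).memLp_weakGrad hΩ) hGp hGt
    have t2 := tendsto_integral_norm_rpow hp (fun n => (hvX n).memLp) hwp hwtp
    have t3 := tendsto_integral_norm_rpow (μ := leb Ω) (p := 2) (F := v) (f := w) (by norm_num)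
      (fun n => by simpa using (hvX n).2) (by simpa using hw2) (by simpa using hwt)
    have t4 := tendsto_integral_mul_of_eLpNorm hh (fun n => (hvX n).2) hw2 hwt
    have e1 : ∫ x in Ω, ‖weakGrad Ω w x‖ ^ p = ∫ x in Ω, ‖G x‖ ^ p :=
      integral_congr_ae (by filter_upwards [hGae] with x hx; rw [hx])
    simp only [Real.norm_eq_abs, Real.rpow_ofNat] at t2 t3
    unfold energy
    rw [e1]
    exact (((t1.const_mul _).sub (t2.const_mul _)).add (t3.const_mul _)).sub t4
  have hEm : energy p lam Ω h w ≤ m := by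
    have t : Tendsto (fun n : ℕ => m + 1 / ((n : ℝ) + 1)) atTop (𝓝 (m + 0)) :=
      tendsto_one_div_add_atTop_nhds_zero_nat.const_add m
    rw [add_zero] at t
    exact le_of_tendsto_of_tendsto' hlimE t hve
  exact ⟨w, hwX, fun φ hφ => hEm.trans (hmle φ hφ)⟩

end Existence

/-! ### Classical solutions and the failure of local minimality -/

section SignedPower

lemma abs_rpow_mul_of_nonneg {p y : ℝ} (hp : 1 < p) (hy : 0 ≤ y) :
    |y| ^ (p - 2) * y = y ^ (p - 1) := by
  rcases hy.eq_or_lt with rfl | hy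
  · rw [mul_zero, Real.zero_rpow (by linarith)]
  · rw [abs_of_pos hy, ← Real.rpow_add_one hy.ne']; ring_nf

lemma abs_rpow_mul_neg (p y : ℝ) : |-y| ^ (p - 2) * -y = -(|y| ^ (p - 2) * y) := by
  rw [abs_neg, mul_neg]

lemma continuous_abs_rpow_mul {p : ℝ} (hp : 1 < p) :
    Continuous fun y : ℝ => |y| ^ (p - 2) * y := by
  have h : (fun y : ℝ => |y| ^ (p - 2) * y)
      = fun y => (max y 0) ^ (p - 1) - (max (-y) 0) ^ (p - 1) := by
    ext y
    have h0 : (0 : ℝ) ^ (p - 1) = 0 := Real.zero_rpow (by linarith)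
    rcases le_total 0 y with hy | hy
    · rw [max_eq_left hy, max_eq_right (by linarith), h0, sub_zero, abs_rpow_mul_of_nonneg hp hy]
    · rw [max_eq_right hy, max_eq_left (by linarith), h0, zero_sub,
        ← abs_rpow_mul_of_nonneg hp (by linarith : 0 ≤ -y), abs_rpow_mul_neg, neg_neg]
  rw [h]
  exact ((continuous_id.max continuous_const).rpow_const fun _ => Or.inr (by linarith)).sub
    ((continuous_neg.max continuous_const).rpow_const fun _ => Or.inr (by linarith))

end SignedPower

section Divergence

variable {N : ℕ} {Ω : Set (Eu N)} {p lam : ℝ}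

lemma pFlux_eq_zero {w : Eu N → ℝ} {x : Eu N} (hx : x ∉ tsupport w) : pFlux p w x = 0 := by
  simp [pFlux, gradient_eq_zero_of_notMem_tsupport hx]

lemma tsupport_pFlux_subset (p : ℝ) (w : Eu N → ℝ) : tsupport (pFlux p w) ⊆ tsupport w :=
  closure_minimal (fun _ hx => by
    by_contra h
    exact hx (pFlux_eq_zero h)) (isClosed_tsupport w)

lemma continuous_pLaplacian {w : Eu N → ℝ}
    (hF : ContDiff ℝ ((⊤ : ℕ∞) : WithTop ℕ∞) (pFlux p w)) : Continuous (pLaplacian p w) := by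
  refine continuous_finsetSum _ fun i _ => ?_
  exact (EuclideanSpace.proj i : Eu N →L[ℝ] ℝ).continuous.comp
    ((hF.continuous_fderiv (by simp)).clm_apply continuous_const)

/-- Divergence theorem for a smooth compactly supported flux tested with a Sobolev function: every
component of the flux is a test function in the definition of the weak gradient. -/
lemma integral_inner_pFlux {w : Eu N → ℝ} (hw : IsTestFn Ω w)
    (hF : ContDiff ℝ ((⊤ : ℕ∞) : WithTop ℕ∞) (pFlux p w)) {φ : Eu N → ℝ} {Φ : Eu N → Eu N}
    (hφ : HasWeakGrad Ω φ Φ) :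
    ∫ x in Ω, inner ℝ (pFlux p w x) (Φ x) = - ∫ x in Ω, pLaplacian p w x * φ x := by
  set P : Fin N → Eu N →L[ℝ] ℝ := fun i => EuclideanSpace.proj i with hP
  have ht : ∀ i, IsTestFn Ω fun x => pFlux p w x i := fun i => by
    have hs : tsupport (fun x => pFlux p w x i) ⊆ tsupport w := by
      refine Subset.trans ?_ (tsupport_pFlux_subset p w)
      exact closure_mono fun x hx => by
        intro h0
        exact hx (by simp only [h0]; rfl)
    exact ⟨(P i).contDiff.comp hF, hw.2.1.of_isClosed_subset (isClosed_tsupport _) hs,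
      hs.trans hw.2.2⟩
  have hg : ∀ i x, gradient (fun x => pFlux p w x i) x i
      = (fderiv ℝ (pFlux p w) x (EuclideanSpace.single i 1)) i := fun i x => by
    have h1 : gradient (fun x => pFlux p w x i) x i
        = inner ℝ (EuclideanSpace.single i (1 : ℝ)) (gradient (fun x => pFlux p w x i) x) := by
      rw [EuclideanSpace.inner_single_left, map_one, one_mul]
    rw [h1, inner_gradient_right, conj_trivial]
    have h2 : HasFDerivAt (fun x => pFlux p w x i) ((P i).comp (fderiv ℝ (pFlux p w) x)) x :=
      (P i).hasFDerivAt.comp x (hF.differentiable (by simp) x).hasFDerivAt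
    rw [h2.fderiv]; rfl
  have key : ∀ i, ∫ x in Ω, φ x * (fderiv ℝ (pFlux p w) x (EuclideanSpace.single i 1)) i
      = - ∫ x in Ω, pFlux p w x i * Φ x i := fun i => by
    have h1 := congrArg (P i) (hφ.2.2 _ (ht i))
    rw [map_neg, ← (P i).integral_comp_comm (integrable_smul_gradient hφ.1 (ht i)).integrableOn,
      ← (P i).integral_comp_comm (integrable_testFn_smul hφ.2.1 (ht i)).integrableOn] at h1
    simp only [map_smul, smul_eq_mul] at h1
    simp only [← hg]
    exact h1
  have i1 : ∀ i, Integrable (fun x => φ x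
      * (fderiv ℝ (pFlux p w) x (EuclideanSpace.single i 1)) i) (leb Ω) := fun i => by
    have := (P i).integrable_comp (integrable_smul_gradient hφ.1 (ht i)).integrableOn (μ := leb Ω)
    simp only [map_smul, smul_eq_mul] at this
    simp only [← hg]
    exact this
  have i2 : ∀ i, Integrable (fun x => pFlux p w x i * Φ x i) (leb Ω) := fun i =>
    (P i).integrable_comp (integrable_testFn_smul hφ.2.1 (ht i)).integrableOn (μ := leb Ω)
  have e1 : ∀ x, inner ℝ (pFlux p w x) (Φ x) = ∑ i, pFlux p w x i * Φ x i := fun x => by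
    simp [PiLp.inner_apply, mul_comm]
  have e2 : ∀ x, pLaplacian p w x * φ x
      = ∑ i, φ x * (fderiv ℝ (pFlux p w) x (EuclideanSpace.single i 1)) i := fun x => by
    rw [pLaplacian, Finset.sum_mul]
    exact Finset.sum_congr rfl fun i _ => mul_comm _ _
  simp only [e1, e2]
  rw [integral_finsetSum _ fun i _ => i2 i, integral_finsetSum _ fun i _ => i1 i,
    ← Finset.sum_neg_distrib]
  exact Finset.sum_congr rfl fun i _ => by rw [key i, neg_neg]

/-- The source for which `w` is a classical solution of the elliptic problem. -/
noncomputable def ellipticSource {N : ℕ} (p lam : ℝ) (w : Eu N → ℝ) (x : Eu N) : ℝ :=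
  - pLaplacian p w x - lam * (|w x| ^ (p - 2) * w x) + w x

lemma continuous_ellipticSource (hp : 1 < p) {w : Eu N → ℝ} (hw : IsTestFn Ω w)
    (hF : ContDiff ℝ ((⊤ : ℕ∞) : WithTop ℕ∞) (pFlux p w)) :
    Continuous (ellipticSource p lam w) :=
  ((continuous_pLaplacian hF).neg.sub
    (((continuous_abs_rpow_mul hp).comp hw.1.continuous).const_mul lam)).add hw.1.continuous

/-- A test function with smooth flux is a weak solution for the source that makes it a classical
one. -/
lemma isEllipticSol_ellipticSource [IsFiniteMeasure (leb Ω)] (hp : 1 < p) (hΩ : IsOpen Ω)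
    {w : Eu N → ℝ} (hw : IsTestFn Ω w)
    (hF : ContDiff ℝ ((⊤ : ℕ∞) : WithTop ℕ∞) (pFlux p w))
    (hh : MemLp (ellipticSource p lam w) 2 (leb Ω)) :
    IsEllipticSol p lam Ω (ellipticSource p lam w) w := by
  refine ⟨MemX.of_testFn hw, fun φ hφ => ?_⟩
  have e1 : ∫ x in Ω, ‖weakGrad Ω w x‖ ^ (p - 2) * inner ℝ (weakGrad Ω w x) (weakGrad Ω φ x)
      = ∫ x in Ω, inner ℝ (pFlux p w x) (weakGrad Ω φ x) := by
    refine integral_congr_ae ?_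
    filter_upwards [weakGrad_testFn hΩ hw] with x hx
    rw [hx, pFlux, real_inner_smul_left]
  rw [e1, integral_inner_pFlux hw hF (hφ.hasWeakGrad hΩ)]
  have i1 : Integrable (fun x => |w x| ^ (p - 2) * w x * φ x) (leb Ω) := by
    simp only [abs_rpow_mul_mul_eq]
    exact integrable_flux hp (hw.memLp _) hφ.memLp
  have i2 : Integrable (fun x => w x * φ x) (leb Ω) := (hw.memLp 2).integrable_mul hφ.2
  have i3 : Integrable (fun x => ellipticSource p lam w x * φ x) (leb Ω) := hh.integrable_mul hφ.2
  have i4 : Integrable (fun x => lam * (|w x| ^ (p - 2) * w x * φ x) - w x * φ x) (leb Ω) :=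
    (i1.const_mul lam).sub i2
  rw [← integral_const_mul, ← integral_sub (i1.const_mul lam) i2, ← integral_add i4 i3,
    ← integral_neg]
  refine integral_congr_ae (ae_of_all _ fun x => ?_)
  simp only [ellipticSource]; ring

/-- A weak solution which vanishes on a set `U` is not a local minimizer as soon as there is a
perturbation which equals `1` on `U` and varies only where the solution has gradient bounded away
from zero: the gain `-lam / p * t ^ p` from `U` dominates the cost of order `t ^ 2`. -/
lemma not_isLocalMinimizer [IsFiniteMeasure (leb Ω)] (hp : 1 < p) (hp2 : p < 2) (hlam : 0 < lam)
    (hΩ : IsOpen Ω) {h w φ : Eu N → ℝ} (hh : MemLp h 2 (leb Ω)) (hw : IsTestFn Ω w)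
    (hsol : IsEllipticSol p lam Ω h w) (hφ : IsTestFn Ω φ) {C : ℝ}
    (hC : ∀ x, gradient φ x ≠ 0 → gradient w x ≠ 0 ∧ ‖gradient w x‖ ^ (p - 2) ≤ C)
    {U : Set (Eu N)} (hUo : MeasurableSet U) (hUΩ : U ⊆ Ω) (hU : volume U ≠ 0)
    (hwU : ∀ x ∈ U, w x = 0) (hφU : ∀ x ∈ U, φ x = 1) :
    ¬ IsLocalMinimizer p lam Ω h w := by
  rintro ⟨hwX, δ, hδ, hmin⟩
  have hp0 : 0 < p := by linarith
  have hφX : MemX p Ω φ := MemX.of_testFn hφ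
  have hsol' := (isEllipticSol_iff.1 hsol).2
  set v := (leb Ω).real U with hv
  have hv0 : 0 < v := by
    refine ENNReal.toReal_pos ?_ (measure_ne_top _ _)
    rw [Measure.restrict_apply hUo, inter_eq_self_of_subset_left hUΩ]
    exact hU
  set D := 1 / 2 * (C * ∫ x in Ω, ‖gradient φ x‖ ^ 2) + 1 / 2 * ∫ x in Ω, |φ x| ^ 2 with hD
  have key : ∀ t > 0, energy p lam Ω h (fun x => w x + t * φ x)
      ≤ energy p lam Ω h w + t ^ 2 * D - lam * (v / p * t ^ p) := by
    intro t ht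
    have htX := hφX.const_mul t
    rw [energy_add hp hΩ hh hwX htX, hsol' _ htX, add_zero]
    have r1 : ∫ x in Ω, taylorRem p (weakGrad Ω w x) (weakGrad Ω (fun x => t * φ x) x)
        ≤ t ^ 2 * (1 / 2 * (C * ∫ x in Ω, ‖gradient φ x‖ ^ 2)) := by
      have e : t ^ 2 * (1 / 2 * (C * ∫ x in Ω, ‖gradient φ x‖ ^ 2))
          = ∫ x in Ω, t ^ 2 * (1 / 2 * (C * ‖gradient φ x‖ ^ 2)) := by
        rw [integral_const_mul, integral_const_mul, integral_const_mul]
      rw [e]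
      have i1 : Integrable (fun x => ‖gradient φ x‖ ^ 2) (leb Ω) := by
        simpa using (hφ.memLp_gradient 2).integrable_norm_pow (by norm_num)
      refine integral_mono_ae (integrable_taylorRem hp (hwX.memLp_weakGrad hΩ)
        (htX.memLp_weakGrad hΩ)) (((i1.const_mul _).const_mul _).const_mul _) ?_
      filter_upwards [weakGrad_testFn hΩ hw, weakGrad_const_mul hΩ hφX t, weakGrad_testFn hΩ hφ]
        with x h1 h2 h3
      rw [h1, h2, h3]
      rcases eq_or_ne (gradient φ x) 0 with h0 | h0
      · simp [h0, taylorRem]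
      · obtain ⟨h4, h5⟩ := hC x h0
        refine (taylorRem_le_sq hp hp2 h4 _).trans ?_
        rw [norm_smul, mul_pow, Real.norm_eq_abs, sq_abs]
        have := mul_le_mul_of_nonneg_right h5
          (by positivity : 0 ≤ t ^ 2 * ‖gradient φ x‖ ^ 2)
        linarith
    have r2 : v / p * t ^ p ≤ ∫ x in Ω, taylorRem p (w x) (t * φ x) := by
      have i1 := integrable_taylorRem hp hwX.memLp htX.memLp
      calc v / p * t ^ p = ∫ x in U, t ^ p / p ∂(leb Ω) := by
            rw [setIntegral_const, smul_eq_mul]; ring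
        _ = ∫ x in U, taylorRem p (w x) (t * φ x) ∂(leb Ω) := by
            refine setIntegral_congr_fun hUo fun x hx => ?_
            simp only [taylorRem, hwU x hx, hφU x hx, mul_one, zero_add, inner_zero_left,
              mul_zero, sub_zero, norm_zero, Real.zero_rpow hp0.ne', zero_div,
              Real.norm_of_nonneg ht.le]
        _ ≤ ∫ x in Ω, taylorRem p (w x) (t * φ x) :=
            setIntegral_le_integral i1 (ae_of_all _ fun x => taylorRem_nonneg hp _ _)
    have r3 : ∫ x in Ω, |t * φ x| ^ 2 = t ^ 2 * ∫ x in Ω, |φ x| ^ 2 := by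
      rw [← integral_const_mul]
      refine integral_congr_ae (ae_of_all _ fun x => ?_)
      simp only [sq_abs]; ring
    rw [r3, hD]
    have := mul_le_mul_of_nonneg_left r2 hlam.le
    linarith
  have hev : ∀ᶠ t in 𝓝[>] (0 : ℝ), t ^ (2 - p) * D < lam * (v / p) := by
    have hl : Tendsto (fun t : ℝ => t ^ (2 - p) * D) (𝓝[>] 0) (𝓝 (0 ^ (2 - p) * D)) :=
      ((Real.continuous_rpow_const (by linarith)).mul_const D).continuousAt.tendsto.mono_left
        nhdsWithin_le_nhds
    rw [Real.zero_rpow (by linarith), zero_mul] at hl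
    exact hl.eventually (gt_mem_nhds (by positivity))
  have hev2 : ∀ᶠ t in 𝓝[>] (0 : ℝ), t * xNorm p Ω φ < δ := by
    have hl : Tendsto (fun t : ℝ => t * xNorm p Ω φ) (𝓝[>] 0) (𝓝 (0 * xNorm p Ω φ)) :=
      (continuous_id.mul_const _).continuousAt.tendsto.mono_left nhdsWithin_le_nhds
    rw [zero_mul] at hl
    exact hl.eventually (gt_mem_nhds hδ)
  obtain ⟨t, ⟨h1, h2⟩, ht⟩ := ((hev.and hev2).and self_mem_nhdsWithin).exists
  have ht0 : 0 < t := ht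
  have h3 := hmin _ (hφX.const_mul t) (by
    rw [xNorm_const_mul hΩ hφX, abs_of_pos ht0]; exact h2)
  have h4 := key t ht0
  have h5 : t ^ 2 = t ^ p * t ^ (2 - p) := by
    rw [← Real.rpow_natCast, ← Real.rpow_add ht0]; norm_num
  have h6 : 0 < t ^ p := by positivity
  rw [h5] at h4
  nlinarith

end Divergence

/-! ### A radial function with smooth flux and two plateaus -/

section Profile

/-- For `q = 1` a smooth bump supported in `[-1, 1]`, and for `q > 0` its power with exponent `q`,
written so that smoothness is evident: `exp (-1 / s) ^ q = exp (-1 / (s / q))`. -/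
noncomputable def bumpPow (q s : ℝ) : ℝ :=
  expNegInvGlue ((1 + s) / q) * expNegInvGlue ((1 - s) / q)

lemma expNegInvGlue_rpow {q : ℝ} (hq : 0 < q) (x : ℝ) :
    expNegInvGlue x ^ q = expNegInvGlue (x / q) := by
  rcases le_or_gt x 0 with hx | hx
  · rw [expNegInvGlue.zero_of_nonpos hx, Real.zero_rpow hq.ne',
      expNegInvGlue.zero_of_nonpos (div_nonpos_of_nonpos_of_nonneg hx hq.le)]
  · have hx' : 0 < x / q := by positivity
    simp only [expNegInvGlue, not_le.2 hx, not_le.2 hx', if_false]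
    rw [← Real.exp_mul]
    congr 1
    field_simp

lemma bumpPow_nonneg (q s : ℝ) : 0 ≤ bumpPow q s :=
  mul_nonneg (expNegInvGlue.nonneg _) (expNegInvGlue.nonneg _)

lemma bumpPow_rpow {q : ℝ} (hq : 0 < q) (s : ℝ) : bumpPow 1 s ^ q = bumpPow q s := by
  unfold bumpPow
  rw [Real.mul_rpow (expNegInvGlue.nonneg _) (expNegInvGlue.nonneg _), expNegInvGlue_rpow hq,
    expNegInvGlue_rpow hq, div_one, div_one]

lemma contDiff_bumpPow (q : ℝ) : ContDiff ℝ ((⊤ : ℕ∞) : WithTop ℕ∞) (bumpPow q) :=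
  (expNegInvGlue.contDiff.comp ((contDiff_const.add contDiff_id).div_const q)).mul
    (expNegInvGlue.contDiff.comp ((contDiff_const.sub contDiff_id).div_const q))

lemma bumpPow_pos {s : ℝ} (h1 : -1 < s) (h2 : s < 1) : 0 < bumpPow 1 s :=
  mul_pos (expNegInvGlue.pos_of_pos (by linarith)) (expNegInvGlue.pos_of_pos (by linarith))

lemma bumpPow_of_le {q s : ℝ} (hq : 0 < q) (h : s ≤ -1) : bumpPow q s = 0 := by
  rw [bumpPow, expNegInvGlue.zero_of_nonpos
    (div_nonpos_of_nonpos_of_nonneg (by linarith) hq.le), zero_mul]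

lemma bumpPow_of_ge {q s : ℝ} (hq : 0 < q) (h : 1 ≤ s) : bumpPow q s = 0 := by
  rw [bumpPow, expNegInvGlue.zero_of_nonpos
    (div_nonpos_of_nonpos_of_nonneg (by linarith : 1 - s ≤ 0) hq.le), mul_zero]

/-- The smooth step: the primitive of the bump. -/
noncomputable def smoothStep (s : ℝ) : ℝ := ∫ r in (-1 : ℝ)..s, bumpPow 1 r

lemma hasDerivAt_smoothStep (s : ℝ) : HasDerivAt smoothStep (bumpPow 1 s) s :=
  intervalIntegral.integral_hasDerivAt_right
    ((contDiff_bumpPow 1).continuous.intervalIntegrable _ _)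
    ((contDiff_bumpPow 1).continuous.stronglyMeasurableAtFilter _ _)
    (contDiff_bumpPow 1).continuous.continuousAt

lemma contDiff_smoothStep : ContDiff ℝ ((⊤ : ℕ∞) : WithTop ℕ∞) smoothStep := by
  rw [contDiff_infty_iff_deriv]
  refine ⟨fun s => (hasDerivAt_smoothStep s).differentiableAt, ?_⟩
  rw [show deriv smoothStep = bumpPow 1 from funext fun s => (hasDerivAt_smoothStep s).deriv]
  exact contDiff_bumpPow 1

lemma smoothStep_of_le {s : ℝ} (h : s ≤ -1) : smoothStep s = 0 := by
  unfold smoothStep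
  rw [intervalIntegral.integral_congr (g := fun _ => 0), intervalIntegral.integral_zero]
  intro r hr
  rw [uIcc_of_ge h] at hr
  exact bumpPow_of_le one_pos hr.2

lemma smoothStep_of_ge {s : ℝ} (h : 1 ≤ s) : smoothStep s = smoothStep 1 := by
  have hi : ∀ a b, IntervalIntegrable (bumpPow 1) volume a b := fun a b =>
    (contDiff_bumpPow 1).continuous.intervalIntegrable _ _
  unfold smoothStep
  rw [← intervalIntegral.integral_add_adjacent_intervals (hi (-1) 1) (hi 1 s)]
  rw [intervalIntegral.integral_congr (a := 1) (g := fun _ => 0), intervalIntegral.integral_zero,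
    add_zero]
  intro r hr
  rw [uIcc_of_le h] at hr
  exact bumpPow_of_ge one_pos hr.1

lemma smoothStep_one_pos : 0 < smoothStep 1 :=
  intervalIntegral.intervalIntegral_pos_of_pos_on
    ((contDiff_bumpPow 1).continuous.intervalIntegrable _ _)
    (fun _ hx => bumpPow_pos hx.1 hx.2) (by norm_num)

/-- A smooth radial profile, supported in `[1, 9]`, with plateaus at heights `c` and `-c`, and such
that the signed power `|G'| ^ (p - 2) * G'` of its derivative is smooth as well. -/
lemma exists_radialProfile {p c : ℝ} (hp : 1 < p) (hc : 0 < c) :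
    ∃ G Γ : ℝ → ℝ, ContDiff ℝ ((⊤ : ℕ∞) : WithTop ℕ∞) G ∧
      ContDiff ℝ ((⊤ : ℕ∞) : WithTop ℕ∞) Γ ∧
      (∀ s, |deriv G s| ^ (p - 2) * deriv G s = Γ s) ∧
      (∀ s ≤ 1, G s = 0) ∧ (∀ s, 9 ≤ s → G s = 0) ∧
      (∀ s ∈ Icc (3 : ℝ) 4, G s = c) ∧ (∀ s ∈ Icc (6 : ℝ) 7, G s = -c) ∧
      ∀ s ∈ Ioo (1 : ℝ) 3, deriv G s ≠ 0 := by
  have hI := smoothStep_one_pos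
  set A := c / smoothStep 1 with hA
  have hA0 : 0 < A := by positivity
  have hAI : A * smoothStep 1 = c := by rw [hA]; field_simp
  have hp1 : 0 < p - 1 := by linarith
  set G : ℝ → ℝ := fun s => A * (smoothStep (s - 2) - 2 * smoothStep (s - 5) + smoothStep (s - 8))
    with hG
  set Γ : ℝ → ℝ := fun s => A ^ (p - 1) * bumpPow (p - 1) (s - 2)
    - (2 * A) ^ (p - 1) * bumpPow (p - 1) (s - 5) + A ^ (p - 1) * bumpPow (p - 1) (s - 8) with hΓ
  have sh : ∀ a : ℝ, ContDiff ℝ ((⊤ : ℕ∞) : WithTop ℕ∞) fun s : ℝ => s - a := fun a =>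
    contDiff_id.sub contDiff_const
  have hd : ∀ s, deriv G s
      = A * (bumpPow 1 (s - 2) - 2 * bumpPow 1 (s - 5) + bumpPow 1 (s - 8)) := fun s => by
    have h : ∀ a, HasDerivAt (fun s => smoothStep (s - a)) (bumpPow 1 (s - a)) s := fun a =>
      (hasDerivAt_smoothStep (s - a)).comp_sub_const s a
    exact ((((h 2).sub ((h 5).const_mul 2)).add (h 8)).const_mul A).deriv
  have hpow : ∀ B s : ℝ, 0 < B → |B * bumpPow 1 s| ^ (p - 2) * (B * bumpPow 1 s)
      = B ^ (p - 1) * bumpPow (p - 1) s := fun B s hB => by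
    rw [abs_rpow_mul_of_nonneg hp (mul_nonneg hB.le (bumpPow_nonneg _ _)),
      Real.mul_rpow hB.le (bumpPow_nonneg _ _), bumpPow_rpow hp1]
  refine ⟨G, Γ, ?_, ?_, fun s => ?_, fun s hs => ?_, fun s hs => ?_, fun s hs => ?_,
    fun s hs => ?_, fun s hs => ?_⟩
  · exact contDiff_const.mul (((contDiff_smoothStep.comp (sh 2)).sub
      (contDiff_const.mul (contDiff_smoothStep.comp (sh 5)))).add (contDiff_smoothStep.comp (sh 8)))
  · exact ((contDiff_const.mul ((contDiff_bumpPow _).comp (sh 2))).sub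
      (contDiff_const.mul ((contDiff_bumpPow _).comp (sh 5)))).add
      (contDiff_const.mul ((contDiff_bumpPow _).comp (sh 8)))
  · rw [hd]
    simp only [hΓ]
    -- the three bumps have disjoint supports
    rcases le_or_gt s (7 / 2) with h | h
    · rw [bumpPow_of_le one_pos (by linarith : s - 5 ≤ -1),
        bumpPow_of_le one_pos (by linarith : s - 8 ≤ -1),
        bumpPow_of_le hp1 (by linarith : s - 5 ≤ -1), bumpPow_of_le hp1 (by linarith : s - 8 ≤ -1),
        mul_zero, mul_zero, mul_zero, sub_zero, add_zero, sub_zero, add_zero, hpow A _ hA0]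
    · rcases le_or_gt s (13 / 2) with h' | h'
      · rw [bumpPow_of_ge one_pos (by linarith : 1 ≤ s - 2),
          bumpPow_of_le one_pos (by linarith : s - 8 ≤ -1),
          bumpPow_of_ge hp1 (by linarith : 1 ≤ s - 2), bumpPow_of_le hp1 (by linarith : s - 8 ≤ -1),
          mul_zero, zero_sub, add_zero, zero_sub, add_zero, ← hpow (2 * A) _ (by positivity),
          ← abs_rpow_mul_neg]
        congr 2 <;> ring_nf
      · rw [bumpPow_of_ge one_pos (by linarith : 1 ≤ s - 2),
          bumpPow_of_ge one_pos (by linarith : 1 ≤ s - 5),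
          bumpPow_of_ge hp1 (by linarith : 1 ≤ s - 2), bumpPow_of_ge hp1 (by linarith : 1 ≤ s - 5)]
        simp only [mul_zero, sub_zero, zero_add, hpow A _ hA0]
  · simp only [hG]
    rw [smoothStep_of_le (by linarith), smoothStep_of_le (by linarith),
      smoothStep_of_le (by linarith)]
    ring
  · simp only [hG]
    rw [smoothStep_of_ge (by linarith), smoothStep_of_ge (by linarith : 1 ≤ s - 5),
      smoothStep_of_ge (by linarith : 1 ≤ s - 8)]
    ring
  · simp only [hG]
    rw [smoothStep_of_ge (by linarith [hs.1] : 1 ≤ s - 2),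
      smoothStep_of_le (by linarith [hs.2] : s - 5 ≤ -1),
      smoothStep_of_le (by linarith [hs.2] : s - 8 ≤ -1), ← hAI]
    ring
  · simp only [hG]
    rw [smoothStep_of_ge (by linarith [hs.1] : 1 ≤ s - 2),
      smoothStep_of_ge (by linarith [hs.1] : 1 ≤ s - 5),
      smoothStep_of_le (by linarith [hs.2] : s - 8 ≤ -1), ← hAI]
    ring
  · rw [hd, bumpPow_of_le one_pos (by linarith [hs.2] : s - 5 ≤ -1),
      bumpPow_of_le one_pos (by linarith [hs.2] : s - 8 ≤ -1), mul_zero, sub_zero, add_zero]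
    exact (mul_pos hA0 (bumpPow_pos (by linarith [hs.1]) (by linarith [hs.2]))).ne'

end Profile

section Radial

variable {N : ℕ} {Ω : Set (Eu N)} {p : ℝ}

lemma hasGradientAt_radial {G : ℝ → ℝ} (hG : Differentiable ℝ G) (κ : ℝ) (a x : Eu N) :
    HasGradientAt (fun y => G (κ * ‖y - a‖ ^ 2))
      ((deriv G (κ * ‖x - a‖ ^ 2) * (2 * κ)) • (x - a)) x := by
  rw [hasGradientAt_iff_hasFDerivAt]
  have h1 : HasFDerivAt (fun y : Eu N => κ * ‖y - a‖ ^ 2)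
      (κ • (2 • (innerSL ℝ (x - a)).comp (ContinuousLinearMap.id ℝ (Eu N)))) x :=
    (((hasFDerivAt_id x).sub_const a).norm_sq).const_mul κ
  have h2 := (hG (κ * ‖x - a‖ ^ 2)).hasDerivAt.comp_hasFDerivAt x h1
  refine h2.congr_fderiv ?_
  ext v
  simp
  ring

lemma gradient_radial {G : ℝ → ℝ} (hG : Differentiable ℝ G) (κ : ℝ) (a x : Eu N) :
    gradient (fun y => G (κ * ‖y - a‖ ^ 2)) x
      = (deriv G (κ * ‖x - a‖ ^ 2) * (2 * κ)) • (x - a) :=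
  (hasGradientAt_radial hG κ a x).gradient

lemma contDiff_radial {G : ℝ → ℝ} (hG : ContDiff ℝ ((⊤ : ℕ∞) : WithTop ℕ∞) G) (κ : ℝ)
    (a : Eu N) : ContDiff ℝ ((⊤ : ℕ∞) : WithTop ℕ∞) fun y : Eu N => G (κ * ‖y - a‖ ^ 2) :=
  hG.comp (contDiff_const.mul ((contDiff_id.sub contDiff_const).norm_sq ℝ))

lemma isTestFn_radial {G : ℝ → ℝ} (hG : ContDiff ℝ ((⊤ : ℕ∞) : WithTop ℕ∞) G) {κ b : ℝ}
    (hκ : 0 < κ) (a : Eu N) (hb : ∀ s, b ≤ s → G s = 0)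
    (hΩ : ∀ x, κ * ‖x - a‖ ^ 2 ≤ b → x ∈ Ω) :
    IsTestFn Ω fun y : Eu N => G (κ * ‖y - a‖ ^ 2) := by
  set K : Set (Eu N) := {x | κ * ‖x - a‖ ^ 2 ≤ b} with hK
  have hKcl : IsClosed K := isClosed_le (by fun_prop) continuous_const
  have hKc : IsCompact K := by
    refine (isCompact_closedBall a (√(b / κ))).of_isClosed_subset hKcl fun x hx => ?_
    rw [mem_closedBall_iff_norm]
    apply Real.le_sqrt_of_sq_le
    rw [le_div_iff₀ hκ, mul_comm]
    exact hx
  have hs : Function.support (fun y : Eu N => G (κ * ‖y - a‖ ^ 2)) ⊆ K := fun x hx => by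
    by_contra h
    exact hx (hb _ (not_le.1 h).le)
  exact ⟨contDiff_radial hG κ a, HasCompactSupport.of_support_subset_isCompact hKc hs,
    (closure_minimal hs hKcl).trans hΩ⟩

/-- The flux of a radial function whose profile is constant near the center, and for which the
signed power of the derivative of the profile is smooth, is smooth. -/
lemma contDiff_pFlux_radial {G Γ : ℝ → ℝ} (hG : Differentiable ℝ G)
    (hΓ : ContDiff ℝ ((⊤ : ℕ∞) : WithTop ℕ∞) Γ)
    (hGΓ : ∀ s, |deriv G s| ^ (p - 2) * deriv G s = Γ s) (h1 : ∀ s ≤ 1, G s = 0) {κ : ℝ}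
    (hκ : 0 < κ) (a : Eu N) :
    ContDiff ℝ ((⊤ : ℕ∞) : WithTop ℕ∞) (pFlux p fun y : Eu N => G (κ * ‖y - a‖ ^ 2)) := by
  have hΓ0 : ∀ s < 1, Γ s = 0 := fun s hs => by
    have : G =ᶠ[𝓝 s] fun _ => 0 := by
      filter_upwards [Iio_mem_nhds hs] with r hr using h1 r (le_of_lt hr)
    rw [← hGΓ, this.deriv_eq]; simp
  have hform : (pFlux p fun y : Eu N => G (κ * ‖y - a‖ ^ 2)) = fun x =>
      ((2 * κ) ^ (p - 2) * (2 * κ) * (‖x - a‖ ^ (p - 2) * Γ (κ * ‖x - a‖ ^ 2))) • (x - a) := by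
    ext1 x
    unfold pFlux
    rw [gradient_radial hG, norm_smul, smul_smul, ← hGΓ, Real.norm_eq_abs, abs_mul,
      abs_of_pos (by positivity : 0 < 2 * κ), Real.mul_rpow (by positivity) (norm_nonneg _),
      Real.mul_rpow (abs_nonneg _) (by positivity)]
    congr 1
    ring
  rw [hform, contDiff_iff_contDiffAt]
  intro x
  rcases lt_or_ge (κ * ‖x - a‖ ^ 2) 1 with hx | hx
  · have : (fun x => ((2 * κ) ^ (p - 2) * (2 * κ)
        * (‖x - a‖ ^ (p - 2) * Γ (κ * ‖x - a‖ ^ 2))) • (x - a)) =ᶠ[𝓝 x] fun _ => (0 : Eu N) := by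
      have ho : IsOpen {y : Eu N | κ * ‖y - a‖ ^ 2 < 1} :=
        isOpen_lt (by fun_prop) continuous_const
      filter_upwards [ho.mem_nhds hx] with y hy
      rw [hΓ0 _ hy]; simp
    exact contDiffAt_const.congr_of_eventuallyEq this
  · have hne : x - a ≠ 0 := by
      intro h
      rw [h] at hx
      norm_num at hx
    have hn : ContDiffAt ℝ ((⊤ : ℕ∞) : WithTop ℕ∞) (fun y : Eu N => ‖y - a‖) x :=
      (contDiffAt_id.sub contDiffAt_const).norm ℝ hne
    exact (contDiffAt_const.mul ((hn.rpow_const_of_ne (norm_ne_zero_iff.2 hne)).mul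
      (contDiff_radial hΓ κ a).contDiffAt)).smul (contDiffAt_id.sub contDiffAt_const)

/-- The classical solution `w`: a smooth radial function supported in an annulus, with smooth flux,
equal to `c` and to `-c` near two points of `Ω`, and zero on an open set `U` on which some test
function `φ`, varying only where `∇w ≠ 0`, equals `1`. -/
lemma exists_classical_candidate (hN : 1 ≤ N) (hΩo : IsOpen Ω) (hΩn : Ω.Nonempty) (hp : 1 < p)
    {c : ℝ} (hc : 0 < c) :
    ∃ (w φ : Eu N → ℝ) (U : Set (Eu N)) (C : ℝ), IsTestFn Ω w ∧ IsTestFn Ω φ ∧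
      ContDiff ℝ ((⊤ : ℕ∞) : WithTop ℕ∞) (pFlux p w) ∧
      (∃ y ∈ Ω, w =ᶠ[𝓝 y] fun _ => c) ∧ (∃ y ∈ Ω, w =ᶠ[𝓝 y] fun _ => -c) ∧
      (∀ x, gradient φ x ≠ 0 → gradient w x ≠ 0 ∧ ‖gradient w x‖ ^ (p - 2) ≤ C) ∧
      MeasurableSet U ∧ U ⊆ Ω ∧ volume U ≠ 0 ∧ (∀ x ∈ U, w x = 0) ∧ ∀ x ∈ U, φ x = 1 := by
  obtain ⟨G, Γ, hG, hΓ, hGΓ, g1, g9, gc, gc', gne⟩ := exists_radialProfile hp hc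
  obtain ⟨a, ha⟩ := hΩn
  obtain ⟨R, hR, hRΩ⟩ := Metric.nhds_basis_closedBall.mem_iff.1 (hΩo.mem_nhds ha)
  set κ := 9 / R ^ 2 with hκ
  have hκ0 : 0 < κ := by positivity
  have hin : ∀ x, κ * ‖x - a‖ ^ 2 ≤ 9 → x ∈ Ω := fun x hx => by
    apply hRΩ
    rw [mem_closedBall_iff_norm]
    rw [hκ, div_mul_eq_mul_div, div_le_iff₀ (by positivity)] at hx
    exact le_of_sq_le_sq (by linarith) hR.le
  have hGd : Differentiable ℝ G := hG.differentiable (by simp)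
  set w : Eu N → ℝ := fun y => G (κ * ‖y - a‖ ^ 2) with hw
  set η : ℝ → ℝ := fun s => 1 - Real.smoothTransition (s - 3 / 2) with hη
  have hηs : ContDiff ℝ ((⊤ : ℕ∞) : WithTop ℕ∞) η :=
    contDiff_const.sub (Real.smoothTransition.contDiff.comp (contDiff_id.sub contDiff_const))
  have hη1 : ∀ s ≤ 3 / 2, η s = 1 := fun s hs => by
    simp [hη, Real.smoothTransition.zero_of_nonpos (by linarith : s - 3 / 2 ≤ 0)]
  have hη0 : ∀ s, 5 / 2 ≤ s → η s = 0 := fun s hs => by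
    simp [hη, Real.smoothTransition.one_of_one_le (by linarith : 1 ≤ s - 3 / 2)]
  set φ : Eu N → ℝ := fun y => η (κ * ‖y - a‖ ^ 2) with hφ
  -- a point at prescribed radius
  have hpt : ∀ s : ℝ, 0 ≤ s → ∃ x : Eu N, κ * ‖x - a‖ ^ 2 = s := fun s hs => by
    refine ⟨a + EuclideanSpace.single ⟨0, hN⟩ (√(s / κ)), ?_⟩
    rw [add_sub_cancel_left, PiLp.norm_single, Real.norm_eq_abs, sq_abs,
      Real.sq_sqrt (by positivity)]
    field_simp
  have hplateau : ∀ s : ℝ, 0 ≤ s → s ≤ 9 → ∀ d : ℝ, G =ᶠ[𝓝 s] (fun _ => d) →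
      ∃ y ∈ Ω, w =ᶠ[𝓝 y] fun _ => d := fun s hs hs9 d hd => by
    obtain ⟨x, hx⟩ := hpt s hs
    refine ⟨x, hin x (by rw [hx]; exact hs9), ?_⟩
    have hcont : Tendsto (fun y : Eu N => κ * ‖y - a‖ ^ 2) (𝓝 x) (𝓝 s) := by
      rw [← hx]
      exact Continuous.tendsto (by fun_prop) x
    exact hcont.eventually hd
  -- the closed annulus in which the cutoff varies
  set K : Set (Eu N) := {x | 3 / 2 ≤ κ * ‖x - a‖ ^ 2 ∧ κ * ‖x - a‖ ^ 2 ≤ 5 / 2} with hK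
  have hKc : IsCompact K := by
    have hcont : Continuous fun x : Eu N => κ * ‖x - a‖ ^ 2 := by fun_prop
    refine (isCompact_closedBall a R).of_isClosed_subset
      ((isClosed_le continuous_const hcont).inter
        (isClosed_le hcont continuous_const)) fun x hx => ?_
    rw [mem_closedBall_iff_norm]
    have := hx.2
    rw [hκ, div_mul_eq_mul_div, div_le_iff₀ (by positivity)] at this
    exact le_of_sq_le_sq (by nlinarith) hR.le
  have hgne : ∀ x ∈ K, gradient w x ≠ 0 := fun x hx => by
    rw [hw, gradient_radial hGd]
    refine smul_ne_zero (mul_ne_zero (gne _ ⟨by linarith [hx.1], by linarith [hx.2]⟩)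
      (by positivity)) fun h => ?_
    have := hx.1
    rw [h] at this
    norm_num at this
  have hwt : IsTestFn Ω w := isTestFn_radial hG hκ0 a g9 hin
  have hφt : IsTestFn Ω φ := isTestFn_radial hηs hκ0 a hη0 fun x hx => hin x (by linarith)
  obtain ⟨C, hC⟩ := hKc.exists_bound_of_continuousOn
    (f := fun x => ‖gradient w x‖ ^ (p - 2)) (ContinuousOn.rpow_const
      hwt.continuous_gradient.norm.continuousOn fun x hx => Or.inl (norm_ne_zero_iff.2 (hgne x hx)))
  have hgφ : ∀ x, gradient φ x ≠ 0 → x ∈ K := fun x hx => by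
    rw [hφ, gradient_radial (hηs.differentiable (by simp))] at hx
    constructor
    · by_contra! h
      have : η =ᶠ[𝓝 (κ * ‖x - a‖ ^ 2)] fun _ => 1 := by
        filter_upwards [Iio_mem_nhds h] with r hr using hη1 r (le_of_lt hr)
      rw [this.deriv_eq] at hx
      simp at hx
    · by_contra! h
      have : η =ᶠ[𝓝 (κ * ‖x - a‖ ^ 2)] fun _ => 0 := by
        filter_upwards [Ioi_mem_nhds h] with r hr using hη0 r (le_of_lt hr)
      rw [this.deriv_eq] at hx
      simp at hx
  have hUo : IsOpen {x : Eu N | κ * ‖x - a‖ ^ 2 < 1} := isOpen_lt (by fun_prop) continuous_const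
  -- the variable is `s = κ ‖x - a‖ ^ 2`: `w` and `φ` are constant for `s < 1`, the cutoff acts on
  -- the first slope of the profile, and the plateaus are at `3 ≤ s ≤ 4` and `6 ≤ s ≤ 7`
  refine ⟨w, φ, {x | κ * ‖x - a‖ ^ 2 < 1}, C, hwt, hφt,
    contDiff_pFlux_radial hGd hΓ hGΓ g1 hκ0 a, hplateau (7 / 2) (by norm_num) (by norm_num) c ?_,
    hplateau (13 / 2) (by norm_num) (by norm_num) (-c) ?_, fun x hx => ⟨hgne x (hgφ x hx), ?_⟩,
    hUo.measurableSet, fun x hx => hin x ?_, (hUo.measure_pos volume ⟨a, by simp⟩).ne',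
    fun x hx => g1 _ (le_of_lt hx), fun x hx => hη1 _ ?_⟩
  · filter_upwards [Icc_mem_nhds (by norm_num : (3 : ℝ) < 7 / 2) (by norm_num : (7 / 2 : ℝ) < 4)]
      with s hs using gc s hs
  · filter_upwards [Icc_mem_nhds (by norm_num : (6 : ℝ) < 13 / 2) (by norm_num : (13 / 2 : ℝ) < 7)]
      with s hs using gc' s hs
  · have := hC x (hgφ x hx)
    exact (le_abs_self _).trans this
  · have : κ * ‖x - a‖ ^ 2 < 1 := hx
    linarith
  · have : κ * ‖x - a‖ ^ 2 < 1 := hx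
    linarith

end Radial

/-! ### Separation of variables in the parabolic problem -/

section ProfileFn

variable {p : ℝ}

lemma continuous_profile (hp2 : p < 2) : Continuous (profile p) :=
  (Real.continuous_rpow_const (div_nonneg zero_le_one (by linarith))).comp
    (continuous_const.mul continuous_id)

lemma profile_zero (hp2 : p < 2) : profile p 0 = 0 := by
  unfold profile
  rw [mul_zero, Real.zero_rpow]
  exact (one_div_pos.2 (by linarith)).ne'

lemma profile_pos (hp2 : p < 2) {t : ℝ} (ht : 0 < t) : 0 < profile p t :=
  Real.rpow_pos_of_pos (mul_pos (by linarith) ht) _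

lemma hasDerivAt_profile (hp1 : 1 < p) (hp2 : p < 2) {t : ℝ} (ht : 0 < t) :
    HasDerivAt (profile p) (|profile p t| ^ (p - 2) * profile p t) t := by
  have h2p : 0 < 2 - p := by linarith
  have hx : 0 < (2 - p) * t := mul_pos h2p ht
  have h1 : HasDerivAt (fun t : ℝ => (2 - p) * t) (2 - p) t := by
    simpa using (hasDerivAt_id t).const_mul (2 - p)
  have h2 := h1.rpow_const (p := 1 / (2 - p)) (Or.inl hx.ne')
  refine h2.congr_deriv ?_
  rw [abs_rpow_mul_of_nonneg hp1 (profile_pos hp2 ht).le]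
  unfold profile
  rw [← Real.rpow_mul hx.le]
  have e : 1 / (2 - p) * (p - 1) = 1 / (2 - p) - 1 := by field_simp; ring
  rw [e]
  field_simp

lemma integral_profile_deriv (hp1 : 1 < p) (hp2 : p < 2) {t : ℝ} (ht : 0 ≤ t) :
    ∫ s in (0 : ℝ)..t, |profile p s| ^ (p - 2) * profile p s = profile p t := by
  rw [intervalIntegral.integral_eq_sub_of_hasDerivAt_of_le ht
    (continuous_profile hp2).continuousOn (fun s hs => hasDerivAt_profile hp1 hp2 hs.1)
    (((continuous_abs_rpow_mul hp1).comp (continuous_profile hp2)).intervalIntegrable _ _),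
    profile_zero hp2, sub_zero]

end ProfileFn

section Time

/-- Integration by parts for the primitives of a continuous and of an integrable function. -/
lemma integral_mul_primitive_add {g b : ℝ → ℝ} (hg : Continuous g) {τ : ℝ}
    (hb : IntervalIntegrable b volume 0 τ) :
    ∫ t in (0 : ℝ)..τ, (g t * (∫ s in (0 : ℝ)..t, b s) + (∫ s in (0 : ℝ)..t, g s) * b t)
      = (∫ s in (0 : ℝ)..τ, g s) * ∫ s in (0 : ℝ)..τ, b s := by
  have h := AbsolutelyContinuousOnInterval.integral_deriv_mul_eq_sub
    ((hg.intervalIntegrable 0 τ).absolutelyContinuousOnInterval_intervalIntegral (c := 0) (by simp))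
    (hb.absolutelyContinuousOnInterval_intervalIntegral (c := 0) (by simp))
  simp only [intervalIntegral.integral_same, mul_zero, sub_zero] at h
  rw [← h]
  refine intervalIntegral.integral_congr_ae ?_
  filter_upwards [hb.ae_hasDerivAt_integral] with t ht hts
  rw [(ht (uIoc_subset_uIcc hts) 0 (by simp)).deriv,
    (hg.integral_hasStrictDerivAt 0 t).hasDerivAt.deriv]

end Time

section Parabolic

variable {N : ℕ} {Ω : Set (Eu N)} {p lam : ℝ}

lemma ae_mem_cyl (hΩ : IsOpen Ω) (T : ℝ) : ∀ᵐ z ∂(cyl T Ω), z.1 ∈ Ioo 0 T ∧ z.2 ∈ Ω := by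
  rw [cyl, Measure.prod_restrict]
  exact ae_restrict_mem (measurableSet_Ioo.prod hΩ.measurableSet)

/-- A function of space times a continuous function of time, on the cylinder. -/
lemma memLp_cyl_smul [IsFiniteMeasure (leb Ω)] (hΩ : IsOpen Ω) {E : Type*} [NormedAddCommGroup E]
    [NormedSpace ℝ E] {q : ENNReal} {F : Eu N → E} (hF : MemLp F q (leb Ω)) {v : ℝ → ℝ}
    (hv : Continuous v) (T : ℝ) :
    MemLp (fun z : ℝ × Eu N => v z.1 • F z.2) q (cyl T Ω) := by
  have h1 : MemLp (fun z : ℝ × Eu N => F z.2) q (cyl T Ω) := hF.comp_snd _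
  obtain ⟨C, hC⟩ := (isCompact_Icc (a := (0 : ℝ)) (b := T)).exists_bound_of_continuousOn
    hv.continuousOn
  refine h1.of_le_mul (c := C)
    ((hv.comp continuous_fst).aestronglyMeasurable.smul h1.1) ?_
  filter_upwards [ae_mem_cyl hΩ T] with z hz
  rw [norm_smul]
  exact mul_le_mul_of_nonneg_right (hC _ (Ioo_subset_Icc_self hz.1)) (norm_nonneg _)

lemma flux_smul {E : Type*} [NormedAddCommGroup E] [InnerProductSpace ℝ E] (p c : ℝ) (a b : E) :
    ‖c • a‖ ^ (p - 2) * inner ℝ (c • a) b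
      = (|c| ^ (p - 2) * c) * (‖a‖ ^ (p - 2) * inner ℝ a b) := by
  rw [norm_smul, Real.mul_rpow (norm_nonneg _) (norm_nonneg _), real_inner_smul_left,
    Real.norm_eq_abs]
  ring

lemma integral_Ioo_eq_interval {τ : ℝ} (hτ : 0 ≤ τ) (f : ℝ → ℝ) :
    ∫ t in Ioo 0 τ, f t = ∫ t in (0 : ℝ)..τ, f t := by
  rw [intervalIntegral.integral_of_le hτ, integral_Ioc_eq_integral_Ioo]

/-- The pairing of a fixed function with an element of `W^{1,2}((0, τ) → L²(Ω))` is absolutely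
continuous in time. -/
lemma IsW12L2.integral_mul_eq [IsFiniteMeasure (leb Ω)] {τ : ℝ} {φ ψ : ℝ → Eu N → ℝ}
    (h : IsW12L2 τ Ω φ ψ) (hτ : 0 < τ) {w : Eu N → ℝ} (hw : MemLp w 2 (leb Ω))
    (hK : Integrable (fun z : ℝ × Eu N => w z.2 * ψ z.1 z.2) (cyl τ Ω))
    {t : ℝ} (ht : t ∈ Icc 0 τ) :
    ∫ x in Ω, w x * φ t x
      = (∫ x in Ω, w x * φ 0 x) + ∫ s in (0 : ℝ)..t, ∫ x in Ω, w x * ψ s x := by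
  obtain ⟨hφt, hae⟩ := h.2.2 t ht
  have hφ0 := (h.2.2 0 ⟨le_rfl, hτ.le⟩).1
  have i0 : Integrable (fun x => w x * φ 0 x) (leb Ω) := hw.integrable_mul hφ0
  have it : Integrable (fun x => w x * φ t x) (leb Ω) := hw.integrable_mul hφt
  have e1 : ∀ᵐ x ∂(leb Ω), w x * φ t x - w x * φ 0 x = ∫ s in Ioo 0 t, w x * ψ s x := by
    filter_upwards [hae] with x hx
    rw [integral_const_mul, hx, integral_Ioo_eq_interval ht.1]
    ring
  have hK' : Integrable (fun z : ℝ × Eu N => w z.2 * ψ z.1 z.2) (cyl t Ω) := by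
    have : cyl t Ω = (cyl τ Ω).restrict (Ioo 0 t ×ˢ univ) := by
      rw [cyl, cyl, ← Measure.prod_restrict, Measure.restrict_univ,
        Measure.restrict_restrict measurableSet_Ioo,
        inter_eq_self_of_subset_left (Ioo_subset_Ioo_right ht.2)]
    rw [this]
    exact hK.restrict
  have e2 : (∫ x in Ω, w x * φ t x) - ∫ x in Ω, w x * φ 0 x
      = ∫ s in Ioo 0 t, ∫ x in Ω, w x * ψ s x := by
    rw [← integral_sub it i0, integral_congr_ae e1]
    exact (integral_integral_swap (f := fun (s : ℝ) (x : Eu N) => w x * ψ s x) hK').symm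
  rw [integral_Ioo_eq_interval ht.1] at e2
  linarith

/-- Separation of variables: a weak solution `w` of the elliptic problem gives the weak solution
`w(x) v(t)` of the parabolic problem, because `v' = |v|^{p-2} v`. -/
theorem IsEllipticSol.isParabolicSol [IsFiniteMeasure (leb Ω)] (hp1 : 1 < p) (hp2 : p < 2)
    (hΩ : IsOpen Ω) {h w : Eu N → ℝ} (hh : MemLp h ⊤ (leb Ω))
    (hw : IsEllipticSol p lam Ω h w) (T : ℝ) :
    IsParabolicSol p lam T Ω (fun t x => h x * (|profile p t| ^ (p - 2) * profile p t))
      (fun _ => 0) (fun t x => w x * profile p t) := by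
  set v := profile p with hv
  set g : ℝ → ℝ := fun t => |v t| ^ (p - 2) * v t with hg
  have hvc : Continuous v := continuous_profile hp2
  have hgc : Continuous g := (continuous_abs_rpow_mul hp1).comp hvc
  have hv0 : v 0 = 0 := profile_zero hp2
  obtain ⟨hwX, hsol⟩ := hw
  have hf : ∀ τ, MemLp (fun z : ℝ × Eu N => h z.2 * g z.1) ⊤ (cyl τ Ω) := fun τ => by
    have := memLp_cyl_smul hΩ hh hgc τ
    simpa only [smul_eq_mul, mul_comm] using this
  have hu : ∀ τ {q : ENNReal}, MemLp w q (leb Ω) →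
      MemLp (fun z : ℝ × Eu N => w z.2 * v z.1) q (cyl τ Ω) := fun τ q hq => by
    have := memLp_cyl_smul hΩ hq hvc τ
    simpa only [smul_eq_mul, mul_comm] using this
  have hG := fun τ => memLp_cyl_smul hΩ (hwX.memLp_weakGrad hΩ) hvc τ
  have hcomm : ∀ t, (fun x => w x * v t) = fun x => v t * w x := fun t => by
    ext x; exact mul_comm _ _
  refine ⟨hf T, memX_zero, ⟨fun t _ => ?_, fun t _ => ?_⟩, ?_, fun t x => v t • weakGrad Ω w x,
    ⟨hu T hwX.memLp, hG T, ae_of_all _ fun t => ?_⟩, ?_⟩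
  · simp only [hcomm]; exact hwX.2.const_mul _
  · have e : (fun s => eLpNorm (fun x => w x * v s - w x * v t) 2 (leb Ω))
        = fun s => ‖v s - v t‖ₑ * eLpNorm w 2 (leb Ω) := by
      ext s
      rw [← eLpNorm_const_smul]
      congr 1; ext x; simp only [Pi.smul_apply, smul_eq_mul]; ring
    rw [e]
    have h1 : Tendsto (fun s => ‖v s - v t‖ₑ) (𝓝[Icc 0 T] t) (𝓝 0) := by
      have : Tendsto (fun s => ‖v s - v t‖ₑ) (𝓝 t) (𝓝 ‖v t - v t‖ₑ) :=
        ((hvc.sub continuous_const).enorm).tendsto t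
      rw [sub_self, enorm_zero] at this
      exact this.mono_left nhdsWithin_le_nhds
    have := ENNReal.Tendsto.mul_const h1 (Or.inr hwX.2.2.ne)
    rwa [zero_mul] at this
  · exact ae_of_all _ fun x => by simp [hv0]
  · simp only [hcomm]; exact (hwX.isW0 hΩ).const_mul (v t)
  · intro τ hτ φ ψ Φ hφ hΦ
    have hτ0 : 0 < τ := hτ.1
    have i_uψ : Integrable (fun z : ℝ × Eu N => w z.2 * v z.1 * ψ z.1 z.2) (cyl τ Ω) :=
      (hu τ hwX.2).integrable_mul hφ.2.1
    have i_wψ : Integrable (fun z : ℝ × Eu N => w z.2 * ψ z.1 z.2) (cyl τ Ω) :=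
      (hwX.2.comp_snd _).integrable_mul hφ.2.1
    have i_uφ : Integrable (fun z : ℝ × Eu N => g z.1 * (w z.2 * φ z.1 z.2)) (cyl τ Ω) := by
      have h1 : MemLp (fun z : ℝ × Eu N => g z.1 • w z.2) 2 (cyl τ Ω) :=
        memLp_cyl_smul hΩ hwX.2 hgc τ
      refine (h1.integrable_mul hφ.1).congr (ae_of_all _ fun z => ?_)
      simp only [Pi.mul_apply, smul_eq_mul]; ring
    have i_flux : Integrable (fun z : ℝ × Eu N => ‖v z.1 • weakGrad Ω w z.2‖ ^ (p - 2)
        * inner ℝ (v z.1 • weakGrad Ω w z.2) (Φ z.1 z.2)) (cyl τ Ω) :=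
      integrable_flux hp1 (hG τ) hΦ.2.1
    have i_pow : Integrable (fun z : ℝ × Eu N => |w z.2 * v z.1| ^ (p - 2) * (w z.2 * v z.1)
        * φ z.1 z.2) (cyl τ Ω) := by
      simp only [abs_rpow_mul_mul_eq]
      exact integrable_flux hp1 (hu τ hwX.memLp) hΦ.1
    have i_src : Integrable (fun z : ℝ × Eu N => h z.2 * g z.1 * φ z.1 z.2) (cyl τ Ω) :=
      ((hf τ).mono_exponent (p := 2) le_top).integrable_mul hφ.1
    -- the space-time integrals as iterated integrals
    have e_uψ : ∫ z, w z.2 * v z.1 * ψ z.1 z.2 ∂(cyl τ Ω)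
        = ∫ t in Ioo 0 τ, v t * ∫ x in Ω, w x * ψ t x := by
      rw [cyl, integral_prod _ i_uψ]
      refine integral_congr_ae (ae_of_all _ fun t => ?_)
      simp only
      rw [← integral_const_mul]
      exact integral_congr_ae (ae_of_all _ fun x => by simp only; ring)
    have e_flux : ∫ z, ‖v z.1 • weakGrad Ω w z.2‖ ^ (p - 2)
        * inner ℝ (v z.1 • weakGrad Ω w z.2) (Φ z.1 z.2) ∂(cyl τ Ω)
        = ∫ t in Ioo 0 τ, g t * ∫ x in Ω, ‖weakGrad Ω w x‖ ^ (p - 2)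
          * inner ℝ (weakGrad Ω w x) (Φ t x) := by
      rw [cyl, integral_prod _ i_flux]
      refine integral_congr_ae (ae_of_all _ fun t => ?_)
      simp only [flux_smul, integral_const_mul, hg]
    have e_pow : ∫ z, |w z.2 * v z.1| ^ (p - 2) * (w z.2 * v z.1) * φ z.1 z.2 ∂(cyl τ Ω)
        = ∫ t in Ioo 0 τ, g t * ∫ x in Ω, |w x| ^ (p - 2) * w x * φ t x := by
      rw [cyl, integral_prod _ i_pow]
      refine integral_congr_ae (ae_of_all _ fun t => ?_)
      simp only
      rw [← integral_const_mul]
      refine integral_congr_ae (ae_of_all _ fun x => ?_)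
      simp only [hg]
      rw [abs_mul, Real.mul_rpow (abs_nonneg _) (abs_nonneg _)]
      ring
    have e_src : ∫ z, h z.2 * g z.1 * φ z.1 z.2 ∂(cyl τ Ω)
        = ∫ t in Ioo 0 τ, g t * ∫ x in Ω, h x * φ t x := by
      rw [cyl, integral_prod _ i_src]
      refine integral_congr_ae (ae_of_all _ fun t => ?_)
      simp only
      rw [← integral_const_mul]
      exact integral_congr_ae (ae_of_all _ fun x => by simp only; ring)
    have j_pow : IntegrableOn (fun t => g t * ∫ x in Ω, |w x| ^ (p - 2) * w x * φ t x)
        (Ioo 0 τ) := by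
      refine i_pow.integral_prod_left.congr (ae_of_all _ fun t => ?_)
      simp only
      rw [← integral_const_mul]
      refine integral_congr_ae (ae_of_all _ fun x => ?_)
      simp only [hg]
      rw [abs_mul, Real.mul_rpow (abs_nonneg _) (abs_nonneg _)]
      ring
    have j_src : IntegrableOn (fun t => g t * ∫ x in Ω, h x * φ t x) (Ioo 0 τ) := by
      refine i_src.integral_prod_left.congr (ae_of_all _ fun t => ?_)
      simp only
      rw [← integral_const_mul]
      exact integral_congr_ae (ae_of_all _ fun x => by simp only; ring)
    have j_uφ : IntegrableOn (fun t => g t * ∫ x in Ω, w x * φ t x) (Ioo 0 τ) := by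
      refine i_uφ.integral_prod_left.congr (ae_of_all _ fun t => ?_)
      simp only [integral_const_mul]
    have j_uψ : IntegrableOn (fun t => v t * ∫ x in Ω, w x * ψ t x) (Ioo 0 τ) := by
      refine i_uψ.integral_prod_left.congr (ae_of_all _ fun t => ?_)
      simp only
      rw [← integral_const_mul]
      exact integral_congr_ae (ae_of_all _ fun x => by simp only; ring)
    -- the elliptic equation tested with `φ(t)`, for almost every `t`
    have e_ell : ∫ t in Ioo 0 τ, g t * ∫ x in Ω, ‖weakGrad Ω w x‖ ^ (p - 2)
          * inner ℝ (weakGrad Ω w x) (Φ t x)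
        = lam * (∫ t in Ioo 0 τ, g t * ∫ x in Ω, |w x| ^ (p - 2) * w x * φ t x)
          - (∫ t in Ioo 0 τ, g t * ∫ x in Ω, w x * φ t x)
          + ∫ t in Ioo 0 τ, g t * ∫ x in Ω, h x * φ t x := by
      have j4 : IntegrableOn (fun t => lam * (g t * ∫ x in Ω, |w x| ^ (p - 2) * w x * φ t x)
          - g t * ∫ x in Ω, w x * φ t x) (Ioo 0 τ) := (j_pow.const_mul lam).sub j_uφ
      rw [← integral_const_mul, ← integral_sub (j_pow.const_mul lam) j_uφ,
        ← integral_add j4 j_src]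
      refine integral_congr_ae ?_
      filter_upwards [hΦ.2.2, ae_restrict_mem measurableSet_Ioo] with t h1 h2
      have hX : MemX p Ω (φ t) := ⟨⟨_, h1⟩, (hφ.2.2 t (Ioo_subset_Icc_self h2)).1⟩
      have h3 := hsol _ hX
      have h4 : ∫ x in Ω, ‖weakGrad Ω w x‖ ^ (p - 2) * inner ℝ (weakGrad Ω w x) (Φ t x)
          = ∫ x in Ω, ‖weakGrad Ω w x‖ ^ (p - 2)
            * inner ℝ (weakGrad Ω w x) (weakGrad Ω (φ t) x) := by
        refine integral_congr_ae ?_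
        filter_upwards [h1.1.weakGrad_ae_eq hΩ] with x hx
        rw [hx]
      rw [h4, h3]; ring
    -- integration by parts in time
    set a : ℝ → ℝ := fun t => ∫ x in Ω, w x * φ t x with ha
    set b : ℝ → ℝ := fun t => ∫ x in Ω, w x * ψ t x with hb
    have hbi : IntervalIntegrable b volume 0 τ := by
      rw [intervalIntegrable_iff_integrableOn_Ioo_of_le hτ0.le]
      exact i_wψ.integral_prod_left
    have hab : ∀ t ∈ Icc 0 τ, a t = a 0 + ∫ s in (0 : ℝ)..t, b s := fun t ht =>
      hφ.integral_mul_eq hτ0 hwX.2 i_wψ ht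
    have hvg : ∀ t, 0 ≤ t → ∫ s in (0 : ℝ)..t, g s = v t := fun t ht =>
      integral_profile_deriv hp1 hp2 ht
    have e_parts : (∫ t in Ioo 0 τ, g t * a t) + ∫ t in Ioo 0 τ, v t * b t = v τ * a τ := by
      rw [← integral_add j_uφ j_uψ, integral_Ioo_eq_interval hτ0.le]
      have h1 := integral_mul_primitive_add hgc hbi
      have h2 : ∫ t in (0 : ℝ)..τ, (g t * a t + v t * b t)
          = ∫ t in (0 : ℝ)..τ, (g t * a 0 + (g t * (∫ s in (0 : ℝ)..t, b s)
            + (∫ s in (0 : ℝ)..t, g s) * b t)) := by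
        refine intervalIntegral.integral_congr fun t ht => ?_
        rw [uIcc_of_le hτ0.le] at ht
        rw [hab t ht, hvg t ht.1]; ring
      have i1 : IntervalIntegrable (fun t => g t * a 0) volume 0 τ :=
        (hgc.mul continuous_const).intervalIntegrable _ _
      have i2 : IntervalIntegrable (fun t => g t * (∫ s in (0 : ℝ)..t, b s)
            + (∫ s in (0 : ℝ)..t, g s) * b t) volume 0 τ := by
        have j1 : IntervalIntegrable (fun t => g t * a t + v t * b t) volume 0 τ := by
          rw [intervalIntegrable_iff_integrableOn_Ioo_of_le hτ0.le]
          exact j_uφ.add j_uψ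
        refine (j1.sub i1).congr fun t ht => ?_
        rw [uIoc_of_le hτ0.le] at ht
        rw [hab t (Ioc_subset_Icc_self ht), hvg t ht.1.le]; ring
      rw [h2, intervalIntegral.integral_add i1 i2, h1, intervalIntegral.integral_mul_const,
        hvg τ hτ0.le, hab τ ⟨hτ0.le, le_rfl⟩]
      ring
    have e_end : ∫ x in Ω, w x * v τ * φ τ x = v τ * a τ := by
      rw [ha, ← integral_const_mul]
      exact integral_congr_ae (ae_of_all _ fun x => by simp only; ring)
    have e_start : ∫ x in Ω, w x * v 0 * φ 0 x = 0 := by simp [hv0]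
    have e_sum : ∫ z, (-(w z.2 * v z.1 * ψ z.1 z.2) + ‖v z.1 • weakGrad Ω w z.2‖ ^ (p - 2)
        * inner ℝ (v z.1 • weakGrad Ω w z.2) (Φ z.1 z.2)) ∂(cyl τ Ω)
        = -(∫ z, w z.2 * v z.1 * ψ z.1 z.2 ∂(cyl τ Ω)) + ∫ z, ‖v z.1 • weakGrad Ω w z.2‖ ^ (p - 2)
        * inner ℝ (v z.1 • weakGrad Ω w z.2) (Φ z.1 z.2) ∂(cyl τ Ω) := by
      have i_neg : Integrable (fun z : ℝ × Eu N => -(w z.2 * v z.1 * ψ z.1 z.2)) (cyl τ Ω) :=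
        i_uψ.neg
      rw [integral_add i_neg i_flux, integral_neg]
    simp only
    rw [e_end, e_start, e_sum, e_uψ, e_flux, e_ell, e_pow, e_src]
    linarith

end Parabolic

/-! ### Comparison of the two solutions -/

section Conclusion

variable {N : ℕ} {Ω : Set (Eu N)} {p lam : ℝ}

lemma energy_congr_ae (hΩ : IsOpen Ω) {h w w' : Eu N → ℝ} (hw : MemX p Ω w) (hw' : MemX p Ω w')
    (hww : w =ᵐ[leb Ω] w') : energy p lam Ω h w = energy p lam Ω h w' := by
  have hG := (hw.hasWeakGrad hΩ).ae_eq hΩ (hw'.hasWeakGrad hΩ) hww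
  have e1 : ∫ x in Ω, ‖weakGrad Ω w x‖ ^ p = ∫ x in Ω, ‖weakGrad Ω w' x‖ ^ p :=
    integral_congr_ae (by filter_upwards [hG] with x hx; rw [hx])
  have e2 : ∫ x in Ω, |w x| ^ p = ∫ x in Ω, |w' x| ^ p :=
    integral_congr_ae (by filter_upwards [hww] with x hx; rw [hx])
  have e3 : ∫ x in Ω, |w x| ^ 2 = ∫ x in Ω, |w' x| ^ 2 :=
    integral_congr_ae (by filter_upwards [hww] with x hx; rw [hx])
  have e4 : ∫ x in Ω, h x * w x = ∫ x in Ω, h x * w' x :=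
    integral_congr_ae (by filter_upwards [hww] with x hx; rw [hx])
  rw [energy, energy, e1, e2, e3, e4]

lemma IsGlobalMinimizer.isLocalMinimizer_of_ae_eq (hp : 1 < p) (hΩ : IsOpen Ω)
    {h w w' : Eu N → ℝ} (hw : MemX p Ω w) (hmin : IsGlobalMinimizer p lam Ω h w')
    (hww : w =ᵐ[leb Ω] w') : IsLocalMinimizer p lam Ω h w :=
  ⟨hw, 1, one_pos, fun _ hφ _ => (energy_congr_ae hΩ hw hmin.1 hww).trans_le
    (hmin.2 _ (hw.add hp hφ))⟩

/-- The zero function solves the elliptic problem only for the zero source: tested with `φ`, the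
weak equation reads `∫ h φ = 0`. -/
lemma IsEllipticSol.not_ae_eq_zero (hΩ : IsOpen Ω) {h w : Eu N → ℝ} (hh : Continuous h)
    (hw : IsEllipticSol p lam Ω h w) {y : Eu N} (hy : y ∈ Ω) (hhy : h y ≠ 0) :
    ¬ w =ᵐ[leb Ω] 0 := by
  intro h0
  have hG : weakGrad Ω w =ᵐ[leb Ω] fun _ => 0 := by
    have hz : HasWeakGrad Ω (fun _ : Eu N => (0 : ℝ)) (fun _ => 0) :=
      ⟨(locallyIntegrable_zero).locallyIntegrableOn _,
        (locallyIntegrable_zero).locallyIntegrableOn _, fun φ _ => by simp⟩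
    exact (hw.1.hasWeakGrad hΩ).ae_eq hΩ hz h0
  have key := hΩ.ae_eq_zero_of_integral_contDiff_smul_eq_zero (μ := volume)
    (hh.locallyIntegrable.locallyIntegrableOn Ω) (fun φ h1 h2 h3 => by
      have hφ : IsTestFn Ω φ := ⟨h1, h2, h3⟩
      have := hw.2 φ (MemX.of_testFn hφ)
      have e1 : ∫ x in Ω, ‖weakGrad Ω w x‖ ^ (p - 2) * inner ℝ (weakGrad Ω w x) (weakGrad Ω φ x)
          = 0 := integral_eq_zero_of_ae (by filter_upwards [hG] with x hx; simp [hx])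
      have e2 : ∫ x in Ω, |w x| ^ (p - 2) * w x * φ x = 0 :=
        integral_eq_zero_of_ae (by filter_upwards [h0] with x hx; simp [hx])
      have e3 : ∫ x in Ω, w x * φ x = 0 :=
        integral_eq_zero_of_ae (by filter_upwards [h0] with x hx; simp [hx])
      rw [e1, e2, e3, mul_zero, sub_zero, zero_add] at this
      rw [this, setIntegral_eq_integral_of_forall_compl_eq_zero fun x hx => by
        rw [hφ.eq_zero hx, mul_zero]]
      exact integral_congr_ae (ae_of_all _ fun x => mul_comm _ _))
  have hU : IsOpen (Ω ∩ {x | h x ≠ 0}) := hΩ.inter (isOpen_ne_fun hh continuous_const)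
  refine (hU.measure_pos volume ⟨y, hy, hhy⟩).ne' ?_
  refine measure_mono_null (fun x hx => ?_) key
  exact fun hk => hx.2 (hk hx.1)

lemma pLaplacian_eq_zero_of_eventuallyEq_const {w : Eu N → ℝ} {y : Eu N} {c : ℝ}
    (hw : w =ᶠ[𝓝 y] fun _ => c) : pLaplacian p w y = 0 := by
  have h1 : pFlux p w =ᶠ[𝓝 y] fun _ => 0 := by
    filter_upwards [hw.eventuallyEq_nhds] with x hx
    rw [pFlux, gradient, hx.fderiv_eq]
    simp
  simp [pLaplacian, h1.fderiv_eq]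

/-- On an open set where `w` is constant the source is an explicit function of the value of `w`. -/
lemma ellipticSource_of_eventuallyEq_const {w : Eu N → ℝ} {y : Eu N} {c : ℝ}
    (hw : w =ᶠ[𝓝 y] fun _ => c) : ellipticSource p lam w y = c - lam * (|c| ^ (p - 2) * c) := by
  rw [ellipticSource, pLaplacian_eq_zero_of_eventuallyEq_const hw, hw.self_of_nhds]
  ring

lemma memLp_top_of_continuous (hΩb : Bornology.IsBounded Ω) (hΩ : IsOpen Ω) {h : Eu N → ℝ}
    (hh : Continuous h) : MemLp h ⊤ (leb Ω) := by
  obtain ⟨C, hC⟩ := hΩb.isCompact_closure.exists_bound_of_continuousOn hh.continuousOn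
  refine memLp_top_of_bound hh.aestronglyMeasurable C ?_
  filter_upwards [ae_restrict_mem hΩ.measurableSet] with x hx
  exact hC x (subset_closure hx)

/-- Products with the positive time profile determine the spatial factor. -/
lemma ae_eq_of_ae_cyl (hp2 : p < 2) {T : ℝ} (hT : 0 < T) {w w' : Eu N → ℝ}
    (h : ∀ᵐ z ∂(cyl T Ω), w z.2 * profile p z.1 = w' z.2 * profile p z.1) :
    w =ᵐ[leb Ω] w' := by
  have h1 := Measure.ae_ae_of_ae_prod h
  have hne : (ae (volume.restrict (Ioo (0 : ℝ) T))).NeBot := by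
    rw [ae_neBot, Ne, Measure.restrict_eq_zero, Real.volume_Ioo]
    simpa using hT
  obtain ⟨t, ht, ht'⟩ := (h1.and (ae_restrict_mem measurableSet_Ioo)).exists
  filter_upwards [ht] with x hx
  exact mul_right_cancel₀ (profile_pos hp2 ht'.1).ne' hx

end Conclusion

end PLap

theorem mainTheorem9 (N : ℕ) (hN : 1 ≤ N) (Ω : Set (PLap.Eu N)) (hΩo : IsOpen Ω)
    (hΩc : IsConnected Ω) (hΩb : Bornology.IsBounded Ω)
    (p lam : ℝ) (hp1 : 1 < p) (hp2 : p < 2) (hlam : 0 < lam) :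
    -- the function `v` is a positive solution of `v' = |v|^{p-2} v`, `v(0) = 0`
    (PLap.profile p 0 = 0 ∧ ContinuousOn (PLap.profile p) (Ici 0) ∧
      ∀ t > 0, 0 < PLap.profile p t ∧
        HasDerivAt (PLap.profile p) (|PLap.profile p t| ^ (p - 2) * PLap.profile p t) t) ∧
    ∃ h w₀ w₁ : PLap.Eu N → ℝ,
      -- `h` is continuous on the closure of `Ω` and changes sign in `Ω`
      ContinuousOn h (closure Ω) ∧ (∃ x ∈ Ω, h x < 0) ∧ (∃ y ∈ Ω, 0 < h y) ∧
      -- `w₀` is a nontrivial classical solution with compact support in `Ω`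
      ContDiff ℝ 2 w₀ ∧ HasCompactSupport w₀ ∧ tsupport w₀ ⊆ Ω ∧
      (∀ x ∈ Ω, DifferentiableAt ℝ (PLap.pFlux p w₀) x ∧
        - PLap.pLaplacian p w₀ x = lam * (|w₀ x| ^ (p - 2) * w₀ x) - w₀ x + h x) ∧
      ¬ (w₀ =ᵐ[PLap.leb Ω] 0) ∧
      -- `w₀` is a weak solution and a critical point, but not even a local minimizer
      PLap.IsEllipticSol p lam Ω h w₀ ∧ PLap.IsCriticalPt p lam Ω h w₀ ∧
      ¬ PLap.IsLocalMinimizer p lam Ω h w₀ ∧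
      -- `w₁` is a nontrivial weak solution and a global minimizer
      PLap.IsEllipticSol p lam Ω h w₁ ∧ PLap.IsCriticalPt p lam Ω h w₁ ∧
      PLap.IsGlobalMinimizer p lam Ω h w₁ ∧
      ¬ (w₁ =ᵐ[PLap.leb Ω] 0) ∧
      -- the two solutions are different
      ¬ (w₀ =ᵐ[PLap.leb Ω] w₁) ∧
      -- nonuniqueness for the parabolic problem and failure of the comparison principle
      ∀ T > 0,
        PLap.IsParabolicSol p lam T Ω
          (fun t x => h x * (|PLap.profile p t| ^ (p - 2) * PLap.profile p t))
          (fun _ => 0) (fun t x => w₀ x * PLap.profile p t) ∧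
        PLap.IsParabolicSol p lam T Ω
          (fun t x => h x * (|PLap.profile p t| ^ (p - 2) * PLap.profile p t))
          (fun _ => 0) (fun t x => w₁ x * PLap.profile p t) ∧
        ¬ (∀ᵐ z ∂(PLap.cyl T Ω),
            w₀ z.2 * PLap.profile p z.1 = w₁ z.2 * PLap.profile p z.1) ∧
        ¬ PLap.WeakComparisonPrinciple p lam T Ω := by
  open PLap in
  refine ⟨⟨profile_zero hp2, (continuous_profile hp2).continuousOn, fun t ht =>
    ⟨profile_pos hp2 ht, hasDerivAt_profile hp1 hp2 ht⟩⟩, ?_⟩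
  have : IsFiniteMeasure (leb Ω) := ⟨by
    rw [Measure.restrict_apply_univ]; exact hΩb.measure_lt_top⟩
  -- the plateau height is chosen so that `c ^ (2 - p) > lam`, which makes the source
  -- `c - lam * c ^ (p - 1)` positive on the upper plateau
  set c : ℝ := (lam + 1) ^ (1 / (2 - p)) with hc
  have hc0 : 0 < c := Real.rpow_pos_of_pos (by linarith) _
  have hcl : 0 < c - lam * (|c| ^ (p - 2) * c) := by
    have h1 : c ^ (2 - p) = lam + 1 := by
      rw [hc, ← Real.rpow_mul (by linarith), one_div_mul_cancel (by linarith), Real.rpow_one]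
    have h2 : c ^ (2 - p) * c ^ (p - 2) = 1 := by
      rw [← Real.rpow_add hc0]; simp
    rw [abs_of_pos hc0]
    have h3 : 0 < c ^ (p - 2) := Real.rpow_pos_of_pos hc0 _
    rw [h1] at h2
    have h4 : c - lam * (c ^ (p - 2) * c) = c ^ (p - 2) * c := by linear_combination (-c) * h2
    rw [h4]
    positivity
  obtain ⟨w₀, φ, U, C, hw, hφ, hF, ⟨y₁, hy₁, hw₁⟩, ⟨y₂, hy₂, hw₂⟩, hC, hU, hUΩ, hU0, hwU, hφU⟩ :=
    exists_classical_candidate hN hΩo hΩc.nonempty hp1 hc0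
  set h := ellipticSource p lam w₀ with hh
  have hhc : Continuous h := continuous_ellipticSource hp1 hw hF
  have hhT : MemLp h ⊤ (leb Ω) := memLp_top_of_continuous hΩb hΩo hhc
  have hh2 : MemLp h 2 (leb Ω) := hhT.mono_exponent le_top
  have hpos : 0 < h y₁ := by
    rwa [hh, ellipticSource_of_eventuallyEq_const hw₁]
  have hneg : h y₂ < 0 := by
    rw [hh, ellipticSource_of_eventuallyEq_const hw₂, abs_rpow_mul_neg]
    linarith
  have hsol₀ : IsEllipticSol p lam Ω h w₀ := isEllipticSol_ellipticSource hp1 hΩo hw hF hh2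
  have hloc : ¬ IsLocalMinimizer p lam Ω h w₀ :=
    not_isLocalMinimizer hp1 hp2 hlam hΩo hh2 hw hsol₀ hφ hC hU hUΩ hU0 hwU hφU
  obtain ⟨w₁, hmin⟩ := exists_isGlobalMinimizer hp1 hp2 hlam hΩo hh2
  have hsol₁ := hmin.isEllipticSol hp1 hp2 hlam hΩo hh2
  have hne : ¬ w₀ =ᵐ[leb Ω] w₁ := fun he =>
    hloc (hmin.isLocalMinimizer_of_ae_eq hp1 hΩo hsol₀.1 he)
  refine ⟨h, w₀, w₁, hhc.continuousOn, ⟨y₂, hy₂, hneg⟩, ⟨y₁, hy₁, hpos⟩,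
    (contDiff_infty.1 hw.1) 2, hw.2.1, hw.2.2, fun x _ => ⟨(hF.differentiable (by simp)) x, ?_⟩,
    hsol₀.not_ae_eq_zero hΩo hhc hy₁ hpos.ne', hsol₀, hsol₀.isCriticalPt hp1 hp2 hlam hΩo hh2,
    hloc, hsol₁, hsol₁.isCriticalPt hp1 hp2 hlam hΩo hh2, hmin,
    hsol₁.not_ae_eq_zero hΩo hhc hy₁ hpos.ne', hne, fun T hT => ?_⟩
  · rw [hh, ellipticSource]
    ring
  · have hu₀ := hsol₀.isParabolicSol hp1 hp2 hΩo hhT T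
    have hu₁ := hsol₁.isParabolicSol hp1 hp2 hΩo hhT T
    refine ⟨hu₀, hu₁, fun he => hne (ae_eq_of_ae_cyl hp2 hT he), fun hcomp => ?_⟩
    -- the data coincide, so the comparison principle would order the solutions both ways
    have h01 := hcomp _ _ _ _ _ _ hu₀ hu₁ (ae_of_all _ fun _ => le_rfl)
      (ae_of_all _ fun _ => le_rfl)
    have h10 := hcomp _ _ _ _ _ _ hu₁ hu₀ (ae_of_all _ fun _ => le_rfl)
      (ae_of_all _ fun _ => le_rfl)
    refine hne (ae_eq_of_ae_cyl hp2 hT ?_)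
    filter_upwards [h01, h10] with z hz hz'
    exact le_antisymm hz hz'
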